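/- Let $n\ge 2$ and let $\Omega\subset\mathbb{R}^n$ be a bounded Lipschitz domain (a nonempty bounded open set which near each boundary point is, after a rotation, the region on one side of the graph of a Lipschitz function; connectedness is not needed). Let $0<\lambda_1(\Omega)\le\lambda_2(\Omega)\le\cdots$ be the eigenvalues of the Dirichlet Laplacian on $\Omega$, repeated according to multiplicity. Let $|\Omega|$ be the Lebesgue measure of $\Omega$, $|\partial\Omega|$ the surface area of $\partial\Omega$, $\omega(n)$ the volume of the unit ball of $\mathbb{R}^n$, $\mathrm{diam}(\Omega)$ the diameter, and $\mathrm{width}(\Omega)$ the minimal distance between two parallel hyperplanes having $\Omega$ between them. Let $C_{Lip}(\Omega)\ge 1$ be the least constant $C\ge 1$ such that $$|\{x\in\mathbb{R}^n:\ \mathrm{dist}(x,\partial\Omega)\le t\}|\le C\,t\,|\partial\Omega|\qquad\text{for all } 0<t<\mathrm{width}(\Omega).$$ Let $0<\varepsilon<1$. There is a unique $\Lambda=\Lambda(\varepsilon,\Omega)\ge \mathrm{width}(\Omega)^{-2}$ such that $$\frac{2n\,\mathrm{diam}(\Omega)^{n-1}+|\partial\Omega|}{|\Omega|\sqrt{\Lambda}}\;C_{Lip}(\Omega)\left(\frac{\pi}{2}+5n^2\pi\log_2\frac{10\,\mathrm{width}(\Omega)\sqrt{\Lambda}}{\pi}\right)=\varepsilon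 ,$$ and for every $k\ge 1$ with $\lambda_k(\Omega)\ge\Lambda(\varepsilon,\Omega)$, $$k\le (1+\varepsilon)\frac{|\Omega|\,\omega(n)}{(2\pi)^n}\,\lambda_k(\Omega)^{n/2}.$$ Moreover, if $\Omega$ is convex, then there is a unique $\Lambda_c\ge\mathrm{width}(\Omega)^{-2}$ such that $$\frac{2n\,\mathrm{diam}(\Omega)^{n-1}}{|\Omega|\sqrt{\Lambda_c}}\left(\frac{\pi}{2}+5n^2\pi\log_2\frac{10\,\mathrm{width}(\Omega)\sqrt{\Lambda_c}}{\pi}\right)=\varepsilon ,$$ it satisfies $\Lambda_c<\Lambda(\varepsilon,\Omega)$, and the same bound on $k$ holds for every $k\ge 1$ with $\lambda_k(\Omega)\ge\Lambda_c$. -/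

import Mathlib

open MeasureTheory Set
open scoped ContDiff

noncomputable section

namespace DirichletPolya

/-- Euclidean space `ℝⁿ`. -/
abbrev E (n : ℕ) : Type := EuclideanSpace ℝ (Fin n)

/-- A bounded Lipschitz domain: a nonempty bounded open set such that near each boundary point `p`,
for a suitable unit vector `ν`, it is the set of points lying strictly below the graph of a
Lipschitz function over the hyperplane orthogonal to `ν`.  Here `x - ⟪ν, x⟫ ν` is the orthogonal
projection of `x` to that hyperplane, and only the values of `g` on the hyperplane matter.
Connectedness is not required. -/
structure IsBoundedLipschitzDomain {n : ℕ} (Ω : Set (E n)) : Prop where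
  nonempty : Ω.Nonempty
  isOpen : IsOpen Ω
  isBounded : Bornology.IsBounded Ω
  graph : ∀ p ∈ frontier Ω, ∃ ν : E n, ‖ν‖ = 1 ∧ ∃ (g : E n → ℝ) (K : NNReal) (r : ℝ),
    LipschitzWith K g ∧ 0 < r ∧
      ∀ x ∈ Metric.ball p r, (x ∈ Ω ↔ inner ℝ ν x < g (x - inner ℝ ν x • ν))

/-- The Lebesgue measure `|Ω|`. -/
def vol {n : ℕ} (Ω : Set (E n)) : ℝ := (volume Ω).toReal

/-- The volume `ω(n)` of the unit ball of `ℝⁿ`. -/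
def unitBallVol (n : ℕ) : ℝ := vol (Metric.ball (0 : E n) 1)

/-- The surface area `|∂Ω|`: the `(n-1)`-dimensional Hausdorff measure, with the Euclidean
normalization, of the topological boundary (used for `n ≥ 2`). -/
def surfaceArea {n : ℕ} (Ω : Set (E n)) : ℝ :=
  (Measure.euclideanHausdorffMeasure (n - 1) (frontier Ω)).toReal

/-- The width: the minimal distance `d` between two parallel hyperplanes
`{⟪ν, x⟫ = a}` and `{⟪ν, x⟫ = a + d}` with `Ω` between them. -/
def width {n : ℕ} (Ω : Set (E n)) : ℝ :=
  sInf {d : ℝ | ∃ (ν : E n) (a : ℝ), ‖ν‖ = 1 ∧ ∀ x ∈ Ω, a ≤ inner ℝ ν x ∧ inner ℝ ν x ≤ a + d}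

/-- `C_Lip(Ω)`: the least constant `C ≥ 1` such that
`|{x ∈ ℝⁿ : dist(x, ∂Ω) ≤ t}| ≤ C t |∂Ω|` for all `0 < t < width(Ω)`. -/
def lipConst {n : ℕ} (Ω : Set (E n)) : ℝ :=
  sInf {C : ℝ | 1 ≤ C ∧ ∀ t : ℝ, 0 < t → t < width Ω →
    vol {x : E n | Metric.infDist x (frontier Ω) ≤ t} ≤ C * t * surfaceArea Ω}

/-- `H¹₀(Ω)`, as the closure in `L² × L²` of the pairs `(φ, ∇φ)` with `φ ∈ C_c^∞(Ω)`.
Functions on `Ω` are extended by zero to `ℝⁿ`; an element is a pair `(u, ∇u)`. -/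
def H10 {n : ℕ} (Ω : Set (E n)) :
    Submodule ℝ (Lp ℝ 2 (volume : Measure (E n)) × Lp (E n) 2 (volume : Measure (E n))) :=
  (Submodule.span ℝ {p | ∃ φ : E n → ℝ, ContDiff ℝ ∞ φ ∧ HasCompactSupport φ ∧ tsupport φ ⊆ Ω ∧
    p.1 =ᵐ[volume] φ ∧ p.2 =ᵐ[volume] gradient φ}).topologicalClosure

/-- The eigenspace of the Dirichlet Laplacian for the value `μ`: all `u ∈ H¹₀(Ω)` with
`∫ ∇u · ∇v = μ ∫ u v` for all `v ∈ H¹₀(Ω)`, that is, the weak solutions of `-Δu = μ u`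
with zero boundary values. -/
def eigenspace {n : ℕ} (Ω : Set (E n)) (μ : ℝ) :
    Submodule ℝ (Lp ℝ 2 (volume : Measure (E n)) × Lp (E n) 2 (volume : Measure (E n))) where
  carrier := {p | p ∈ H10 Ω ∧ ∀ q ∈ H10 Ω, inner ℝ p.2 q.2 = μ * inner ℝ p.1 q.1}
  add_mem' := by
    rintro a b ⟨ha, ha'⟩ ⟨hb, hb'⟩
    refine ⟨add_mem ha hb, fun q hq => ?_⟩
    simp only [Prod.snd_add, Prod.fst_add, inner_add_left, ha' q hq, hb' q hq]
    ring
  zero_mem' := ⟨zero_mem _, fun q _ => by simp⟩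
  smul_mem' := by
    rintro c a ⟨ha, ha'⟩
    refine ⟨Submodule.smul_mem _ c ha, fun q hq => ?_⟩
    simp only [Prod.smul_snd, Prod.smul_fst, real_inner_smul_left, ha' q hq]
    ring

/-- The number, counted with multiplicity, of Dirichlet eigenvalues `≤ t`: the dimension of the
(direct) sum of the eigenspaces for the values `μ ≤ t`. -/
def eigenvalueCount {n : ℕ} (Ω : Set (E n)) (t : ℝ) : Cardinal :=
  Module.rank ℝ ↥(⨆ (μ : ℝ) (_ : μ ≤ t), eigenspace Ω μ)

/-- The `k`-th Dirichlet eigenvalue `λ_k(Ω)`, `k ≥ 1`, of the increasing enumeration with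
multiplicity: the least `t` such that at least `k` eigenvalues are `≤ t`. -/
def dirichletEigenvalue {n : ℕ} (Ω : Set (E n)) (k : ℕ) : ℝ :=
  sInf {t : ℝ | (k : Cardinal) ≤ eigenvalueCount Ω t}

/-- The factor `π/2 + 5 n² π log₂(10 width(Ω) √Λ / π)`. -/
def logFactor {n : ℕ} (Ω : Set (E n)) (Λ : ℝ) : ℝ :=
  Real.pi / 2 + 5 * (n : ℝ) ^ 2 * Real.pi *
    Real.logb 2 (10 * width Ω * Real.sqrt Λ / Real.pi)

/-- `Λ` is the threshold `Λ(ε, Ω)` of a bounded Lipschitz domain. -/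
def IsThreshold {n : ℕ} (Ω : Set (E n)) (ε Λ : ℝ) : Prop :=
  1 / width Ω ^ 2 ≤ Λ ∧
    (2 * (n : ℝ) * Metric.diam Ω ^ (n - 1) + surfaceArea Ω) / (vol Ω * Real.sqrt Λ) *
      lipConst Ω * logFactor Ω Λ = ε

/-- `Λ` is the smaller threshold available for a convex domain. -/
def IsConvexThreshold {n : ℕ} (Ω : Set (E n)) (ε Λ : ℝ) : Prop :=
  1 / width Ω ^ 2 ≤ Λ ∧
    2 * (n : ℝ) * Metric.diam Ω ^ (n - 1) / (vol Ω * Real.sqrt Λ) * logFactor Ω Λ = ε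

/-- Pólya's conjecture up to an `ε`-loss for all Dirichlet eigenvalues `λ_k(Ω) ≥ Λ`. -/
def PolyaUpToLoss {n : ℕ} (Ω : Set (E n)) (ε Λ : ℝ) : Prop :=
  ∀ k : ℕ, 1 ≤ k → Λ ≤ dirichletEigenvalue Ω k →
    (k : ℝ) ≤ (1 + ε) * (vol Ω * unitBallVol n / (2 * Real.pi) ^ n) *
      dirichletEigenvalue Ω k ^ ((n : ℝ) / 2)

end DirichletPolya

end

noncomputable section

namespace DirichletPolya

/-! ### Orthogonal systems of continuous functions on a compact set -/

/-! The bound is Dirichlet–Neumann bracketing on a Whitney-type decomposition. `Ω` is covered by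
disjoint half-open cubes: the maximal dyadic cubes inside `Ω` of sides `2 ^ j * s`, `j ≤ J`, and the
cubes of the least side `s` that meet `Ω` without lying in it. On a cube of side `ℓ`, a function
orthogonal to all cosine products with `|m| ≤ ρ = ℓR/π` has Dirichlet energy at least `R²` times its
squared norm (`neumann_cube_ineq`). A sum of eigenfunctions with values `≤ t < R²` has energy at
most `t` times its squared norm, so it vanishes once it is orthogonal to these cosines on every
cube. Hence the cosines are at least as many as the Dirichlet eigenvalues `≤ t`
(`eigenvalueCount_le`); only linear algebra is used, no compactness.

A cube has at most `ω(n) 2⁻ⁿ (ρ + √n)ⁿ` such cosines (`card_freq_le`): a main part proportional to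
`ℓⁿ Rⁿ` and an error of order `ℓⁿ⁻¹ Rⁿ⁻¹`. The main parts of the inner cubes add up to at most the
Weyl term. A maximal cube of scale `j < J` has a parent that leaves `Ω`, so it lies in a boundary
strip of width of order `2 ^ j * s`. If strips have volume linear in their width, each scale
contributes the same error, and the `J` scales produce the logarithm. Since `s` is comparable to
`1/R`, each boundary cube has a bounded number of cosines, and these cubes also contribute order
`Rⁿ⁻¹` (`eigenvalueCount_le_of_strips`).

Strip volumes come from the definition of `lipConst`, or, for convex `Ω`, from the bound `2 n t
diam(Ω)ⁿ⁻¹` proved by packing disjoint translates (`exists_eroded`). The threshold equation says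
that the total error is at most `ε` times the Weyl term; its left side decreases strictly from a
value `≥ 1` to `0`, which gives existence and uniqueness. Letting `R` decrease to `√λ_k` turns the
count into the bound on `k`. -/

theorem integral_sq_sub_sum {α ι : Type*} [TopologicalSpace α] [T2Space α] [MeasurableSpace α]
    [OpensMeasurableSpace α] (μ : Measure α) [IsFiniteMeasureOnCompacts μ] {K : Set α}
    (hK : IsCompact K) (f : α → ℝ) (hf : Continuous f) (ψ : ι → α → ℝ) (hψ : ∀ m, Continuous (ψ m))
    (q : ι → ℝ) (F : Finset ι) (hq : ∀ m ∈ F, ∫ x in K, ψ m x * ψ m x ∂μ = q m)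
    (ho : ∀ m ∈ F, ∀ m' ∈ F, m ≠ m' → ∫ x in K, ψ m x * ψ m' x ∂μ = 0) (b : ι → ℝ) :
    ∫ x in K, (f x - ∑ m ∈ F, b m * ψ m x) ^ 2 ∂μ =
      (∫ x in K, f x ^ 2 ∂μ) - 2 * ∑ m ∈ F, b m * (∫ x in K, f x * ψ m x ∂μ)
        + ∑ m ∈ F, b m ^ 2 * q m := by
  have hint : ∀ g : α → ℝ, Continuous g → Integrable g (μ.restrict K) :=
    fun g hg => hg.continuousOn.integrableOn_compact hK
  have h1 : ∀ x, (f x - ∑ m ∈ F, b m * ψ m x) ^ 2 = f x ^ 2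
      - (∑ m ∈ F, (2 * b m) * (f x * ψ m x))
      + ∑ m ∈ F, ∑ m' ∈ F, (b m * b m') * (ψ m x * ψ m' x) := by
    intro x
    have : (∑ m ∈ F, ∑ m' ∈ F, (b m * b m') * (ψ m x * ψ m' x)) =
        (∑ m ∈ F, b m * ψ m x) * (∑ m ∈ F, b m * ψ m x) := by
      rw [Finset.sum_mul_sum]
      exact Finset.sum_congr rfl fun m _ => Finset.sum_congr rfl fun m' _ => by ring
    rw [this]
    have : (∑ m ∈ F, (2 * b m) * (f x * ψ m x)) = 2 * f x * ∑ m ∈ F, b m * ψ m x := by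
      rw [Finset.mul_sum]; exact Finset.sum_congr rfl fun m _ => by ring
    rw [this]; ring
  simp_rw [h1]
  rw [integral_add (hint _ (by fun_prop)) (hint _ (by fun_prop)),
    integral_sub (hint _ (by fun_prop)) (hint _ (by fun_prop)),
    integral_finsetSum _ (fun m _ => hint _ (by fun_prop)),
    integral_finsetSum _ (fun m _ => hint _ (by fun_prop))]
  congr 1
  · congr 1
    rw [Finset.mul_sum]
    exact Finset.sum_congr rfl fun m _ => by rw [integral_const_mul]; ring
  · refine Finset.sum_congr rfl fun m hm => ?_
    rw [integral_finsetSum _ (fun m _ => hint _ (by fun_prop))]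
    rw [Finset.sum_eq_single_of_mem m hm]
    · rw [integral_const_mul, hq m hm]; ring
    · intro m' hm' hne
      rw [integral_const_mul, ho m hm m' hm' hne.symm, mul_zero]

/-! ### One-dimensional trigonometric integrals -/

theorem integral_cos_int_mul_of_ne_zero (a s : ℝ) (hs : 0 < s) (k : ℤ) (hk : k ≠ 0) :
    ∫ x in Icc a (a + s), Real.cos (k * (Real.pi / s * (x - a))) = 0 := by
  rw [integral_Icc_eq_integral_Ioc, ← intervalIntegral.integral_of_le (by linarith)]
  have hc : (k : ℝ) * (Real.pi / s) ≠ 0 := by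
    have : (k : ℝ) ≠ 0 := by exact_mod_cast hk
    have := Real.pi_pos
    positivity
  have h : ∀ x : ℝ, (k : ℝ) * (Real.pi / s * (x - a)) =
      (k : ℝ) * (Real.pi / s) * x - (k : ℝ) * (Real.pi / s) * a := fun x => by ring
  simp_rw [h]
  rw [intervalIntegral.integral_comp_mul_sub (fun x => Real.cos x) hc]
  have : (k : ℝ) * (Real.pi / s) * (a + s) - k * (Real.pi / s) * a = k * Real.pi := by
    field_simp; ring
  rw [this]
  simp

theorem integral_cos_int_mul (a s : ℝ) (hs : 0 < s) (k : ℤ) :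
    ∫ x in Icc a (a + s), Real.cos (k * (Real.pi / s * (x - a))) = if k = 0 then s else 0 := by
  split_ifs with h
  · simp [h, hs.le]
  · exact integral_cos_int_mul_of_ne_zero a s hs k h

/-- The squared `L²` norm of `cos (k π x)` on an interval of length `s`. -/
def cosNormSq (s : ℝ) (k : ℕ) : ℝ := if k = 0 then s else s / 2

theorem cosNormSq_pos {s : ℝ} (hs : 0 < s) (k : ℕ) : 0 < cosNormSq s k := by
  unfold cosNormSq; split_ifs <;> linarith

theorem integral_cos_mul_cos (a s : ℝ) (hs : 0 < s) (k l : ℕ) :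
    ∫ x in Icc a (a + s), Real.cos (k * (Real.pi / s * (x - a))) *
      Real.cos (l * (Real.pi / s * (x - a))) = if k = l then cosNormSq s k else 0 := by
  have h : ∀ x : ℝ, Real.cos (k * (Real.pi / s * (x - a))) *
      Real.cos (l * (Real.pi / s * (x - a))) =
      (1 / 2) * (Real.cos (((k : ℤ) - (l : ℤ) : ℤ) * (Real.pi / s * (x - a)))
        + Real.cos (((k : ℤ) + (l : ℤ) : ℤ) * (Real.pi / s * (x - a)))) := by
    intro x
    push_cast
    rw [sub_mul, add_mul, Real.cos_sub, Real.cos_add]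
    ring
  simp_rw [h]
  have hint : ∀ k : ℤ, IntegrableOn (fun x => Real.cos (k * (Real.pi / s * (x - a))))
      (Icc a (a + s)) volume :=
    fun k => Continuous.integrableOn_Icc (by fun_prop)
  rw [integral_const_mul, integral_add (hint _) (hint _), integral_cos_int_mul a s hs,
    integral_cos_int_mul a s hs]
  unfold cosNormSq
  by_cases hkl : k = l
  · subst hkl
    by_cases hk : k = 0
    · subst hk; simp; ring
    · have : ((k : ℤ) + (k : ℤ)) ≠ 0 := by omega
      simp [hk]; ring
  · have h1 : ((k : ℤ) - (l : ℤ)) ≠ 0 := by omega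
    have h2 : ((k : ℤ) + (l : ℤ)) ≠ 0 := by omega
    simp only [h1, h2, hkl, if_false]; ring

theorem integral_sin_mul_sin (a s : ℝ) (hs : 0 < s) (k l : ℕ) (hk0 : k ≠ 0) :
    ∫ x in Icc a (a + s), Real.sin (k * (Real.pi / s * (x - a))) *
      Real.sin (l * (Real.pi / s * (x - a))) = if k = l then cosNormSq s k else 0 := by
  have h : ∀ x : ℝ, Real.sin (k * (Real.pi / s * (x - a))) *
      Real.sin (l * (Real.pi / s * (x - a))) =
      (1 / 2) * (Real.cos (((k : ℤ) - (l : ℤ) : ℤ) * (Real.pi / s * (x - a)))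
        - Real.cos (((k : ℤ) + (l : ℤ) : ℤ) * (Real.pi / s * (x - a)))) := by
    intro x
    push_cast
    rw [sub_mul, add_mul, Real.cos_sub, Real.cos_add]
    ring
  simp_rw [h]
  have hint : ∀ k : ℤ, IntegrableOn (fun x => Real.cos (k * (Real.pi / s * (x - a))))
      (Icc a (a + s)) volume :=
    fun k => Continuous.integrableOn_Icc (by fun_prop)
  rw [integral_const_mul, integral_sub (hint _) (hint _), integral_cos_int_mul a s hs,
    integral_cos_int_mul a s hs]
  unfold cosNormSq
  have h2 : ((k : ℤ) + (l : ℤ)) ≠ 0 := by omega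
  by_cases hkl : k = l
  · subst hkl
    simp [hk0]; ring
  · have h1 : ((k : ℤ) - (l : ℤ)) ≠ 0 := by omega
    simp only [h1, h2, hkl, if_false]; ring

/-! ### Products of cosines on a cube -/

/-- The (unnormalized) Neumann eigenfunction of index `m` of the cube with corner `a`, side `s`. -/
def cosProd {n : ℕ} (a : Fin n → ℝ) (s : ℝ) (m : Fin n → ℕ) (x : Fin n → ℝ) : ℝ :=
  ∏ i, Real.cos (m i * (Real.pi / s * (x i - a i)))

/-- The product obtained from `cosProd` by replacing the `i`-th cosine by a sine. -/
def sinCosProd {n : ℕ} (a : Fin n → ℝ) (s : ℝ) (i : Fin n) (m : Fin n → ℕ) (x : Fin n → ℝ) : ℝ :=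
  ∏ j, if j = i then Real.sin (m j * (Real.pi / s * (x j - a j)))
    else Real.cos (m j * (Real.pi / s * (x j - a j)))

theorem continuous_cosProd {n : ℕ} (a : Fin n → ℝ) (s : ℝ) (m : Fin n → ℕ) :
    Continuous (cosProd a s m) := by
  unfold cosProd; fun_prop

theorem continuous_sinCosProd {n : ℕ} (a : Fin n → ℝ) (s : ℝ) (i : Fin n) (m : Fin n → ℕ) :
    Continuous (sinCosProd a s i m) := by
  unfold sinCosProd
  refine continuous_finsetProd _ fun j _ => ?_
  split_ifs <;> fun_prop

/-- The closed cube with corner `a` and side `s`. -/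
abbrev cube {n : ℕ} (a : Fin n → ℝ) (s : ℝ) : Set (Fin n → ℝ) := Icc a (fun i => a i + s)

/-- The squared `L²` norm of `cosProd`. -/
def cosProdNormSq {n : ℕ} (s : ℝ) (m : Fin n → ℕ) : ℝ := ∏ i, cosNormSq s (m i)

theorem cosProdNormSq_pos {n : ℕ} {s : ℝ} (hs : 0 < s) (m : Fin n → ℕ) :
    0 < cosProdNormSq s m := Finset.prod_pos fun i _ => cosNormSq_pos hs (m i)

theorem integral_cube_prod {n : ℕ} (a : Fin n → ℝ) (s : ℝ) (f : Fin n → ℝ → ℝ) :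
    ∫ x in cube a s, ∏ i, f i (x i) = ∏ i, ∫ x in Icc (a i) (a i + s), f i x := by
  have : (volume : Measure (Fin n → ℝ)).restrict (cube a s) =
      Measure.pi fun i => (volume : Measure ℝ).restrict (Icc (a i) (a i + s)) := by
    rw [volume_pi, ← Measure.restrict_pi_pi, cube, ← pi_univ_Icc]
  rw [this]
  exact integral_fintype_prod_eq_prod (𝕜 := ℝ) f

theorem integral_cosProd_mul {n : ℕ} (a : Fin n → ℝ) {s : ℝ} (hs : 0 < s) (m m' : Fin n → ℕ) :
    ∫ x in cube a s, cosProd a s m x * cosProd a s m' x =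
      if m = m' then cosProdNormSq s m else 0 := by
  unfold cosProd
  simp_rw [← Finset.prod_mul_distrib]
  rw [integral_cube_prod a s (fun i x => Real.cos (m i * (Real.pi / s * (x - a i))) *
    Real.cos (m' i * (Real.pi / s * (x - a i))))]
  simp_rw [integral_cos_mul_cos _ s hs]
  split_ifs with h
  · subst h; simp [cosProdNormSq]
  · obtain ⟨i, hi⟩ := Function.ne_iff.1 h
    exact Finset.prod_eq_zero (Finset.mem_univ i) (by simp [hi])

theorem integral_sinCosProd_mul {n : ℕ} (a : Fin n → ℝ) {s : ℝ} (hs : 0 < s) (i : Fin n)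
    (m m' : Fin n → ℕ) (hm : m i ≠ 0) :
    ∫ x in cube a s, sinCosProd a s i m x * sinCosProd a s i m' x =
      if m = m' then cosProdNormSq s m else 0 := by
  unfold sinCosProd
  simp_rw [← Finset.prod_mul_distrib]
  rw [integral_cube_prod a s (fun j x => (if j = i then Real.sin (m j * (Real.pi / s * (x - a j)))
      else Real.cos (m j * (Real.pi / s * (x - a j)))) *
    (if j = i then Real.sin (m' j * (Real.pi / s * (x - a j)))
      else Real.cos (m' j * (Real.pi / s * (x - a j)))))]
  have h1 : ∀ j, (∫ x in Icc (a j) (a j + s),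
      (if j = i then Real.sin (m j * (Real.pi / s * (x - a j)))
      else Real.cos (m j * (Real.pi / s * (x - a j)))) *
    (if j = i then Real.sin (m' j * (Real.pi / s * (x - a j)))
      else Real.cos (m' j * (Real.pi / s * (x - a j))))) =
      if m j = m' j then cosNormSq s (m j) else 0 := by
    intro j
    by_cases hj : j = i
    · subst hj
      simp only [if_true]
      exact integral_sin_mul_sin _ s hs _ _ hm
    · simp only [hj, if_false]
      exact integral_cos_mul_cos _ s hs _ _
  simp_rw [h1]
  split_ifs with h
  · subst h; simp [cosProdNormSq]
  · obtain ⟨i, hi⟩ := Function.ne_iff.1 h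
    exact Finset.prod_eq_zero (Finset.mem_univ i) (by simp [hi])


/-! ### Integration by parts against the cosine products. -/

theorem differentiable_sinCosProd {n : ℕ} (a : Fin n → ℝ) (s : ℝ) (i : Fin n) (m : Fin n → ℕ) :
    Differentiable ℝ (sinCosProd a s i m) := by
  have : ContDiff ℝ 1 (sinCosProd a s i m) := by
    unfold sinCosProd
    refine contDiff_prod fun j _ => ?_
    split_ifs <;> fun_prop
  exact this.differentiable (by norm_num)

theorem fderiv_sinCosProd_single {n : ℕ} (a : Fin n → ℝ) (s : ℝ) (i : Fin n) (m : Fin n → ℕ)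
    (x : Fin n → ℝ) :
    fderiv ℝ (sinCosProd a s i m) x (Pi.single i 1) = (Real.pi / s * m i) * cosProd a s m x := by
  have hd := differentiable_sinCosProd a s i m x
  have hline : HasDerivAt (fun t : ℝ => x + t • (Pi.single i (1 : ℝ) : Fin n → ℝ))
      (Pi.single i 1) 0 := by
    simpa using ((hasDerivAt_id (0 : ℝ)).smul_const (Pi.single i (1 : ℝ) : Fin n → ℝ)).const_add x
  have h1 : HasDerivAt (fun t : ℝ => sinCosProd a s i m (x + t • Pi.single i (1 : ℝ)))
      (fderiv ℝ (sinCosProd a s i m) x (Pi.single i 1)) 0 := by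
    have hd' : HasFDerivAt (sinCosProd a s i m) (fderiv ℝ (sinCosProd a s i m) x)
      (x + (0 : ℝ) • Pi.single i (1 : ℝ)) := by simpa using hd.hasFDerivAt
    exact HasFDerivAt.comp_hasDerivAt (l := sinCosProd a s i m) (0 : ℝ) hd' hline
  have h2 : ∀ t : ℝ, sinCosProd a s i m (x + t • Pi.single i (1 : ℝ)) =
      Real.sin (m i * (Real.pi / s * (x i + t - a i))) *
        ∏ j ∈ Finset.univ.erase i, Real.cos (m j * (Real.pi / s * (x j - a j))) := by
    intro t
    unfold sinCosProd
    rw [← Finset.mul_prod_erase _ _ (Finset.mem_univ i)]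
    simp only [if_true]
    congr 1
    · simp
    · refine Finset.prod_congr rfl fun j hj => ?_
      have := Finset.ne_of_mem_erase hj
      simp [this]
  have h3 : HasDerivAt (fun t : ℝ => sinCosProd a s i m (x + t • Pi.single i (1 : ℝ)))
      ((Real.pi / s * m i) * cosProd a s m x) 0 := by
    simp_rw [h2]
    have : HasDerivAt (fun t : ℝ => (m i : ℝ) * (Real.pi / s * (x i + t - a i)))
        (m i * (Real.pi / s * 1)) 0 :=
      ((((hasDerivAt_id (0:ℝ)).const_add (x i)).sub_const (a i)).const_mul _).const_mul _
    refine ((this.sin).mul_const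
      (∏ j ∈ Finset.univ.erase i, Real.cos (m j * (Real.pi / s * (x j - a j))))).congr_deriv ?_
    unfold cosProd
    rw [← Finset.mul_prod_erase _ _ (Finset.mem_univ i)]
    simp; ring
  exact h1.unique h3

theorem sinCosProd_eq_zero {n : ℕ} (a : Fin n → ℝ) {s : ℝ} (hs : 0 < s) (i : Fin n)
    (m : Fin n → ℕ) (x : Fin n → ℝ) (h : x i = a i ∨ x i = a i + s) :
    sinCosProd a s i m x = 0 := by
  refine Finset.prod_eq_zero (Finset.mem_univ i) ?_
  simp only [if_true]
  rcases h with h | h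
  · simp [h]
  · have : (m i : ℝ) * (Real.pi / s * (x i - a i)) = m i * Real.pi := by
      rw [h]; field_simp; ring
    rw [this, Real.sin_nat_mul_pi]

/-- Divergence theorem for the field `f * sinCosProd` in direction `i`. The sine vanishes on the two
faces orthogonal to that direction, so no boundary condition on `f` is needed; this is what makes
the cosines the Neumann system. -/
theorem integral_fderiv_mul_sinCosProd {n : ℕ} (a : Fin n → ℝ) {s : ℝ} (hs : 0 < s) (i : Fin n)
    (m : Fin n → ℕ) (f : (Fin n → ℝ) → ℝ) (hf : ContDiff ℝ 1 f) :
    ∫ x in cube a s, fderiv ℝ f x (Pi.single i 1) * sinCosProd a s i m x =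
      -((Real.pi / s * m i) * ∫ x in cube a s, f x * cosProd a s m x) := by
  obtain _ | n := n
  · exact i.elim0
  have hfd : Differentiable ℝ f := hf.differentiable (by norm_num)
  have hfc : Continuous fun x => fderiv ℝ f x (Pi.single i 1) :=
    (hf.continuous_fderiv (by norm_num)).clm_apply continuous_const
  have hψ := differentiable_sinCosProd a s i m
  have hψc := continuous_sinCosProd a s i m
  have hcc := continuous_cosProd a s m
  have hle : a ≤ (fun i => a i + s) := fun i => by simp [hs.le]
  have key := integral_divergence_of_hasFDerivAt_off_countable' (E := ℝ) a (fun i => a i + s) hle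
    (fun j x => if j = i then f x * sinCosProd a s i m x else 0)
    (fun j x => if j = i then f x • fderiv ℝ (sinCosProd a s i m) x
      + sinCosProd a s i m x • fderiv ℝ f x else 0) ∅ countable_empty
    (by
      intro j
      by_cases h : j = i
      · simp only [h, if_true]; exact (hf.continuous.mul hψc).continuousOn
      · simp only [h, if_false]; exact continuousOn_const)
    (by
      intro x _ j
      by_cases h : j = i
      · simp only [h, if_true]; exact (hfd x).hasFDerivAt.mul (hψ x).hasFDerivAt
      · simp only [h, if_false]; exact hasFDerivAt_const _ _)
  have hsum : ∀ x : Fin (n + 1) → ℝ, (∑ j, (if j = i then f x • fderiv ℝ (sinCosProd a s i m) x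
      + sinCosProd a s i m x • fderiv ℝ f x else 0) (Pi.single j 1)) =
      (Real.pi / s * m i) * (f x * cosProd a s m x)
        + fderiv ℝ f x (Pi.single i 1) * sinCosProd a s i m x := by
    intro x
    rw [Finset.sum_eq_single i (by intro j _ hj; simp [hj]) (by simp)]
    simp [fderiv_sinCosProd_single]; ring
  have hi1 : IntegrableOn (fun x => (Real.pi / s * m i) * (f x * cosProd a s m x)) (cube a s) :=
    ((hf.continuous.mul hcc).const_smul (Real.pi / s * m i : ℝ)).continuousOn.integrableOn_compact
      isCompact_Icc
  have hi2 : IntegrableOn (fun x => fderiv ℝ f x (Pi.single i 1) * sinCosProd a s i m x)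
      (cube a s) := (hfc.mul hψc).continuousOn.integrableOn_compact isCompact_Icc
  simp_rw [hsum] at key
  have key2 := key (hi1.add hi2)
  rw [integral_add hi1 hi2, Finset.sum_eq_zero, integral_const_mul] at key2
  · linarith
  · intro j _
    by_cases h : j = i
    · subst h
      simp only [if_true]
      simp_rw [sinCosProd_eq_zero a hs j m (j.insertNth (a j + s) _) (Or.inr (by simp)),
        sinCosProd_eq_zero a hs j m (j.insertNth (a j) _) (Or.inl (by simp))]
      simp
    · simp [h]

/-- Bessel's inequality for the `i`-th partial derivative in the orthogonal system `sinCosProd`,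
whose coefficients are those of `f` multiplied by the frequency. -/
theorem sum_sq_le_integral_fderiv_sq {n : ℕ} (a : Fin n → ℝ) {s : ℝ} (hs : 0 < s) (i : Fin n)
    (F : Finset (Fin n → ℕ)) (f : (Fin n → ℝ) → ℝ) (hf : ContDiff ℝ 1 f) :
    ∑ m ∈ F, (Real.pi / s * m i) ^ 2 * ((∫ x in cube a s, f x * cosProd a s m x) ^ 2
      / cosProdNormSq s m) ≤ ∫ x in cube a s, (fderiv ℝ f x (Pi.single i 1)) ^ 2 := by
  have hfc : Continuous fun x => fderiv ℝ f x (Pi.single i 1) :=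
    (hf.continuous_fderiv (by norm_num)).clm_apply continuous_const
  -- For `m i = 0` the sine product is identically zero and the term on the left vanishes too, so
  -- these indices can be dropped before orthogonality is used.
  set F' := F.filter (fun m => m i ≠ 0) with hF'
  have hsub : ∑ m ∈ F, (Real.pi / s * m i) ^ 2 * ((∫ x in cube a s, f x * cosProd a s m x) ^ 2
      / cosProdNormSq s m) = ∑ m ∈ F', (∫ x in cube a s, fderiv ℝ f x (Pi.single i 1) *
        sinCosProd a s i m x) ^ 2 / cosProdNormSq s m := by
    rw [hF', Finset.sum_filter]
    refine Finset.sum_congr rfl fun m _ => ?_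
    split_ifs with h
    · rw [integral_fderiv_mul_sinCosProd a hs i m f hf]; ring
    · rw [not_not] at h; simp [h]
  rw [hsub]
  have := integral_sq_sub_sum volume (K := cube a s) isCompact_Icc
    (fun x => fderiv ℝ f x (Pi.single i 1)) hfc (sinCosProd a s i) (continuous_sinCosProd a s i)
    (cosProdNormSq s) F'
    (fun m hm => by simp [integral_sinCosProd_mul a hs i m m (Finset.mem_filter.1 hm).2])
    (fun m hm m' _ hne => by
      simp [integral_sinCosProd_mul a hs i m m' (Finset.mem_filter.1 hm).2, hne])
    (fun m => (∫ x in cube a s, fderiv ℝ f x (Pi.single i 1) * sinCosProd a s i m x)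
      / cosProdNormSq s m)
  have hnn : 0 ≤ ∫ x in cube a s, (fderiv ℝ f x (Pi.single i 1) - ∑ m ∈ F',
      ((∫ x in cube a s, fderiv ℝ f x (Pi.single i 1) * sinCosProd a s i m x)
      / cosProdNormSq s m) * sinCosProd a s i m x) ^ 2 := integral_nonneg fun x => sq_nonneg _
  rw [this, Finset.mul_sum] at hnn
  have : ∑ m ∈ F', (∫ x in cube a s, fderiv ℝ f x (Pi.single i 1) *
        sinCosProd a s i m x) ^ 2 / cosProdNormSq s m =
      (∑ m ∈ F', 2 * ((∫ x in cube a s, fderiv ℝ f x (Pi.single i 1) * sinCosProd a s i m x)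
      / cosProdNormSq s m * ∫ x in cube a s, fderiv ℝ f x (Pi.single i 1) * sinCosProd a s i m x))
      - ∑ m ∈ F', ((∫ x in cube a s, fderiv ℝ f x (Pi.single i 1) * sinCosProd a s i m x)
      / cosProdNormSq s m) ^ 2 * cosProdNormSq s m := by
    rw [← Finset.sum_sub_distrib]
    refine Finset.sum_congr rfl fun m _ => ?_
    have := (cosProdNormSq_pos (n := n) hs m).ne'
    field_simp; ring
  rw [this]; linarith


/-! ### Completeness of the cosine products -/

/-- `cosProd` restricted to the cube, as a continuous map. -/
def cosProdMap {n : ℕ} (a : Fin n → ℝ) (s : ℝ) (m : Fin n → ℕ) : C(cube a s, ℝ) :=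
  ⟨fun x => cosProd a s m x, (continuous_cosProd a s m).comp continuous_subtype_val⟩

theorem cosProd_single {n : ℕ} (a : Fin n → ℝ) (s : ℝ) (i : Fin n) (x : Fin n → ℝ) :
    cosProd a s (Pi.single i 1) x = Real.cos (Real.pi / s * (x i - a i)) := by
  unfold cosProd
  rw [← Finset.mul_prod_erase _ _ (Finset.mem_univ i), Finset.prod_eq_one]
  · simp
  · intro j hj
    simp [Finset.ne_of_mem_erase hj]

theorem cosProd_update {n : ℕ} (a : Fin n → ℝ) (s : ℝ) (i : Fin n) (m : Fin n → ℕ) (k : ℕ)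
    (x : Fin n → ℝ) :
    cosProd a s (Function.update m i k) x = Real.cos (k * (Real.pi / s * (x i - a i))) *
      ∏ j ∈ Finset.univ.erase i, Real.cos (m j * (Real.pi / s * (x j - a j))) := by
  unfold cosProd
  rw [← Finset.mul_prod_erase _ _ (Finset.mem_univ i)]
  congr 1
  · simp
  · refine Finset.prod_congr rfl fun j hj => ?_
    simp [Finset.ne_of_mem_erase hj]

theorem cosProd_single_mul {n : ℕ} (a : Fin n → ℝ) (s : ℝ) (i : Fin n) (m : Fin n → ℕ)
    (x : Fin n → ℝ) : cosProd a s (Pi.single i 1) x * cosProd a s m x =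
      (1 / 2) * cosProd a s (Function.update m i (m i + 1)) x +
      (1 / 2) * cosProd a s (Function.update m i ((m i : ℤ) - 1).natAbs) x := by
  have h : cosProd a s m x = cosProd a s (Function.update m i (m i)) x := by simp
  rw [h, cosProd_single, cosProd_update, cosProd_update, cosProd_update]
  set θ := Real.pi / s * (x i - a i)
  -- For `m i = 0` the lower frequency is `-1`; cosine is even, so `natAbs` keeps the index in `ℕ`.
  have h1 : Real.cos ((((m i : ℤ) - 1).natAbs : ℝ) * θ) = Real.cos (m i * θ - θ) := by
    rw [Nat.cast_natAbs]
    push_cast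
    rcases abs_choice ((m i : ℝ) - 1) with h | h <;> rw [h]
    · congr 1; ring
    · rw [neg_mul, Real.cos_neg]; congr 1; ring
  rw [h1]
  push_cast
  rw [add_mul, one_mul, Real.cos_add, Real.cos_sub]
  ring

/-- The product formula for cosines makes the linear span stable under multiplication by the
generators. As it contains `1`, it contains the whole algebra. -/
theorem adjoin_le_span_cosProdMap {n : ℕ} (a : Fin n → ℝ) (s : ℝ) :
    ∀ g ∈ Algebra.adjoin ℝ (range fun i : Fin n => cosProdMap a s (Pi.single i 1)),
      g ∈ Submodule.span ℝ (range (cosProdMap a s)) := by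
  set S := Submodule.span ℝ (range (cosProdMap a s)) with hS
  have hone : (1 : C(cube a s, ℝ)) ∈ S := by
    refine Submodule.subset_span ⟨0, ?_⟩
    ext x
    simp [cosProdMap, cosProd]
  suffices H : ∀ g ∈ Algebra.adjoin ℝ (range fun i : Fin n => cosProdMap a s (Pi.single i 1)),
      ∀ h ∈ S, g * h ∈ S by
    intro g hg
    simpa using H g hg 1 hone
  intro g hg
  induction hg using Algebra.adjoin_induction with
  | mem g hg =>
    obtain ⟨i, rfl⟩ := hg
    intro h hh
    induction hh using Submodule.span_induction with
    | mem h hh =>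
      obtain ⟨m, rfl⟩ := hh
      have : cosProdMap a s (Pi.single i 1) * cosProdMap a s m =
          (1 / 2 : ℝ) • cosProdMap a s (Function.update m i (m i + 1)) +
          (1 / 2 : ℝ) • cosProdMap a s (Function.update m i ((m i : ℤ) - 1).natAbs) := by
        ext x
        exact cosProd_single_mul a s i m x
      simp only [this]
      exact S.add_mem (S.smul_mem _ (Submodule.subset_span ⟨_, rfl⟩))
        (S.smul_mem _ (Submodule.subset_span ⟨_, rfl⟩))
    | zero => simp
    | add x y _ _ hx hy => rw [mul_add]; exact S.add_mem hx hy
    | smul c x _ hx => rw [mul_smul_comm]; exact S.smul_mem _ hx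
  | algebraMap r =>
    intro h hh
    rw [← Algebra.smul_def]
    exact S.smul_mem _ hh
  | add x y _ _ hx hy => intro h hh; rw [add_mul]; exact S.add_mem (hx h hh) (hy h hh)
  | mul x y _ _ hx hy => intro h hh; rw [mul_assoc]; exact hx _ (hy h hh)

/-- Stone–Weierstrass: the first cosine in each coordinate is injective on the side of the cube, so
these `n` functions separate points. -/
theorem exists_sum_cosProd_near {n : ℕ} (a : Fin n → ℝ) {s : ℝ} (hs : 0 < s)
    (f : (Fin n → ℝ) → ℝ) (hf : Continuous f) {δ : ℝ} (hδ : 0 < δ) :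
    ∃ (F : Finset (Fin n → ℕ)) (b : (Fin n → ℕ) → ℝ), ∀ x ∈ cube a s,
      |f x - ∑ m ∈ F, b m * cosProd a s m x| ≤ δ := by
  have : CompactSpace (cube a s) := isCompact_iff_compactSpace.1 isCompact_Icc
  have hsep : (Algebra.adjoin ℝ
      (range fun i : Fin n => cosProdMap a s (Pi.single i 1))).SeparatesPoints := by
    intro x y hxy
    have hne : (x : Fin n → ℝ) ≠ y := fun h => hxy (Subtype.ext h)
    obtain ⟨i, hi⟩ := Function.ne_iff.1 hne
    refine ⟨_, ⟨cosProdMap a s (Pi.single i 1), Algebra.subset_adjoin ⟨i, rfl⟩, rfl⟩, ?_⟩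
    intro h
    have h' : cosProd a s (Pi.single i 1) x = cosProd a s (Pi.single i 1) y := h
    rw [cosProd_single, cosProd_single] at h'
    have hmem : ∀ z : cube a s, Real.pi / s * ((z : Fin n → ℝ) i - a i) ∈ Icc 0 Real.pi := by
      intro z
      have h1 := z.2.1 i
      have h2 := z.2.2 i
      have := Real.pi_pos
      have h3 : (z : Fin n → ℝ) i - a i ≤ s := by
        have h4 : (z : Fin n → ℝ) i ≤ a i + s := h2
        linarith
      refine ⟨mul_nonneg (by positivity) (by linarith), ?_⟩
      calc Real.pi / s * ((z : Fin n → ℝ) i - a i) ≤ Real.pi / s * s := by gcongr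
        _ = Real.pi := by field_simp
    have h3 := Real.injOn_cos (hmem x) (hmem y) h'
    have : Real.pi / s ≠ 0 := by have := Real.pi_pos; positivity
    exact hi (by simpa using mul_left_cancel₀ this h3)
  obtain ⟨g, hg⟩ := ContinuousMap.exists_mem_subalgebra_near_continuous_of_separatesPoints _ hsep
    (fun x : cube a s => f x) (hf.comp continuous_subtype_val) δ hδ
  have hg' := adjoin_le_span_cosProdMap a s g g.2
  rw [Finsupp.mem_span_range_iff_exists_finsupp] at hg'
  obtain ⟨c, hc⟩ := hg'
  refine ⟨c.support, c, fun x hx => ?_⟩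
  have h1 := hg ⟨x, hx⟩
  rw [← hc] at h1
  rw [abs_sub_comm]
  refine le_of_eq_of_le ?_ h1.le
  rw [Real.norm_eq_abs]
  congr 2
  simp [Finsupp.sum, cosProdMap]

/-- Neumann's spectral gap on a cube: outside of the span of the cosine products indexed by `M`,
which has to contain all frequencies below `R`, the Dirichlet energy is at least `R²`. -/
theorem neumann_cube_ineq {n : ℕ} (a : Fin n → ℝ) {s : ℝ} (hs : 0 < s) (R : ℝ)
    (M : Finset (Fin n → ℕ))
    (hM : ∀ m, m ∉ M → R ^ 2 ≤ ∑ i, (Real.pi / s * (m i : ℝ)) ^ 2)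
    (f : (Fin n → ℝ) → ℝ) (hf : ContDiff ℝ 1 f) :
    R ^ 2 * ((∫ x in cube a s, f x ^ 2) -
      ∑ m ∈ M, (∫ x in cube a s, f x * cosProd a s m x) ^ 2 / cosProdNormSq s m) ≤
    ∫ x in cube a s, ∑ i, (fderiv ℝ f x (Pi.single i 1)) ^ 2 := by
  classical
  have hfc : ∀ i, Continuous fun x => fderiv ℝ f x (Pi.single i 1) := fun i =>
    (hf.continuous_fderiv (by norm_num)).clm_apply continuous_const
  set d : (Fin n → ℕ) → ℝ := fun m => (∫ x in cube a s, f x * cosProd a s m x) ^ 2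
    / cosProdNormSq s m with hd
  have hd0 : ∀ m, 0 ≤ d m := fun m => div_nonneg (sq_nonneg _) (cosProdNormSq_pos hs m).le
  have hgrad : ∀ F : Finset (Fin n → ℕ), ∑ m ∈ F, (∑ i, (Real.pi / s * (m i : ℝ)) ^ 2) * d m ≤
      ∫ x in cube a s, ∑ i, (fderiv ℝ f x (Pi.single i 1)) ^ 2 := by
    intro F
    have hint : ∀ i ∈ Finset.univ, IntegrableOn (fun x => (fderiv ℝ f x (Pi.single i 1)) ^ 2)
        (cube a s) := fun i _ => ((hfc i).pow 2).continuousOn.integrableOn_compact isCompact_Icc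
    rw [integral_finsetSum _ hint]
    simp_rw [Finset.sum_mul]
    rw [Finset.sum_comm]
    exact Finset.sum_le_sum fun i _ => sum_sq_le_integral_fderiv_sq a hs i F f hf
  -- The half of Parseval's identity that is needed: the squared norm is at most a finite sum of
  -- squared coefficients plus a small error. `F` is enlarged to contain `M`, with zero coefficients
  -- on the new indices.
  have happrox : ∀ δ : ℝ, 0 < δ → ∃ F : Finset (Fin n → ℕ), M ⊆ F ∧
      (∫ x in cube a s, f x ^ 2) ≤ ∑ m ∈ F, d m + δ ^ 2 * (volume (cube a s)).toReal := by
    intro δ hδ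
    obtain ⟨F₀, b₀, hb⟩ := exists_sum_cosProd_near a hs f hf.continuous hδ
    set b : (Fin n → ℕ) → ℝ := fun m => if m ∈ F₀ then b₀ m else 0 with hbdef
    set F := F₀ ∪ M
    refine ⟨F, Finset.subset_union_right, ?_⟩
    have hsum : ∀ x, ∑ m ∈ F, b m * cosProd a s m x = ∑ m ∈ F₀, b₀ m * cosProd a s m x := by
      intro x
      rw [← Finset.sum_subset (Finset.subset_union_left : F₀ ⊆ F)]
      · exact Finset.sum_congr rfl fun m hm => by simp [hbdef, hm]
      · intro m _ hm; simp [hbdef, hm]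
    have key := integral_sq_sub_sum volume (K := cube a s) isCompact_Icc f hf.continuous
      (cosProd a s) (continuous_cosProd a s) (cosProdNormSq s) F
      (fun m _ => by simp [integral_cosProd_mul a hs])
      (fun m _ m' _ hne => by simp [integral_cosProd_mul a hs, hne]) b
    have hle : ∫ x in cube a s, (f x - ∑ m ∈ F, b m * cosProd a s m x) ^ 2 ≤
        δ ^ 2 * (volume (cube a s)).toReal := by
      have : ∫ x in cube a s, (f x - ∑ m ∈ F, b m * cosProd a s m x) ^ 2 ≤
          ∫ x in cube a s, δ ^ 2 := by
        refine setIntegral_mono_on ?_ ?_ measurableSet_Icc ?_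
        · have hc : Continuous fun x => (f x - ∑ m ∈ F, b m * cosProd a s m x) ^ 2 := by
            have := hf.continuous
            have := continuous_cosProd a s
            fun_prop
          exact hc.continuousOn.integrableOn_compact isCompact_Icc
        · exact continuousOn_const.integrableOn_compact isCompact_Icc
        · intro x hx
          rw [hsum, ← sq_abs (f x - _)]
          exact pow_le_pow_left₀ (abs_nonneg _) (hb x hx) 2
      refine this.trans (le_of_eq ?_)
      rw [setIntegral_const, smul_eq_mul, mul_comm]; rfl
    -- Completing the square: the Fourier coefficients minimize the `L²` distance, so they do at
    -- least as well as the uniform approximation.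
    have hmin : -∑ m ∈ F, d m ≤ - (2 * ∑ m ∈ F, b m * (∫ x in cube a s, f x * cosProd a s m x))
        + ∑ m ∈ F, b m ^ 2 * cosProdNormSq s m := by
      rw [Finset.mul_sum, ← Finset.sum_neg_distrib, ← Finset.sum_neg_distrib,
        ← Finset.sum_add_distrib]
      refine Finset.sum_le_sum fun m _ => ?_
      have hq := cosProdNormSq_pos (n := n) hs m
      set c := ∫ x in cube a s, f x * cosProd a s m x
      have : - (2 * (b m * c)) + b m ^ 2 * cosProdNormSq s m - -d m =
          (b m * cosProdNormSq s m - c) ^ 2 / cosProdNormSq s m := by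
        simp only [hd]; field_simp; ring
      have h0 : 0 ≤ (b m * cosProdNormSq s m - c) ^ 2 / cosProdNormSq s m := by positivity
      linarith
    linarith
  set V := (volume (cube a s)).toReal with hV
  have hV0 : 0 ≤ V := ENNReal.toReal_nonneg
  refine le_of_forall_pos_le_add fun η hη => ?_
  -- This `δ` makes `R² δ² V ≤ η`; the `+ 1` keeps the denominator positive when `R² V = 0`.
  obtain ⟨F, hMF, hF⟩ := happrox (Real.sqrt (η / (R ^ 2 * V + 1))) (by positivity)
  rw [Real.sq_sqrt (by positivity)] at hF
  have h1 := hgrad (F \ M)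
  have h2 : R ^ 2 * ∑ m ∈ F \ M, d m ≤ ∑ m ∈ F \ M, (∑ i, (Real.pi / s * (m i : ℝ)) ^ 2) * d m := by
    rw [Finset.mul_sum]
    refine Finset.sum_le_sum fun m hm => ?_
    exact mul_le_mul_of_nonneg_right (hM m (Finset.mem_sdiff.1 hm).2) (hd0 m)
  have h3 := Finset.sum_sdiff (f := d) hMF
  have h4 : R ^ 2 * (η / (R ^ 2 * V + 1) * V) ≤ η := by
    have : R ^ 2 * (η / (R ^ 2 * V + 1) * V) = η * ((R ^ 2 * V) / (R ^ 2 * V + 1)) := by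
      field_simp
    rw [this]
    refine mul_le_of_le_one_right hη.le ?_
    rw [div_le_one (by positivity)]; linarith
  have h5 : R ^ 2 * ((∫ x in cube a s, f x ^ 2) - ∑ m ∈ M, d m) ≤
      R ^ 2 * (∑ m ∈ F \ M, d m + η / (R ^ 2 * V + 1) * V) :=
    mul_le_mul_of_nonneg_left (by linarith) (sq_nonneg R)
  linarith


/-! ### Half-open cubes of Euclidean space -/

/-- The half-open cube with corner `a` and side `s` in Euclidean space. -/
def box {n : ℕ} (a : Fin n → ℝ) (s : ℝ) : Set (E n) := {x | ∀ i, a i ≤ x i ∧ x i < a i + s}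

theorem toLp_preimage_box {n : ℕ} (a : Fin n → ℝ) (s : ℝ) :
    (WithLp.toLp 2) ⁻¹' (box a s) = pi univ fun i => Ico (a i) (a i + s) := by
  ext x; simp [box]

theorem measurableSet_box {n : ℕ} (a : Fin n → ℝ) (s : ℝ) : MeasurableSet (box a s) := by
  have : box a s = (WithLp.ofLp : E n → (Fin n → ℝ)) ⁻¹' (pi univ fun i => Ico (a i) (a i + s)) := by
    ext x; simp [box]
  rw [this]
  exact (MeasurableSet.univ_pi fun i => measurableSet_Ico).preimage
    (PiLp.volume_preserving_ofLp (Fin n)).measurable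

theorem volume_box {n : ℕ} (a : Fin n → ℝ) {s : ℝ} (hs : 0 ≤ s) :
    volume (box a s) = ENNReal.ofReal (s ^ n) := by
  rw [← (PiLp.volume_preserving_toLp (Fin n)).measure_preimage
    (measurableSet_box a s).nullMeasurableSet, toLp_preimage_box, Real.volume_pi_Ico]
  simp [ENNReal.ofReal_pow hs]

theorem setIntegral_box {n : ℕ} (a : Fin n → ℝ) (s : ℝ) (g : E n → ℝ) :
    ∫ x in box a s, g x = ∫ y in cube a s, g (WithLp.toLp 2 y) := by
  rw [← (PiLp.volume_preserving_toLp (Fin n)).setIntegral_preimage_emb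
    (MeasurableEquiv.toLp 2 (Fin n → ℝ)).measurableEmbedding, toLp_preimage_box]
  refine setIntegral_congr_set ?_
  exact Measure.univ_pi_Ico_ae_eq_Icc

theorem norm_gradient_sq {n : ℕ} (φ : E n → ℝ) (hφ : Differentiable ℝ φ) (y : Fin n → ℝ) :
    ‖gradient φ (WithLp.toLp 2 y)‖ ^ 2 =
      ∑ i, (fderiv ℝ (fun z : Fin n → ℝ => φ (WithLp.toLp 2 z)) y (Pi.single i 1)) ^ 2 := by
  rw [EuclideanSpace.real_norm_sq_eq]
  refine Finset.sum_congr rfl fun i _ => ?_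
  congr 1
  have h1 : gradient φ (WithLp.toLp 2 y) i =
      fderiv ℝ φ (WithLp.toLp 2 y) (EuclideanSpace.single i 1) := by
    rw [← toDual_gradient, InnerProductSpace.toDual_apply_apply,
      EuclideanSpace.inner_single_right]
    simp
  rw [h1]
  have h2 : HasFDerivAt (fun z : Fin n → ℝ => φ (WithLp.toLp 2 z))
      ((fderiv ℝ φ (WithLp.toLp 2 y)).comp
        ((PiLp.continuousLinearEquiv 2 ℝ (fun _ : Fin n => ℝ)).symm :
          (Fin n → ℝ) →L[ℝ] E n)) y :=
    HasFDerivAt.comp (g := φ) y (hφ _).hasFDerivAt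
      ((PiLp.continuousLinearEquiv 2 ℝ (fun _ : Fin n => ℝ)).symm :
          (Fin n → ℝ) →L[ℝ] E n).hasFDerivAt
  rw [h2.fderiv]
  rfl

theorem neumann_box_ineq {n : ℕ} (a : Fin n → ℝ) {s : ℝ} (hs : 0 < s) (R : ℝ)
    (M : Finset (Fin n → ℕ))
    (hM : ∀ m, m ∉ M → R ^ 2 ≤ ∑ i, (Real.pi / s * (m i : ℝ)) ^ 2)
    (φ : E n → ℝ) (hφ : ContDiff ℝ 1 φ) :
    R ^ 2 * ((∫ x in box a s, φ x ^ 2) -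
      ∑ m ∈ M, (∫ x in box a s, φ x * cosProd a s m (WithLp.ofLp x)) ^ 2 / cosProdNormSq s m) ≤
    ∫ x in box a s, ‖gradient φ x‖ ^ 2 := by
  simp_rw [setIntegral_box, norm_gradient_sq φ (hφ.differentiable (by norm_num))]
  refine neumann_cube_ineq a hs R M hM (fun z : Fin n → ℝ => φ (WithLp.toLp 2 z)) ?_
  exact hφ.comp ((PiLp.continuousLinearEquiv 2 ℝ (fun _ : Fin n => ℝ)).symm.contDiff)

/-! ### The restriction of `H¹₀` to a set -/

/-- Restriction to a set, `L²(ℝⁿ) → L²(s)`. -/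
abbrev restrictL2 {n : ℕ} (F : Type*) [NormedAddCommGroup F] [NormedSpace ℝ F] (s : Set (E n)) :
    Lp F 2 (volume : Measure (E n)) →L[ℝ] Lp F 2 (volume.restrict s : Measure (E n)) :=
  LpToLpRestrictCLM (E n) F ℝ volume 2 s

theorem norm_sq_L2 {α F : Type*} [MeasurableSpace α] {μ : Measure α} [NormedAddCommGroup F]
    [InnerProductSpace ℝ F] (u : Lp F 2 μ) : ‖u‖ ^ 2 = ∫ x, ‖u x‖ ^ 2 ∂μ := by
  rw [← real_inner_self_eq_norm_sq, L2.inner_def]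
  simp_rw [real_inner_self_eq_norm_sq]

theorem integrable_norm_sq_L2 {α F : Type*} [MeasurableSpace α] {μ : Measure α}
    [NormedAddCommGroup F] (u : Lp F 2 μ) : Integrable (fun x => ‖u x‖ ^ 2) μ :=
  (memLp_two_iff_integrable_sq_norm (Lp.memLp u).1).1 (Lp.memLp u)

theorem norm_sq_restrictL2 {n : ℕ} {F : Type*} [NormedAddCommGroup F] [InnerProductSpace ℝ F]
    (s : Set (E n)) (u : Lp F 2 (volume : Measure (E n))) :
    ‖restrictL2 F s u‖ ^ 2 = ∫ x in s, ‖u x‖ ^ 2 := by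
  rw [norm_sq_L2]
  refine integral_congr_ae ?_
  filter_upwards [LpToLpRestrictCLM_coeFn (p := 2) ℝ s u] with x hx
  rw [hx]

theorem memLp_cosProd {n : ℕ} (a : Fin n → ℝ) {s : ℝ} (hs : 0 ≤ s) (m : Fin n → ℕ) :
    MemLp (fun x : E n => cosProd a s m (WithLp.ofLp x)) 2 (volume.restrict (box a s)) := by
  have : IsFiniteMeasure (volume.restrict (box a s)) :=
    ⟨by rw [Measure.restrict_apply_univ, volume_box a hs]; exact ENNReal.ofReal_lt_top⟩
  refine MemLp.of_bound (C := 1) ?_ ?_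
  · exact ((continuous_cosProd a s m).comp
      (PiLp.continuous_ofLp 2 (fun _ : Fin n => ℝ))).aestronglyMeasurable
  · refine Filter.Eventually.of_forall fun x => ?_
    rw [Real.norm_eq_abs, cosProd, Finset.abs_prod]
    exact Finset.prod_le_one (fun i _ => abs_nonneg _) fun i _ => Real.abs_cos_le_one _

/-- The functional `u ↦ ∫_Q u e_m` on `L²(ℝⁿ)`. -/
def cosCoeff {n : ℕ} (a : Fin n → ℝ) {s : ℝ} (hs : 0 ≤ s) (m : Fin n → ℕ) :
    Lp ℝ 2 (volume : Measure (E n)) →L[ℝ] ℝ :=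
  (innerSL ℝ ((memLp_cosProd a hs m).toLp _)).comp (restrictL2 ℝ (box a s))

theorem cosCoeff_eq_integral {n : ℕ} (a : Fin n → ℝ) {s : ℝ} (hs : 0 ≤ s) (m : Fin n → ℕ)
    (u : Lp ℝ 2 (volume : Measure (E n))) (φ : E n → ℝ) (h : u =ᵐ[volume] φ) :
    cosCoeff a hs m u = ∫ x in box a s, φ x * cosProd a s m (WithLp.ofLp x) := by
  rw [cosCoeff, ContinuousLinearMap.comp_apply, innerSL_apply_apply, L2.inner_def]
  refine integral_congr_ae ?_
  filter_upwards [LpToLpRestrictCLM_coeFn (p := 2) ℝ (box a s) u,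
    (memLp_cosProd a hs m).coeFn_toLp, ae_restrict_of_ae h] with x h1 h2 h3
  rw [h1, h2, h3]
  simp

/-- A closed relation that holds for the pairs `(φ, ∇φ)` of test functions holds on `H¹₀`. -/
theorem H10_induction {n : ℕ} {Ω : Set (E n)}
    (P : Lp ℝ 2 (volume : Measure (E n)) × Lp (E n) 2 (volume : Measure (E n)) → Prop)
    (hP : IsClosed {p | P p})
    (h : ∀ (p : Lp ℝ 2 (volume : Measure (E n)) × Lp (E n) 2 (volume : Measure (E n)))
      (φ : E n → ℝ), ContDiff ℝ ∞ φ → tsupport φ ⊆ Ω →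
      p.1 =ᵐ[volume] φ → p.2 =ᵐ[volume] gradient φ → P p) :
    ∀ p ∈ H10 Ω, P p := by
  -- Pairs coming from test functions already form a linear subspace, so only the closure remains to
  -- be handled.
  have hspan : ∀ p ∈ Submodule.span ℝ {p : Lp ℝ 2 (volume : Measure (E n)) ×
      Lp (E n) 2 (volume : Measure (E n)) | ∃ φ : E n → ℝ, ContDiff ℝ ∞ φ ∧ HasCompactSupport φ ∧
      tsupport φ ⊆ Ω ∧ p.1 =ᵐ[volume] φ ∧ p.2 =ᵐ[volume] gradient φ},
      ∃ φ : E n → ℝ, ContDiff ℝ ∞ φ ∧ tsupport φ ⊆ Ω ∧ p.1 =ᵐ[volume] φ ∧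
        p.2 =ᵐ[volume] gradient φ := by
    intro p hp
    induction hp using Submodule.span_induction with
    | mem p hp =>
      obtain ⟨φ, h1, -, h2⟩ := hp
      exact ⟨φ, h1, h2⟩
    | zero =>
      refine ⟨fun _ => 0, contDiff_const, by simp [tsupport], ?_, ?_⟩
      · exact Lp.coeFn_zero _ _ _
      · filter_upwards [Lp.coeFn_zero (E n) 2 (volume : Measure (E n))] with x hx
        rw [Prod.snd_zero, hx]
        simp [gradient]
    | add p q _ _ hp hq =>
      obtain ⟨φ, h1, h2, h3, h4⟩ := hp
      obtain ⟨ψ, g1, g2, g3, g4⟩ := hq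
      refine ⟨φ + ψ, h1.add g1, ?_, ?_, ?_⟩
      · refine Subset.trans ?_ (union_subset h2 g2)
        rw [tsupport, tsupport, tsupport, ← closure_union]
        exact closure_mono (Function.support_add φ ψ)
      · exact (Lp.coeFn_add _ _).trans (h3.add g3)
      · filter_upwards [Lp.coeFn_add p.2 q.2, h4, g4] with x e1 e2 e3
        rw [Prod.snd_add, e1, Pi.add_apply, e2, e3, gradient, gradient, gradient, ← map_add,
          fderiv_add (h1.differentiable (by norm_num) x) (g1.differentiable (by norm_num) x)]
    | smul c p _ hp =>
      obtain ⟨φ, h1, h2, h3, h4⟩ := hp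
      refine ⟨c • φ, contDiff_const.smul h1, ?_, ?_, ?_⟩
      · refine Subset.trans ?_ h2
        exact closure_mono (Function.support_const_smul_subset c φ)
      · filter_upwards [Lp.coeFn_smul c p.1, h3] with x e1 e2
        rw [Prod.smul_fst, e1, Pi.smul_apply, e2, Pi.smul_apply]
      · filter_upwards [Lp.coeFn_smul c p.2, h4] with x e1 e2
        rw [Prod.smul_snd, e1, Pi.smul_apply, e2, gradient, gradient, ← map_smul,
          fderiv_const_smul (h1.differentiable (by norm_num) x)]
  intro p hp
  have : closure (Submodule.span ℝ {p : Lp ℝ 2 (volume : Measure (E n)) ×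
      Lp (E n) 2 (volume : Measure (E n)) | ∃ φ : E n → ℝ, ContDiff ℝ ∞ φ ∧ HasCompactSupport φ ∧
      tsupport φ ⊆ Ω ∧ p.1 =ᵐ[volume] φ ∧ p.2 =ᵐ[volume] gradient φ} : Set _) ⊆ {p | P p} := by
    refine closure_minimal ?_ hP
    intro p hp
    obtain ⟨φ, h1, h2, h3, h4⟩ := hspan p hp
    exact h p φ h1 h2 h3 h4
  exact this hp


/-- Both sides are continuous in the pair `(u, ∇u)`, so the inequality passes from smooth functions
to the closure. No condition at the faces of the cube is required, which is why cubes may cross the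
boundary of `Ω`. -/
theorem H10_neumann_box_ineq {n : ℕ} {Ω : Set (E n)} (a : Fin n → ℝ) {s : ℝ} (hs : 0 < s) (R : ℝ)
    (M : Finset (Fin n → ℕ))
    (hM : ∀ m, m ∉ M → R ^ 2 ≤ ∑ i, (Real.pi / s * (m i : ℝ)) ^ 2) :
    ∀ p ∈ H10 Ω, R ^ 2 * (‖restrictL2 ℝ (box a s) p.1‖ ^ 2 -
      ∑ m ∈ M, (cosCoeff a hs.le m p.1) ^ 2 / cosProdNormSq s m) ≤
      ‖restrictL2 (E n) (box a s) p.2‖ ^ 2 := by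
  refine H10_induction _ (isClosed_le (by fun_prop) (by fun_prop)) ?_
  intro p φ hφ _ h1 h2
  have h := neumann_box_ineq a hs R M hM φ (hφ.of_le (by exact_mod_cast le_top))
  rw [norm_sq_restrictL2, norm_sq_restrictL2]
  have e1 : ∫ x in box a s, ‖p.1 x‖ ^ 2 = ∫ x in box a s, φ x ^ 2 := by
    refine integral_congr_ae ?_
    filter_upwards [ae_restrict_of_ae h1] with x hx
    rw [hx, Real.norm_eq_abs, sq_abs]
  have e2 : ∫ x in box a s, ‖p.2 x‖ ^ 2 = ∫ x in box a s, ‖gradient φ x‖ ^ 2 := by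
    refine integral_congr_ae ?_
    filter_upwards [ae_restrict_of_ae h2] with x hx
    rw [hx]
  rw [e1, e2]
  simp_rw [fun m => cosCoeff_eq_integral a hs.le m p.1 φ h1]
  exact h

theorem H10_norm_sq_eq {n : ℕ} {Ω U : Set (E n)} (hU : MeasurableSet U) (hΩU : Ω ⊆ U) :
    ∀ p ∈ H10 Ω, ‖p.1‖ ^ 2 = ∫ x in U, ‖p.1 x‖ ^ 2 := by
  have h : ∀ p ∈ H10 Ω, restrictL2 ℝ Uᶜ p.1 = 0 := by
    refine H10_induction _ (isClosed_eq (by fun_prop) continuous_const) ?_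
    intro p φ _ hφ h1 _
    rw [Lp.eq_zero_iff_ae_eq_zero]
    filter_upwards [LpToLpRestrictCLM_coeFn (p := 2) ℝ Uᶜ p.1, ae_restrict_of_ae h1,
      ae_restrict_mem hU.compl] with x h2 h3 h4
    rw [h2, h3]
    exact image_eq_zero_of_notMem_tsupport fun hx => h4 (hΩU (hφ hx))
  intro p hp
  have h1 := norm_sq_restrictL2 Uᶜ p.1
  rw [h p hp, norm_zero] at h1
  rw [norm_sq_L2, ← integral_add_compl hU (integrable_norm_sq_L2 p.1), ← h1]
  simp

/-! ### Spans of eigenspaces -/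

/-- Eigenspaces for different values are orthogonal both in `L²` and for the Dirichlet form, so the
Rayleigh quotient of a sum is a weighted mean of values `μ ≤ t`. -/
theorem eigenspace_sum_energy {n : ℕ} {Ω : Set (E n)} {t : ℝ}
    {p : Lp ℝ 2 (volume : Measure (E n)) × Lp (E n) 2 (volume : Measure (E n))}
    (hp : p ∈ ⨆ (μ : ℝ) (_ : μ ≤ t), eigenspace Ω μ) :
    p ∈ H10 Ω ∧ ‖p.2‖ ^ 2 ≤ t * ‖p.1‖ ^ 2 := by
  classical
  rw [iSup_subtype', Submodule.mem_iSup_iff_exists_finsupp] at hp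
  obtain ⟨f, hf, rfl⟩ := hp
  refine ⟨Submodule.sum_mem _ fun i _ => (hf i).1, ?_⟩
  have horth : ∀ i j : {μ : ℝ // μ ≤ t}, i ≠ j → inner ℝ (f i).1 (f j).1 = 0 ∧
      inner ℝ (f i).2 (f j).2 = 0 := by
    intro i j hij
    have h1 := (hf i).2 _ (hf j).1
    have h2 := (hf j).2 _ (hf i).1
    rw [real_inner_comm, real_inner_comm (f i).1] at h2
    have h3 : ((i : ℝ) - j) * inner ℝ (f i).1 (f j).1 = 0 := by
      rw [sub_mul]; linarith
    have h4 : inner ℝ (f i).1 (f j).1 = 0 := by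
      rcases mul_eq_zero.1 h3 with h | h
      · exact absurd (Subtype.ext (sub_eq_zero.1 h)) hij
      · exact h
    exact ⟨h4, by rw [h1, h4, mul_zero]⟩
  have e1 : ‖(f.sum fun _ xi => xi).1‖ ^ 2 = ∑ i ∈ f.support, inner ℝ (f i).1 (f i).1 := by
    rw [← real_inner_self_eq_norm_sq, Finsupp.sum, Prod.fst_sum, sum_inner]
    refine Finset.sum_congr rfl fun i hi => ?_
    rw [inner_sum, Finset.sum_eq_single_of_mem i hi fun j _ hj => (horth i j hj.symm).1]
  have e2 : ‖(f.sum fun _ xi => xi).2‖ ^ 2 = ∑ i ∈ f.support, inner ℝ (f i).2 (f i).2 := by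
    rw [← real_inner_self_eq_norm_sq, Finsupp.sum, Prod.snd_sum, sum_inner]
    refine Finset.sum_congr rfl fun i hi => ?_
    rw [inner_sum, Finset.sum_eq_single_of_mem i hi fun j _ hj => (horth i j hj.symm).2]
  rw [e1, e2, Finset.mul_sum]
  refine Finset.sum_le_sum fun i _ => ?_
  rw [(hf i).2 _ (hf i).1]
  exact mul_le_mul_of_nonneg_right i.2 real_inner_self_nonneg

/-- Dirichlet–Neumann bracketing: if `Ω` is covered by disjoint cubes then the number of Dirichlet
eigenvalues `≤ t < R²` is at most the total number of Neumann frequencies below `R`. -/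
theorem eigenvalueCount_le {n : ℕ} {Ω : Set (E n)} {ι : Type} (T : Finset ι)
    (a : ι → Fin n → ℝ) (s : ι → ℝ) (hs : ∀ c, 0 < s c)
    (hdisj : (T : Set ι).PairwiseDisjoint fun c => box (a c) (s c))
    (hcover : Ω ⊆ ⋃ c ∈ T, box (a c) (s c)) {t R : ℝ} (htR : t < R ^ 2)
    (M : ι → Finset (Fin n → ℕ))
    (hM : ∀ c m, m ∉ M c → R ^ 2 ≤ ∑ i, (Real.pi / s c * (m i : ℝ)) ^ 2) :
    eigenvalueCount Ω t ≤ ((∑ c ∈ T, (M c).card : ℕ) : Cardinal) := by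
  classical
  set V := ⨆ (μ : ℝ) (_ : μ ≤ t), eigenspace Ω μ with hV
  let I := {x : ι × (Fin n → ℕ) // x ∈ T.biUnion fun c => (M c).image fun m => (c, m)}
  -- `Φ` collects all low cosine coefficients on all cubes. On its kernel the Neumann gap gives `R²
  -- ‖u‖² ≤ ‖∇u‖² ≤ t ‖u‖²`, which forces `u = 0`; injectivity then bounds the dimension by the
  -- number of coefficients.
  let Φ : V →ₗ[ℝ] (I → ℝ) := LinearMap.pi fun x =>
    (cosCoeff (a x.1.1) (hs x.1.1).le x.1.2 : Lp ℝ 2 (volume : Measure (E n)) →ₗ[ℝ] ℝ) ∘ₗ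
      (LinearMap.fst ℝ _ _) ∘ₗ V.subtype
  have hinj : Function.Injective Φ := by
    rw [injective_iff_map_eq_zero]
    intro p hp
    obtain ⟨hpH, hpe⟩ := eigenspace_sum_energy p.2
    have hc : ∀ c ∈ T, ∀ m ∈ M c, cosCoeff (a c) (hs c).le m p.1.1 = 0 := by
      intro c hc m hm
      exact congr_fun hp ⟨(c, m), Finset.mem_biUnion.2 ⟨c, hc, Finset.mem_image_of_mem _ hm⟩⟩
    have h1 : ∀ c ∈ T, R ^ 2 * ∫ x in box (a c) (s c), ‖p.1.1 x‖ ^ 2 ≤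
        ∫ x in box (a c) (s c), ‖p.1.2 x‖ ^ 2 := by
      intro c hcT
      have := H10_neumann_box_ineq (a c) (hs c) R (M c) (hM c) p.1 hpH
      rw [Finset.sum_eq_zero fun m hm => by rw [hc c hcT m hm]; simp, sub_zero,
        norm_sq_restrictL2, norm_sq_restrictL2] at this
      exact this
    have hmeas : MeasurableSet (⋃ c ∈ T, box (a c) (s c)) :=
      Finset.measurableSet_biUnion _ fun c _ => measurableSet_box _ _
    have h2 := H10_norm_sq_eq hmeas hcover p.1 hpH
    rw [integral_biUnion_finset T (fun c _ => measurableSet_box _ _) hdisj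
      (fun c _ => (integrable_norm_sq_L2 p.1.1).integrableOn)] at h2
    have h3 : ∑ c ∈ T, ∫ x in box (a c) (s c), ‖p.1.2 x‖ ^ 2 ≤ ‖p.1.2‖ ^ 2 := by
      rw [← integral_biUnion_finset T (fun c _ => measurableSet_box _ _) hdisj
        (fun c _ => (integrable_norm_sq_L2 p.1.2).integrableOn), norm_sq_L2]
      exact setIntegral_le_integral (integrable_norm_sq_L2 p.1.2)
        (Filter.Eventually.of_forall fun x => sq_nonneg _)
    have h4 : R ^ 2 * ‖p.1.1‖ ^ 2 ≤ t * ‖p.1.1‖ ^ 2 := by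
      rw [h2, Finset.mul_sum, ← h2]
      exact (Finset.sum_le_sum h1).trans (h3.trans hpe)
    have h5 : ‖p.1.1‖ ^ 2 = 0 := by
      by_contra hne
      have : 0 < ‖p.1.1‖ ^ 2 := lt_of_le_of_ne (sq_nonneg _) (Ne.symm hne)
      nlinarith
    rw [h5, mul_zero] at hpe
    have h6 : p.1.1 = 0 := by simpa using h5
    have h7 : p.1.2 = 0 := by
      have := le_antisymm hpe (sq_nonneg _)
      simpa using this
    exact Subtype.ext (Prod.ext h6 h7)
  have hrank := LinearMap.rank_le_of_injective Φ hinj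
  rw [eigenvalueCount]
  refine hrank.trans ?_
  rw [rank_fun']
  have hcard : Fintype.card I ≤ ∑ c ∈ T, (M c).card := by
    rw [Fintype.card_coe]
    refine Finset.card_biUnion_le.trans (Finset.sum_le_sum fun c _ => Finset.card_image_le)
  exact_mod_cast hcard


/-! ### Grids of cubes -/

/-- The cube of index `k` of the grid of side `s`. -/
abbrev gridBox {n : ℕ} (s : ℝ) (k : Fin n → ℤ) : Set (E n) := box (fun i => k i * s) s

theorem mem_gridBox {n : ℕ} {s : ℝ} (hs : 0 < s) (k : Fin n → ℤ) (x : E n) :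
    x ∈ gridBox s k ↔ ∀ i, ⌊x i / s⌋ = k i := by
  refine forall_congr' fun i => ?_
  rw [Int.floor_eq_iff, le_div_iff₀ hs, div_lt_iff₀ hs, add_mul, one_mul]

theorem gridBox_index_unique {n : ℕ} {s : ℝ} (hs : 0 < s) {k k' : Fin n → ℤ} {x : E n}
    (h : x ∈ gridBox s k) (h' : x ∈ gridBox s k') : k = k' :=
  funext fun i => ((mem_gridBox hs k x).1 h i).symm.trans ((mem_gridBox hs k' x).1 h' i)

/-- Packing bound: distinct cubes of one grid are disjoint, so their volumes add up inside `S`. -/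
theorem card_mul_le_vol {n : ℕ} {ι : Type*} (T : Finset ι) {s : ℝ} (hs : 0 < s)
    (k : ι → Fin n → ℤ) (hk : InjOn k T) {S : Set (E n)} (hS : volume S ≠ ⊤)
    (hsub : ∀ c ∈ T, gridBox s (k c) ⊆ S) : (T.card : ℝ) * s ^ n ≤ vol S := by
  have h1 : volume (⋃ c ∈ T, gridBox s (k c)) = ∑ c ∈ T, volume (gridBox s (k c)) := by
    refine measure_biUnion_finset ?_ fun c _ => measurableSet_box _ _
    intro c hc c' hc' hne
    refine Set.disjoint_left.2 fun x hx hx' => hne (hk hc hc' (gridBox_index_unique hs hx hx'))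
  have h2 : volume (⋃ c ∈ T, gridBox s (k c)) ≤ volume S := measure_mono (iUnion₂_subset hsub)
  rw [h1] at h2
  simp_rw [gridBox, volume_box _ hs.le] at h2
  rw [Finset.sum_const, nsmul_eq_mul] at h2
  have h3 := ENNReal.toReal_mono hS h2
  rwa [ENNReal.toReal_mul, ENNReal.toReal_natCast, ENNReal.toReal_ofReal (by positivity)] at h3

/-! ### Counting Neumann frequencies -/

/-- The multi-indices `m ∈ ℕⁿ` with `|m| ≤ ρ`. -/
def freq (n : ℕ) (ρ : ℝ) : Finset (Fin n → ℕ) :=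
  {m ∈ Fintype.piFinset fun _ => Finset.range (⌊ρ⌋₊ + 1) | ∑ i, (m i : ℝ) ^ 2 ≤ ρ ^ 2}

theorem mem_freq {n : ℕ} {ρ : ℝ} (hρ : 0 ≤ ρ) (m : Fin n → ℕ) :
    m ∈ freq n ρ ↔ ∑ i, (m i : ℝ) ^ 2 ≤ ρ ^ 2 := by
  rw [freq, Finset.mem_filter, and_iff_right_iff_imp, Fintype.mem_piFinset]
  intro h i
  rw [Finset.mem_range, Nat.lt_add_one_iff, Nat.le_floor_iff hρ]
  have : (m i : ℝ) ^ 2 ≤ ρ ^ 2 := le_trans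
    (Finset.single_le_sum (f := fun i => (m i : ℝ) ^ 2) (fun j _ => sq_nonneg _)
      (Finset.mem_univ i)) h
  exact (pow_le_pow_iff_left₀ (by positivity) hρ two_ne_zero).1 this

theorem volume_ball_eq {n : ℕ} (r : ℝ) (hr : 0 ≤ r) (x : E n) (hn : 1 ≤ n) :
    vol (Metric.closedBall x r) = r ^ n * unitBallVol n := by
  have : Nontrivial (E n) := by
    have : Nonempty (Fin n) := ⟨⟨0, hn⟩⟩
    infer_instance
  rw [vol, unitBallVol, vol, Measure.addHaar_closedBall _ _ hr, ENNReal.toReal_mul]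
  simp [hr]

/-- Reflecting the unit cube at `m` in the coordinate hyperplanes gives `2 ^ n` cubes per frequency.
They are all disjoint and lie in the ball of radius `ρ + √n`, as a unit cube has diameter `√n`. -/
theorem card_freq_le {n : ℕ} (hn : 1 ≤ n) {ρ : ℝ} (hρ : 0 ≤ ρ) :
    ((freq n ρ).card : ℝ) ≤ unitBallVol n / 2 ^ n * (ρ + Real.sqrt n) ^ n := by
  classical
  -- The reflection of `[m, m + 1)` is indexed by its lower end `-(m + 1)`, so the two signs give
  -- different cubes even when `m i = 0`.
  let k : (Fin n → ℕ) × (Fin n → Bool) → Fin n → ℤ := fun p i =>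
    if p.2 i then (p.1 i : ℤ) else -(p.1 i + 1)
  have hk : Function.Injective k := by
    rintro ⟨m, σ⟩ ⟨m', σ'⟩ h
    have h' : ∀ i, σ i = σ' i ∧ m i = m' i := by
      intro i
      have hi := congr_fun h i
      simp only [k] at hi
      cases hσ : σ i <;> cases hσ' : σ' i <;> simp [hσ, hσ'] at hi ⊢ <;> omega
    exact Prod.ext (funext fun i => (h' i).2) (funext fun i => (h' i).1)
  have key := card_mul_le_vol (n := n) (freq n ρ ×ˢ (Finset.univ : Finset (Fin n → Bool)))
    (s := 1) one_pos k hk.injOn (S := Metric.closedBall 0 (ρ + Real.sqrt n))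
    measure_closedBall_lt_top.ne (by
      rintro ⟨m, σ⟩ hm x hx
      rw [Finset.mem_product, mem_freq hρ] at hm
      have hxi : ∀ i, |x i| ≤ m i + 1 := by
        intro i
        obtain ⟨h1, h2⟩ := hx i
        simp only [k, mul_one] at h1 h2
        rw [abs_le]
        cases hσ : σ i <;> simp only [hσ, if_true, if_false, Bool.false_eq_true] at h1 h2 <;>
          push_cast at h1 h2 <;> constructor <;> linarith [(Nat.cast_nonneg (m i) : (0:ℝ) ≤ m i)]
      rw [mem_closedBall_zero_iff]
      have e1 : ‖x‖ ≤ ‖(WithLp.toLp 2 fun i => (m i : ℝ) : E n) + WithLp.toLp 2 fun _ => (1:ℝ)‖ := by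
        rw [EuclideanSpace.norm_eq, EuclideanSpace.norm_eq]
        refine Real.sqrt_le_sqrt (Finset.sum_le_sum fun i _ => ?_)
        refine pow_le_pow_left₀ (norm_nonneg _) ?_ 2
        rw [Real.norm_eq_abs, Real.norm_eq_abs]
        exact (hxi i).trans (le_abs_self _)
      refine e1.trans ((norm_add_le _ _).trans (add_le_add ?_ (le_of_eq ?_)))
      · rw [EuclideanSpace.norm_eq]
        refine Real.sqrt_le_iff.2 ⟨hρ, ?_⟩
        simpa using hm.1
      · rw [EuclideanSpace.norm_eq]; simp)
  rw [Finset.card_product, volume_ball_eq _ (by positivity) _ hn] at key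
  simp only [Finset.card_univ, Fintype.card_pi, Fintype.card_bool, Finset.prod_const,
    Fintype.card_fin, one_pow, mul_one] at key
  push_cast at key
  rw [div_mul_eq_mul_div, le_div_iff₀ (by positivity)]
  linarith

theorem sq_le_of_notMem_freq {n : ℕ} {s R : ℝ} (hs : 0 < s) (hR : 0 ≤ R) (m : Fin n → ℕ)
    (hm : m ∉ freq n (s * R / Real.pi)) : R ^ 2 ≤ ∑ i, (Real.pi / s * (m i : ℝ)) ^ 2 := by
  have hπ := Real.pi_pos
  rw [mem_freq (by positivity), not_le] at hm
  simp_rw [mul_pow]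
  rw [← Finset.mul_sum]
  calc R ^ 2 = (Real.pi / s) ^ 2 * (s * R / Real.pi) ^ 2 := by field_simp
    _ ≤ _ := by gcongr


/-! ### The dyadic decomposition -/

/-- The points of `Ω` that are close to the complement of `Ω`, in the maximum norm. -/
def innerStrip {n : ℕ} (Ω : Set (E n)) (t : ℝ) : Set (E n) :=
  {x | x ∈ Ω ∧ ∃ y, y ∉ Ω ∧ ∀ i, |x i - y i| < t}

/-- The points that are close to both `Ω` and its complement, in the maximum norm. -/
def boundaryShell {n : ℕ} (Ω : Set (E n)) (t : ℝ) : Set (E n) :=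
  {x | (∃ z ∈ Ω, ∀ i, |x i - z i| < t) ∧ ∃ y, y ∉ Ω ∧ ∀ i, |x i - y i| < t}

theorem abs_sub_lt_of_mem_box {n : ℕ} {a : Fin n → ℝ} {s : ℝ} {x y : E n} (hx : x ∈ box a s)
    (hy : y ∈ box a s) (i : Fin n) : |x i - y i| < s := by
  rw [abs_lt]; constructor <;> linarith [(hx i).1, (hx i).2, (hy i).1, (hy i).2]

/-- Dyadic cubes that share a point are nested: in each coordinate the shared point gives strict
inequalities between integers, which improve by one to containment of the intervals. -/
theorem gridBox_subset {n : ℕ} {s s' : ℝ} (hs : 0 < s) {d : ℕ} (hd : s' = 2 ^ d * s)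
    {k k' : Fin n → ℤ} {x : E n} (h : x ∈ gridBox s k) (h' : x ∈ gridBox s' k') :
    (gridBox s k : Set (E n)) ⊆ gridBox s' k' := by
  subst hd
  intro y hy i
  obtain ⟨h1, h2⟩ := h i
  obtain ⟨h3, h4⟩ := h' i
  obtain ⟨h5, h6⟩ := hy i
  have e1 : k' i * 2 ^ d < k i + 1 := by
    have : ((k' i * 2 ^ d : ℤ) : ℝ) * s < ((k i + 1 : ℤ) : ℝ) * s := by push_cast; linarith
    exact_mod_cast lt_of_mul_lt_mul_right this hs.le
  have e2 : k i < (k' i + 1) * 2 ^ d := by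
    have : ((k i : ℤ) : ℝ) * s < (((k' i + 1) * 2 ^ d : ℤ) : ℝ) * s := by push_cast; linarith
    exact_mod_cast lt_of_mul_lt_mul_right this hs.le
  have f1 : ((k' i * 2 ^ d : ℤ) : ℝ) * s ≤ (k i : ℝ) * s := by
    have : k' i * 2 ^ d ≤ k i := by omega
    exact mul_le_mul_of_nonneg_right (by exact_mod_cast this) hs.le
  have f2 : ((k i + 1 : ℤ) : ℝ) * s ≤ (((k' i + 1) * 2 ^ d : ℤ) : ℝ) * s := by
    have : k i + 1 ≤ (k' i + 1) * 2 ^ d := by omega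
    exact mul_le_mul_of_nonneg_right (by exact_mod_cast this) hs.le
  push_cast at f1 f2
  constructor <;> linarith

theorem mem_gridBox_floor {n : ℕ} {s : ℝ} (hs : 0 < s) (x : E n) :
    x ∈ gridBox s fun i => ⌊x i / s⌋ := (mem_gridBox hs _ x).2 fun _ => rfl

theorem finite_gridBox_inter {n : ℕ} {Ω : Set (E n)} (hb : Bornology.IsBounded Ω) {s : ℝ}
    (hs : 0 < s) : {k : Fin n → ℤ | (gridBox s k ∩ Ω).Nonempty}.Finite := by
  obtain ⟨r, hr⟩ := hb.subset_closedBall 0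
  refine (Set.finite_Icc (fun _ => ⌊-r / s⌋) (fun _ => ⌊r / s⌋)).subset ?_
  rintro k ⟨x, hx, hxΩ⟩
  have hxr : ∀ i, |x i| ≤ r := fun i => by
    have h1 := hr hxΩ
    rw [mem_closedBall_zero_iff] at h1
    exact (PiLp.norm_apply_le x i).trans h1
  rw [mem_gridBox hs] at hx
  constructor <;> intro i <;> rw [← hx i] <;> refine Int.floor_le_floor ?_ <;>
    gcongr <;> linarith [(abs_le.1 (hxr i)).1, (abs_le.1 (hxr i)).2]

/-- Indices of the maximal dyadic cubes of side `2 ^ j * s`, `j ≤ J`, contained in `Ω`. -/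
def maximalCubes {n : ℕ} (Ω : Set (E n)) (s : ℝ) (J j : ℕ) : Set (Fin n → ℤ) :=
  {k | gridBox (2 ^ j * s) k ⊆ Ω ∧ (j < J → ∀ k', gridBox (2 ^ j * s) k ⊆
    gridBox (2 ^ (j + 1) * s) k' → ¬ gridBox (2 ^ (j + 1) * s) k' ⊆ Ω)}

/-- Indices of the cubes of side `s` that meet `Ω` without being contained in it. -/
def boundaryCubes {n : ℕ} (Ω : Set (E n)) (s : ℝ) : Set (Fin n → ℤ) :=
  {k | (gridBox s k ∩ Ω).Nonempty ∧ ¬ gridBox s k ⊆ Ω}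

theorem gridBox_nonempty {n : ℕ} {s : ℝ} (hs : 0 < s) (k : Fin n → ℤ) :
    (gridBox s k : Set (E n)).Nonempty :=
  ⟨WithLp.toLp 2 fun i => k i * s, fun i => ⟨le_rfl, by simpa using hs⟩⟩

theorem finite_maximalCubes {n : ℕ} {Ω : Set (E n)} (hb : Bornology.IsBounded Ω) {s : ℝ}
    (hs : 0 < s) (J j : ℕ) : (maximalCubes Ω s J j).Finite := by
  refine (finite_gridBox_inter hb (s := 2 ^ j * s) (by positivity)).subset ?_
  rintro k ⟨hk, -⟩
  obtain ⟨x, hx⟩ := gridBox_nonempty (n := n) (s := 2 ^ j * s) (by positivity) k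
  exact ⟨x, hx, hk hx⟩

theorem finite_boundaryCubes {n : ℕ} {Ω : Set (E n)} (hb : Bornology.IsBounded Ω) {s : ℝ}
    (hs : 0 < s) : (boundaryCubes Ω s).Finite :=
  (finite_gridBox_inter hb hs).subset fun _ hk => hk.1

theorem two_pow_add_mul (j d : ℕ) (s : ℝ) : (2 : ℝ) ^ (j + d) * s = 2 ^ d * (2 ^ j * s) := by
  rw [pow_add]; ring

theorem dyadic_cover {n : ℕ} {Ω : Set (E n)} {s : ℝ} (hs : 0 < s) (J : ℕ) {x : E n} (hx : x ∈ Ω) :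
    (∃ j ≤ J, ∃ k ∈ maximalCubes Ω s J j, x ∈ gridBox (2 ^ j * s) k) ∨
      ∃ k ∈ boundaryCubes Ω s, x ∈ gridBox s k := by
  classical
  have hsj : ∀ j : ℕ, 0 < 2 ^ j * s := fun j => by positivity
  let Q : ℕ → Prop := fun j => gridBox (2 ^ j * s) (fun i => ⌊x i / (2 ^ j * s)⌋) ⊆ Ω
  by_cases h0 : Q 0
  · left
    -- The largest good scale at `x`. `Nat.findGreatest` returns `0` when nothing satisfies `Q`,
    -- hence the case distinction on `Q 0`.
    refine ⟨Nat.findGreatest Q J, Nat.findGreatest_le J, fun i => ⌊x i / _⌋, ⟨?_, ?_⟩,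
      mem_gridBox_floor (hsj _) x⟩
    · exact Nat.findGreatest_spec (P := Q) (Nat.zero_le J) h0
    · intro hlt k' hk' hsub
      have hxk' := hk' (mem_gridBox_floor (hsj _) x)
      refine Nat.findGreatest_is_greatest (P := Q) (Nat.lt_succ_self _) hlt ?_
      have := gridBox_index_unique (hsj _) (mem_gridBox_floor (hsj _) x) hxk'
      change gridBox _ _ ⊆ Ω
      rw [this]
      exact hsub
  · right
    refine ⟨fun i => ⌊x i / s⌋, ⟨⟨x, mem_gridBox_floor hs x, hx⟩, ?_⟩, mem_gridBox_floor hs x⟩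
    simpa [Q] using h0

/-- If the cubes met, the parent of the smaller one would lie in the larger one and hence in `Ω`,
against maximality. -/
theorem maximalCubes_disjoint {n : ℕ} {Ω : Set (E n)} {s : ℝ} (hs : 0 < s) {J j j' : ℕ}
    (hj' : j' ≤ J) (hlt : j < j') {k k' : Fin n → ℤ} (hk : k ∈ maximalCubes Ω s J j)
    (hk' : k' ∈ maximalCubes Ω s J j') :
    Disjoint (gridBox (2 ^ j * s) k : Set (E n)) (gridBox (2 ^ j' * s) k') := by
  rw [Set.disjoint_left]
  intro x hx hx'
  have hsj : ∀ j : ℕ, 0 < 2 ^ j * s := fun j => by positivity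
  obtain ⟨d, rfl⟩ := Nat.exists_eq_add_of_lt hlt
  have hxp := mem_gridBox_floor (hsj (j + 1)) x
  have h1 : gridBox (2 ^ j * s) k ⊆ gridBox (2 ^ (j + 1) * s) fun i => ⌊x i / (2 ^ (j + 1) * s)⌋ :=
    gridBox_subset (hsj j) (two_pow_add_mul j 1 s) hx hxp
  refine hk.2 (by omega) _ h1 (Subset.trans ?_ hk'.1)
  exact gridBox_subset (hsj (j + 1)) (d := d) (by ring) hxp hx'

theorem boundaryCubes_disjoint {n : ℕ} {Ω : Set (E n)} {s : ℝ} (hs : 0 < s) {J j : ℕ}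
    {k k' : Fin n → ℤ} (hk : k ∈ boundaryCubes Ω s) (hk' : k' ∈ maximalCubes Ω s J j) :
    Disjoint (gridBox s k : Set (E n)) (gridBox (2 ^ j * s) k') := by
  rw [Set.disjoint_left]
  intro x hx hx'
  exact hk.2 ((gridBox_subset hs rfl hx hx').trans hk'.1)

/-- The parent, of side `2 * (2 ^ j * s)`, contains a point outside `Ω`, so the whole cube is within
that distance of the complement. This fails at the top scale `j = J`, where no parent is considered.
-/
theorem card_maximalCubes_mul_le {n : ℕ} {Ω : Set (E n)} (hb : Bornology.IsBounded Ω) {s : ℝ}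
    (hs : 0 < s) {J j : ℕ} (hj : j < J) :
    ((finite_maximalCubes hb hs J j).toFinset.card : ℝ) * (2 ^ j * s) ^ n ≤
      vol (innerStrip Ω (2 * (2 ^ j * s))) := by
  have hsj : ∀ j : ℕ, 0 < 2 ^ j * s := fun j => by positivity
  refine card_mul_le_vol _ (hsj j) id (injOn_id _) ?_ ?_
  · exact (hb.subset fun x hx => hx.1).measure_lt_top.ne
  · intro k hk x hx
    rw [Set.Finite.mem_toFinset] at hk
    refine ⟨hk.1 hx, ?_⟩
    have hxp := mem_gridBox_floor (hsj (j + 1)) x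
    have h1 : gridBox (2 ^ j * s) k ⊆
        gridBox (2 ^ (j + 1) * s) fun i => ⌊x i / (2 ^ (j + 1) * s)⌋ :=
      gridBox_subset (hsj j) (two_pow_add_mul j 1 s) hx hxp
    obtain ⟨y, hy, hyΩ⟩ := Set.not_subset.1 (hk.2 hj _ h1)
    refine ⟨y, hyΩ, fun i => ?_⟩
    have := abs_sub_lt_of_mem_box hxp hy i
    rwa [two_pow_add_mul, pow_one] at this

theorem card_boundaryCubes_mul_le {n : ℕ} {Ω : Set (E n)} (hb : Bornology.IsBounded Ω) {s : ℝ}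
    (hs : 0 < s) (hfin : volume (boundaryShell Ω s) ≠ ⊤) :
    ((finite_boundaryCubes hb hs).toFinset.card : ℝ) * s ^ n ≤ vol (boundaryShell Ω s) := by
  refine card_mul_le_vol _ hs id (injOn_id _) hfin ?_
  intro k hk x hx
  rw [Set.Finite.mem_toFinset] at hk
  obtain ⟨⟨z, hz, hzΩ⟩, h2⟩ := hk
  obtain ⟨y, hy, hyΩ⟩ := Set.not_subset.1 h2
  exact ⟨⟨z, hzΩ, abs_sub_lt_of_mem_box hx hz⟩, y, hyΩ, abs_sub_lt_of_mem_box hx hy⟩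

theorem sum_card_maximalCubes_mul_le {n : ℕ} {Ω : Set (E n)} (hb : Bornology.IsBounded Ω) {s : ℝ}
    (hs : 0 < s) (J : ℕ) :
    ∑ j ∈ Finset.range (J + 1), ((finite_maximalCubes hb hs J j).toFinset.card : ℝ) *
      (2 ^ j * s) ^ n ≤ vol Ω := by
  have hsj : ∀ j : ℕ, 0 < 2 ^ j * s := fun j => by positivity
  set T := (Finset.range (J + 1)).sigma fun j => (finite_maximalCubes hb hs J j).toFinset with hT
  have h1 : volume (⋃ c ∈ T, (gridBox (2 ^ c.1 * s) c.2 : Set (E n))) =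
      ∑ c ∈ T, volume (gridBox (2 ^ c.1 * s) c.2 : Set (E n)) := by
    refine measure_biUnion_finset ?_ fun c _ => measurableSet_box _ _
    rintro ⟨j, k⟩ hc ⟨j', k'⟩ hc' hne
    simp only [hT, Finset.coe_sigma, Set.mem_sigma_iff, Finset.mem_coe, Finset.mem_range,
      Set.Finite.mem_toFinset] at hc hc'
    rcases lt_trichotomy j j' with h | h | h
    · exact maximalCubes_disjoint hs (by omega) h hc.2 hc'.2
    · subst h
      refine Set.disjoint_left.2 fun x hx hx' => hne ?_
      exact congrArg _ (gridBox_index_unique (hsj j) hx hx')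
    · exact (maximalCubes_disjoint hs (by omega) h hc'.2 hc.2).symm
  have h2 : volume (⋃ c ∈ T, (gridBox (2 ^ c.1 * s) c.2 : Set (E n))) ≤ volume Ω := by
    refine measure_mono (iUnion₂_subset ?_)
    rintro ⟨j, k⟩ hc
    simp only [hT, Finset.mem_sigma, Set.Finite.mem_toFinset] at hc
    exact hc.2.1
  rw [h1, hT, Finset.sum_sigma] at h2
  simp_rw [gridBox, volume_box _ (hsj _).le] at h2
  have h3 := ENNReal.toReal_mono hb.measure_lt_top.ne h2
  rw [ENNReal.toReal_sum (by simp [ENNReal.mul_eq_top])] at h3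
  refine le_trans (le_of_eq (Finset.sum_congr rfl fun j _ => ?_)) h3
  have := hsj j
  rw [Finset.sum_const, nsmul_eq_mul, ENNReal.toReal_mul, ENNReal.toReal_natCast,
    ENNReal.toReal_ofReal (by positivity)]

theorem eigenvalueCount_le_dyadic {n : ℕ} {Ω : Set (E n)} (hb : Bornology.IsBounded Ω) {s : ℝ}
    (hs : 0 < s) (J : ℕ) {t R : ℝ} (hR : 0 ≤ R) (htR : t < R ^ 2) :
    ∃ N : ℕ, eigenvalueCount Ω t ≤ (N : Cardinal) ∧
      N ≤ ∑ j ∈ Finset.range (J + 1), (finite_maximalCubes hb hs J j).toFinset.card *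
        (freq n (2 ^ j * s * R / Real.pi)).card +
        (finite_boundaryCubes hb hs).toFinset.card * (freq n (s * R / Real.pi)).card := by
  classical
  have hsj : ∀ j : ℕ, 0 < 2 ^ j * s := fun j => by positivity
  set A := fun j => (finite_maximalCubes hb hs J j).toFinset with hA
  set B := (finite_boundaryCubes hb hs).toFinset with hB
  -- Boundary cubes have side `s = 2 ^ 0 * s`, so they are filed together with the maximal cubes of
  -- scale `0`.
  set T := (Finset.range (J + 1)).sigma fun j => A j ∪ if j = 0 then B else ∅ with hT
  have hmem : ∀ j k, (⟨j, k⟩ : Σ _ : ℕ, Fin n → ℤ) ∈ T ↔ j ≤ J ∧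
      (k ∈ maximalCubes Ω s J j ∨ (j = 0 ∧ k ∈ boundaryCubes Ω s)) := by
    intro j k
    simp only [hT, Finset.mem_sigma, Finset.mem_range, Nat.lt_succ_iff, Finset.mem_union, hA, hB,
      Set.Finite.mem_toFinset]
    by_cases h : j = 0 <;> simp [h]
  have hlt : ∀ j j' k k', (⟨j, k⟩ : Σ _ : ℕ, Fin n → ℤ) ∈ T →
      (⟨j', k'⟩ : Σ _ : ℕ, Fin n → ℤ) ∈ T → j < j' →
      Disjoint (gridBox (2 ^ j * s) k : Set (E n)) (gridBox (2 ^ j' * s) k') := by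
    intro j j' k k' h h' hjj
    rw [hmem] at h h'
    have hk' : k' ∈ maximalCubes Ω s J j' := by
      rcases h'.2 with h2 | h2
      · exact h2
      · omega
    rcases h.2 with h2 | ⟨rfl, h2⟩
    · exact maximalCubes_disjoint hs h'.1 hjj h2 hk'
    · rw [pow_zero, one_mul]
      exact boundaryCubes_disjoint hs h2 hk'
  refine ⟨_, eigenvalueCount_le T (fun c i => c.2 i * (2 ^ c.1 * s)) (fun c => 2 ^ c.1 * s)
    (fun c => hsj c.1) ?_ ?_ htR (fun c => freq n (2 ^ c.1 * s * R / Real.pi))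
    (fun c m hm => sq_le_of_notMem_freq (hsj _) hR m hm), ?_⟩
  · rintro ⟨j, k⟩ hc ⟨j', k'⟩ hc' hne
    rcases lt_trichotomy j j' with h | h | h
    · exact hlt _ _ _ _ hc hc' h
    · subst h
      refine Set.disjoint_left.2 fun x hx hx' => hne ?_
      exact congrArg _ (gridBox_index_unique (hsj j) hx hx')
    · exact (hlt _ _ _ _ hc' hc h).symm
  · intro x hx
    rw [mem_iUnion₂]
    rcases dyadic_cover hs J hx with ⟨j, hj, k, hk, hxk⟩ | ⟨k, hk, hxk⟩
    · exact ⟨⟨j, k⟩, (hmem j k).2 ⟨hj, Or.inl hk⟩, hxk⟩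
    · refine ⟨⟨0, k⟩, (hmem 0 k).2 ⟨Nat.zero_le _, Or.inr ⟨rfl, hk⟩⟩, ?_⟩
      simpa using hxk
  · rw [hT, Finset.sum_sigma]
    simp only [Finset.sum_const, smul_eq_mul]
    have h1 : ∀ j ∈ Finset.range (J + 1), (A j ∪ if j = 0 then B else ∅).card *
        (freq n (2 ^ j * s * R / Real.pi)).card ≤ (A j).card *
        (freq n (2 ^ j * s * R / Real.pi)).card +
        if j = 0 then B.card * (freq n (s * R / Real.pi)).card else 0 := by
      intro j _
      by_cases h : j = 0
      · subst h
        simp only [if_true, pow_zero, one_mul]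
        rw [← add_mul]
        exact Nat.mul_le_mul_right _ (Finset.card_union_le _ _)
      · simp [h]
    refine (Finset.sum_le_sum h1).trans ?_
    rw [Finset.sum_add_distrib, Finset.sum_ite_eq' (Finset.range (J + 1)) 0
      (fun _ => B.card * (freq n (s * R / Real.pi)).card)]
    simp [hA]


/-! ### Counting in terms of the boundary strips -/

theorem unitBallVol_nonneg (n : ℕ) : 0 ≤ unitBallVol n := ENNReal.toReal_nonneg

theorem one_add_div_pow_le_two {n : ℕ} (hn : 1 ≤ n) {x : ℝ} (hx0 : 0 ≤ x) (hx : x ≤ 1 / (2 * n)) :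
    (1 + x) ^ n ≤ 2 := by
  have hn' : (0 : ℝ) < n := by exact_mod_cast hn
  have h1 : (1 + x) ^ n ≤ Real.exp (1 / 2) := by
    calc (1 + x) ^ n ≤ (Real.exp x) ^ n := by
          gcongr; linarith [Real.add_one_le_exp x]
      _ = Real.exp (n * x) := by rw [← Real.exp_nat_mul]
      _ ≤ Real.exp (1 / 2) := by
          refine Real.exp_le_exp.2 ?_
          calc (n : ℝ) * x ≤ n * (1 / (2 * n)) := by gcongr
            _ = 1 / 2 := by field_simp
  have h2 : Real.exp (1 / 2) ≤ 2 := by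
    have h3 : Real.exp (1 / 2) ^ 2 = Real.exp 1 := by
      rw [← Real.exp_nat_mul]; norm_num
    have h4 := Real.exp_one_lt_d9
    nlinarith [Real.exp_pos (1 / 2)]
  exact h1.trans h2

theorem add_pow_le_two_mul {n : ℕ} (hn : 1 ≤ n) {ρ : ℝ} (hρ : 2 * (n * Real.sqrt n) ≤ ρ) :
    (ρ + Real.sqrt n) ^ n ≤ 2 * ρ ^ n := by
  have hn' : (1 : ℝ) ≤ n := by exact_mod_cast hn
  have hs : 0 < Real.sqrt n := Real.sqrt_pos.2 (by linarith)
  have hρ0 : 0 < ρ := lt_of_lt_of_le (by positivity) hρ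
  have h : ρ + Real.sqrt n = (1 + Real.sqrt n / ρ) * ρ := by field_simp
  rw [h, mul_pow]
  refine mul_le_mul_of_nonneg_right (one_add_div_pow_le_two hn (by positivity) ?_) (by positivity)
  rw [div_le_div_iff₀ hρ0 (by positivity)]
  linarith

/-- Bernoulli's inequality for `(ρ / (ρ + √n)) ^ n` bounds the increment by `n √n (ρ + √n) ^ (n -
1)`. The lower bound on `ρ` replaces `ρ + √n` by `ρ` there, at the cost of a factor `2`. -/
theorem add_pow_le_add {n : ℕ} (hn : 1 ≤ n) {ρ : ℝ} (hρ : 2 * (n * Real.sqrt n) ≤ ρ) :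
    (ρ + Real.sqrt n) ^ n ≤ ρ ^ n + 2 * (n * Real.sqrt n) * ρ ^ (n - 1) := by
  have hn' : (1 : ℝ) ≤ n := by exact_mod_cast hn
  have hs : 0 < Real.sqrt n := Real.sqrt_pos.2 (by linarith)
  have hρ0 : 0 < ρ := lt_of_lt_of_le (by positivity) hρ
  set b := Real.sqrt n
  have hb : 0 < ρ + b := by linarith
  have hbern := one_add_mul_le_pow (a := -(b / (ρ + b))) (by
    have : b / (ρ + b) ≤ 1 := by rw [div_le_one hb]; linarith
    linarith) n
  have e1 : 1 + -(b / (ρ + b)) = ρ / (ρ + b) := by field_simp; ring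
  rw [e1, div_pow, le_div_iff₀ (by positivity)] at hbern
  obtain ⟨k, rfl⟩ : ∃ k, n = k + 1 := ⟨n - 1, by omega⟩
  have e2 : (1 + ((k + 1 : ℕ) : ℝ) * -(b / (ρ + b))) * (ρ + b) ^ (k + 1) =
      (ρ + b) ^ (k + 1) - ((k + 1 : ℕ) : ℝ) * b * (ρ + b) ^ k := by
    rw [pow_succ]; field_simp; ring
  rw [e2] at hbern
  have h2 := add_pow_le_two_mul hn hρ
  have h3 : (ρ + b) ^ k ≤ 2 * ρ ^ k := by
    have h4 : (ρ + b) ^ k * ρ ≤ 2 * ρ ^ k * ρ := by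
      calc (ρ + b) ^ k * ρ ≤ (ρ + b) ^ k * (ρ + b) := by gcongr; linarith
        _ = (ρ + b) ^ (k + 1) := by ring
        _ ≤ 2 * ρ ^ (k + 1) := h2
        _ = 2 * ρ ^ k * ρ := by ring
    exact le_of_mul_le_mul_right h4 hρ0
  have h5 : ((k + 1 : ℕ) : ℝ) * b * (ρ + b) ^ k ≤ ((k + 1 : ℕ) : ℝ) * b * (2 * ρ ^ k) := by gcongr
  rw [Nat.add_sub_cancel]
  linarith

/-- `X` and `Y` are volumes per unit of width of the inner strips and of the boundary shell. The
lower bound on `s R / π` makes the lattice count linearizable on every cube; the upper bound keeps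
the count on a boundary cube bounded. -/
theorem eigenvalueCount_le_of_strips {n : ℕ} (hn : 1 ≤ n) {Ω : Set (E n)}
    (hb : Bornology.IsBounded Ω) {s : ℝ} (hs : 0 < s) (J : ℕ) {t R X Y : ℝ} (hR : 0 < R)
    (htR : t < R ^ 2) (hρ1 : 2 * (n * Real.sqrt n) ≤ s * R / Real.pi)
    (hρ2 : s * R / Real.pi ≤ 4 * (n * Real.sqrt n))
    (hX : ∀ j < J, vol (innerStrip Ω (2 * (2 ^ j * s))) ≤ X * (2 ^ j * s))
    (hYfin : volume (boundaryShell Ω s) ≠ ⊤) (hY : vol (boundaryShell Ω s) ≤ Y * s) :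
    ∃ N : ℕ, eigenvalueCount Ω t ≤ (N : Cardinal) ∧
      (N : ℝ) ≤ unitBallVol n / 2 ^ n * (R / Real.pi) ^ (n - 1) * (vol Ω * (R / Real.pi) +
        2 * (n * Real.sqrt n) * (J * X + vol Ω / (2 ^ J * s)) + 8 * (n * Real.sqrt n) * Y) := by
  obtain ⟨N, hN, hNle⟩ := eigenvalueCount_le_dyadic hb hs J hR.le htR
  refine ⟨N, hN, ?_⟩
  have hπ := Real.pi_pos
  have hsj : ∀ j : ℕ, 0 < 2 ^ j * s := fun j => by positivity
  set q := R / Real.pi with hq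
  have hq0 : 0 < q := by positivity
  set c := (n : ℝ) * Real.sqrt n with hc
  have hc0 : 0 ≤ c := by positivity
  set κ := unitBallVol n / 2 ^ n with hκ
  have hκ0 : 0 ≤ κ := div_nonneg (unitBallVol_nonneg n) (by positivity)
  have hρ : ∀ j : ℕ, 2 * c ≤ 2 ^ j * s * R / Real.pi := by
    intro j
    have h1 : (1 : ℝ) ≤ 2 ^ j := one_le_pow₀ (by norm_num)
    calc 2 * c ≤ s * R / Real.pi := hρ1
      _ = 1 * (s * R / Real.pi) := by ring
      _ ≤ 2 ^ j * (s * R / Real.pi) := by gcongr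
      _ = _ := by ring
  have hqn : q ^ n = q ^ (n - 1) * q := by rw [← pow_succ, Nat.sub_add_cancel hn]
  have hfreq : ∀ j : ℕ, ((freq n (2 ^ j * s * R / Real.pi)).card : ℝ) ≤
      κ * q ^ (n - 1) * ((2 ^ j * s) ^ n * q + 2 * c * ((2 ^ j * s) ^ n / (2 ^ j * s))) := by
    intro j
    have h1 := card_freq_le hn (ρ := 2 ^ j * s * R / Real.pi) (by positivity)
    refine h1.trans ((mul_le_mul_of_nonneg_left (add_pow_le_add hn (hρ j)) hκ0).trans
      (le_of_eq ?_))
    have e : 2 ^ j * s * R / Real.pi = (2 ^ j * s) * q := by rw [hq]; ring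
    have e2 : (2 ^ j * s) ^ n / (2 ^ j * s) = (2 ^ j * s) ^ (n - 1) := by
      rw [div_eq_iff (hsj j).ne', ← pow_succ, Nat.sub_add_cancel hn]
    rw [e, e2, mul_pow (2 ^ j * s) q n, mul_pow (2 ^ j * s) q, hqn]; ring
  have hfreq0 : ((freq n (s * R / Real.pi)).card : ℝ) ≤
      κ * q ^ (n - 1) * (8 * c * (s ^ n / s)) := by
    have h1 := card_freq_le hn (ρ := s * R / Real.pi) (by positivity)
    have e2 : s ^ n / s = s ^ (n - 1) := by
      rw [div_eq_iff hs.ne', ← pow_succ, Nat.sub_add_cancel hn]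
    have e : s * R / Real.pi = s * q := by rw [hq]; ring
    have h2 := mul_le_mul_of_nonneg_left (add_pow_le_two_mul hn hρ1) hκ0
    refine h1.trans (h2.trans ?_)
    have e3 : (s * R / Real.pi) ^ n = (s * R / Real.pi) * (s ^ (n - 1) * q ^ (n - 1)) := by
      rw [e, ← mul_pow, ← pow_succ', Nat.sub_add_cancel hn]
    rw [e3, e2]
    calc κ * (2 * ((s * R / Real.pi) * (s ^ (n - 1) * q ^ (n - 1))))
        ≤ κ * (2 * ((4 * c) * (s ^ (n - 1) * q ^ (n - 1)))) := by gcongr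
      _ = _ := by ring
  set A : ℕ → ℝ := fun j => ((finite_maximalCubes hb hs J j).toFinset.card : ℝ) with hA
  set B : ℝ := ((finite_boundaryCubes hb hs).toFinset.card : ℝ) with hB
  have hA0 : ∀ j, 0 ≤ A j := fun j => Nat.cast_nonneg _
  have hN2 : (N : ℝ) ≤ ∑ j ∈ Finset.range (J + 1), A j *
      ((freq n (2 ^ j * s * R / Real.pi)).card : ℝ) + B * ((freq n (s * R / Real.pi)).card : ℝ) := by
    have h1 : (N : ℝ) ≤ _ := Nat.cast_le.2 hNle
    simpa only [Nat.cast_add, Nat.cast_sum, Nat.cast_mul] using h1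
  have hV := sum_card_maximalCubes_mul_le hb hs J
  have hBs : B * s ^ n / s ≤ Y := by
    rw [div_le_iff₀ hs]
    exact (card_boundaryCubes_mul_le hb hs hYfin).trans hY
  -- Cubes of the top scale need not be near the boundary; their number is bounded by the volume of
  -- `Ω` alone.
  have hAJ : A J * (2 ^ J * s) ^ n / (2 ^ J * s) ≤ vol Ω / (2 ^ J * s) := by
    have h1 := Finset.single_le_sum (f := fun j => A j * (2 ^ j * s) ^ n)
      (fun j _ => mul_nonneg (hA0 j) (pow_nonneg (hsj j).le n))
      (Finset.mem_range.2 (Nat.lt_succ_self J))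
    exact div_le_div_of_nonneg_right (h1.trans hV) (hsj J).le
  have hAj : ∀ j ∈ Finset.range J, A j * (2 ^ j * s) ^ n / (2 ^ j * s) ≤ X := by
    intro j hj
    rw [div_le_iff₀ (hsj j)]
    exact (card_maximalCubes_mul_le hb hs (Finset.mem_range.1 hj)).trans
      (hX j (Finset.mem_range.1 hj))
  have hsumdiv : ∑ j ∈ Finset.range (J + 1), A j * (2 ^ j * s) ^ n / (2 ^ j * s) ≤
      J * X + vol Ω / (2 ^ J * s) := by
    rw [Finset.sum_range_succ]
    refine add_le_add ((Finset.sum_le_sum hAj).trans (le_of_eq ?_)) hAJ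
    simp
  have hstep : ∀ j ∈ Finset.range (J + 1), A j * ((freq n (2 ^ j * s * R / Real.pi)).card : ℝ) ≤
      κ * q ^ (n - 1) * (q * (A j * (2 ^ j * s) ^ n) +
        2 * c * (A j * (2 ^ j * s) ^ n / (2 ^ j * s))) := by
    intro j _
    refine (mul_le_mul_of_nonneg_left (hfreq j) (hA0 j)).trans (le_of_eq ?_)
    ring
  have hsum := Finset.sum_le_sum hstep
  rw [← Finset.mul_sum, Finset.sum_add_distrib, ← Finset.mul_sum, ← Finset.mul_sum] at hsum
  have hBstep : B * ((freq n (s * R / Real.pi)).card : ℝ) ≤ κ * q ^ (n - 1) * (8 * c * Y) := by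
    refine (mul_le_mul_of_nonneg_left hfreq0 (Nat.cast_nonneg _)).trans ?_
    calc B * (κ * q ^ (n - 1) * (8 * c * (s ^ n / s)))
        = κ * q ^ (n - 1) * (8 * c * (B * s ^ n / s)) := by ring
      _ ≤ _ := by gcongr
  have hK0 : 0 ≤ κ * q ^ (n - 1) := by positivity
  calc (N : ℝ) ≤ _ := hN2
    _ ≤ κ * q ^ (n - 1) * (q * vol Ω + 2 * c * (J * X + vol Ω / (2 ^ J * s))) +
        κ * q ^ (n - 1) * (8 * c * Y) := by
        refine add_le_add (hsum.trans ?_) hBstep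
        gcongr
    _ = _ := by ring


/-! ### Sets with disjoint translates -/

theorem volume_rectangle {n : ℕ} (c L : Fin n → ℝ) :
    volume {x : E n | ∀ j, c j ≤ x j ∧ x j ≤ c j + L j} = ∏ j, ENNReal.ofReal (L j) := by
  have h : {x : E n | ∀ j, c j ≤ x j ∧ x j ≤ c j + L j} =
      (WithLp.ofLp : E n → (Fin n → ℝ)) ⁻¹' (pi univ fun i => Icc (c i) (c i + L i)) := by
    ext x; simp [Pi.le_def, forall_and]
  rw [h, (PiLp.volume_preserving_ofLp (Fin n)).measure_preimage
    (MeasurableSet.univ_pi fun i => measurableSet_Icc).nullMeasurableSet, volume_pi_pi]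
  simp

/-- A substitute for Fubini: `m` disjoint translates of `A` fit in a box of volume `ℓ ^ (n - 1) * (ℓ
+ m * t)`; divide by `m` and let `m` tend to infinity. -/
theorem vol_le_of_disjoint_translates {n : ℕ} (i : Fin n) {A : Set (E n)} (hA : MeasurableSet A)
    {c : Fin n → ℝ} {ℓ t : ℝ} (hℓ : 0 ≤ ℓ) (ht : 0 ≤ t)
    (hbox : ∀ x ∈ A, ∀ j, c j ≤ x j ∧ x j ≤ c j + ℓ)
    (hdisj : ∀ x ∈ A, ∀ k : ℕ, 1 ≤ k → x + (k * t) • EuclideanSpace.single i (1 : ℝ) ∉ A) :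
    vol A ≤ t * ℓ ^ (n - 1) := by
  have key : ∀ m : ℕ, (m : ℝ) * vol A ≤ ℓ ^ (n - 1) * (ℓ + m * t) := by
    intro m
    set v : E n := EuclideanSpace.single i (1 : ℝ) with hv
    have hpre : ∀ k : ℕ, volume ((fun x => x + (-(k * t)) • v) ⁻¹' A) = volume A := fun k =>
      measure_preimage_add_right _ _ _
    have hmeas : ∀ k : ℕ, MeasurableSet ((fun x => x + (-(k * t)) • v) ⁻¹' A) := fun k =>
      hA.preimage (by fun_prop)
    have hd : ∀ k k' : ℕ, k < k' → Disjoint ((fun x => x + (-(k * t)) • v) ⁻¹' A)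
        ((fun x => x + (-(k' * t)) • v) ⁻¹' A) := by
      intro k k' hk
      rw [Set.disjoint_left]
      intro x hx hx'
      refine hdisj _ hx' (k' - k) (by omega) ?_
      have : x + (-(k' * t)) • v + (((k' - k : ℕ) : ℝ) * t) • v = x + (-(k * t)) • v := by
        rw [add_assoc, ← add_smul, Nat.cast_sub hk.le]; congr 2; ring
      rw [this]; exact hx
    have h1 : volume (⋃ k ∈ Finset.range m, (fun x => x + (-(k * t)) • v) ⁻¹' A) = m * volume A := by
      rw [measure_biUnion_finset ?_ fun k _ => hmeas k]
      · simp
      · intro k _ k' _ hne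
        rcases lt_or_gt_of_ne hne with h | h
        · exact hd k k' h
        · exact (hd k' k h).symm
    have h2 : volume (⋃ k ∈ Finset.range m, (fun x => x + (-(k * t)) • v) ⁻¹' A) ≤
        volume {x : E n | ∀ j, c j ≤ x j ∧ x j ≤ c j + if j = i then ℓ + m * t else ℓ} := by
      refine measure_mono (iUnion₂_subset fun k hk x hx j => ?_)
      have hkm : (k : ℝ) ≤ m := by exact_mod_cast (Finset.mem_range.1 hk).le
      have h3 := hbox _ hx j
      by_cases hj : j = i
      · subst hj
        simp only [hv, PiLp.add_apply, PiLp.smul_apply, PiLp.single_apply, if_true,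
          smul_eq_mul, mul_one] at h3 ⊢
        have h4 : 0 ≤ k * t := by positivity
        have h5 : (k : ℝ) * t ≤ m * t := by gcongr
        constructor <;> linarith
      · simp only [hv, PiLp.add_apply, PiLp.smul_apply, PiLp.single_apply, hj, if_false,
          smul_eq_mul, mul_zero, add_zero] at h3 ⊢
        exact h3
    rw [h1, volume_rectangle] at h2
    have h3 := ENNReal.toReal_mono (by
      refine (ENNReal.prod_lt_top fun j _ => ENNReal.ofReal_lt_top).ne) h2
    rw [ENNReal.toReal_mul, ENNReal.toReal_natCast, ENNReal.toReal_prod] at h3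
    refine h3.trans (le_of_eq ?_)
    have h4 : ∀ j, (ENNReal.ofReal (if j = i then ℓ + m * t else ℓ)).toReal =
        if j = i then ℓ + m * t else ℓ := fun j => by
      rw [ENNReal.toReal_ofReal]; split_ifs <;> positivity
    simp_rw [h4]
    rw [← Finset.mul_prod_erase _ _ (Finset.mem_univ i), if_pos rfl,
      Finset.prod_congr rfl fun j hj => if_neg (Finset.ne_of_mem_erase hj), Finset.prod_const,
      Finset.card_erase_of_mem (Finset.mem_univ i), Finset.card_univ, Fintype.card_fin]
    ring
  by_contra hcon
  push Not at hcon
  obtain ⟨m, hm⟩ := exists_nat_gt (ℓ ^ (n - 1) * ℓ / (vol A - t * ℓ ^ (n - 1)))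
  rw [div_lt_iff₀ (by linarith)] at hm
  have := key m
  nlinarith

/-! ### Diameter, width and volume -/

theorem exists_corner {n : ℕ} {Ω : Set (E n)} (hne : Ω.Nonempty) (hb : Bornology.IsBounded Ω) :
    ∃ c : Fin n → ℝ, ∀ x ∈ Ω, ∀ j, c j ≤ x j ∧ x j ≤ c j + Metric.diam Ω := by
  have hd : ∀ x ∈ Ω, ∀ y ∈ Ω, ∀ j, x j - y j ≤ Metric.diam Ω := by
    intro x hx y hy j
    have h1 := PiLp.norm_apply_le (x - y) j
    have h2 := Metric.dist_le_diam_of_mem hb hx hy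
    rw [dist_eq_norm] at h2
    exact (le_abs_self _).trans (h1.trans h2)
  obtain ⟨x₀, hx₀⟩ := hne
  refine ⟨fun j => sInf ((fun x : E n => x j) '' Ω), fun x hx j => ⟨?_, ?_⟩⟩
  · refine csInf_le ⟨x₀ j - Metric.diam Ω, ?_⟩ ⟨x, hx, rfl⟩
    rintro _ ⟨y, hy, rfl⟩
    have := hd x₀ hx₀ y hy j
    simp only; linarith
  · have : x j - Metric.diam Ω ≤ sInf ((fun x : E n => x j) '' Ω) := by
      refine le_csInf ⟨x j, x, hx, rfl⟩ ?_
      rintro _ ⟨y, hy, rfl⟩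
      have := hd x hx y hy j
      simp only; linarith
    linarith

theorem exists_coord_ge {n : ℕ} {ν : E n} (hν : ‖ν‖ = 1) : ∃ i, 1 ≤ Real.sqrt n * |ν i| := by
  by_contra hcon
  push Not at hcon
  have hn : 0 < n := by
    rcases Nat.eq_zero_or_pos n with rfl | h
    · have : ν = 0 := by ext i; exact i.elim0
      rw [this, norm_zero] at hν; norm_num at hν
    · exact h
  have h1 : ∑ i, (ν i) ^ 2 = 1 := by rw [← EuclideanSpace.real_norm_sq_eq, hν, one_pow]
  have h2 : ∑ i : Fin n, n * (ν i) ^ 2 < ∑ i : Fin n, (1 : ℝ) := by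
    refine Finset.sum_lt_sum_of_nonempty ⟨⟨0, hn⟩, Finset.mem_univ _⟩ fun i _ => ?_
    have h3 : (Real.sqrt n * |ν i|) ^ 2 < 1 := by
      have := hcon i
      have h0 : 0 ≤ Real.sqrt n * |ν i| := by positivity
      nlinarith
    rwa [mul_pow, sq_abs, Real.sq_sqrt (Nat.cast_nonneg n)] at h3
  rw [← Finset.mul_sum, h1] at h2
  simp at h2

/-- Some coordinate direction has `|ν i| ≥ 1/√n`, so shifting along it by slightly more than `√n *
d` leaves the slab and gives disjoint translates. -/
theorem vol_le_of_slab {n : ℕ} {Ω : Set (E n)} (hΩ : IsBoundedLipschitzDomain Ω) {ν : E n}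
    {a d : ℝ} (hν : ‖ν‖ = 1) (h : ∀ x ∈ Ω, a ≤ inner ℝ ν x ∧ inner ℝ ν x ≤ a + d) :
    vol Ω ≤ Real.sqrt n * d * Metric.diam Ω ^ (n - 1) := by
  obtain ⟨i, hi⟩ := exists_coord_ge hν
  obtain ⟨c, hc⟩ := exists_corner hΩ.nonempty hΩ.isBounded
  have hd : 0 ≤ d := by
    obtain ⟨x, hx⟩ := hΩ.nonempty
    linarith [(h x hx).1, (h x hx).2]
  have hdiam : 0 ≤ Metric.diam Ω := Metric.diam_nonneg
  -- A shift by exactly `√n * d` could join the two closed faces of the slab; the extra `η` rules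
  -- this out.
  have key : ∀ η : ℝ, 0 < η → vol Ω ≤ (Real.sqrt n * (d + η)) * Metric.diam Ω ^ (n - 1) := by
    intro η hη
    refine vol_le_of_disjoint_translates i hΩ.isOpen.measurableSet hdiam (by positivity) hc ?_
    intro x hx k hk hx'
    have h1 := h x hx
    have h2 := h _ hx'
    rw [inner_add_right, inner_smul_right, EuclideanSpace.inner_single_right] at h2
    simp only [one_mul, conj_trivial] at h2
    have hk' : (1 : ℝ) ≤ k := by exact_mod_cast hk
    have h3 : d + η ≤ |k * (Real.sqrt n * (d + η)) * ν i| := by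
      rw [abs_mul, abs_of_nonneg (by positivity)]
      calc d + η = 1 * 1 * (d + η) := by ring
        _ ≤ k * (Real.sqrt n * |ν i|) * (d + η) := by gcongr
        _ = _ := by ring
    have h4 : |k * (Real.sqrt n * (d + η)) * ν i| ≤ d := by
      rw [abs_le]; constructor <;> linarith
    linarith
  refine le_of_forall_pos_le_add fun η hη => ?_
  have hpos : 0 < Real.sqrt n * Metric.diam Ω ^ (n - 1) + 1 := by positivity
  have h1 := key (η / (Real.sqrt n * Metric.diam Ω ^ (n - 1) + 1)) (by positivity)
  refine h1.trans ?_
  have h2 : Real.sqrt n * Metric.diam Ω ^ (n - 1) * (η / (Real.sqrt n * Metric.diam Ω ^ (n - 1) + 1))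
      ≤ η := by
    rw [mul_div_assoc', div_le_iff₀ hpos]
    nlinarith
  linarith

theorem coord_mem_slabs {n : ℕ} (hn : 1 ≤ n) {Ω : Set (E n)} (hΩ : IsBoundedLipschitzDomain Ω) :
    Metric.diam Ω ∈ {d : ℝ | ∃ (ν : E n) (a : ℝ), ‖ν‖ = 1 ∧
      ∀ x ∈ Ω, a ≤ inner ℝ ν x ∧ inner ℝ ν x ≤ a + d} := by
  obtain ⟨c, hc⟩ := exists_corner hΩ.nonempty hΩ.isBounded
  refine ⟨EuclideanSpace.single ⟨0, hn⟩ 1, c ⟨0, hn⟩, by simp, fun x hx => ?_⟩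
  rw [EuclideanSpace.inner_single_left]
  simpa using hc x hx ⟨0, hn⟩

theorem vol_pos {n : ℕ} {Ω : Set (E n)} (hΩ : IsBoundedLipschitzDomain Ω) : 0 < vol Ω :=
  ENNReal.toReal_pos (hΩ.isOpen.measure_pos _ hΩ.nonempty).ne' hΩ.isBounded.measure_lt_top.ne

theorem diam_pos {n : ℕ} (hn : 1 ≤ n) {Ω : Set (E n)} (hΩ : IsBoundedLipschitzDomain Ω) :
    0 < Metric.diam Ω := by
  obtain ⟨ν, a, hν, h⟩ := coord_mem_slabs hn hΩ
  have h1 := vol_le_of_slab hΩ hν h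
  refine lt_of_le_of_ne Metric.diam_nonneg fun h0 => ?_
  rw [← h0] at h1
  have := vol_pos hΩ
  simp only [mul_zero, zero_mul] at h1
  linarith

theorem width_le_diam {n : ℕ} (hn : 1 ≤ n) {Ω : Set (E n)} (hΩ : IsBoundedLipschitzDomain Ω) :
    width Ω ≤ Metric.diam Ω := by
  refine csInf_le ⟨0, ?_⟩ (coord_mem_slabs hn hΩ)
  rintro d ⟨ν, a, -, h⟩
  obtain ⟨x, hx⟩ := hΩ.nonempty
  linarith [(h x hx).1, (h x hx).2]

theorem vol_le_width {n : ℕ} (hn : 1 ≤ n) {Ω : Set (E n)} (hΩ : IsBoundedLipschitzDomain Ω) :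
    vol Ω ≤ Real.sqrt n * width Ω * Metric.diam Ω ^ (n - 1) := by
  have hd := diam_pos hn hΩ
  have hs : 0 < Real.sqrt n := Real.sqrt_pos.2 (by exact_mod_cast hn)
  have h : vol Ω / (Real.sqrt n * Metric.diam Ω ^ (n - 1)) ≤ width Ω := by
    refine le_csInf ⟨_, coord_mem_slabs hn hΩ⟩ ?_
    rintro d ⟨ν, a, hν, h⟩
    rw [div_le_iff₀ (by positivity)]
    linarith [vol_le_of_slab hΩ hν h]
  rw [div_le_iff₀ (by positivity)] at h
  linarith

theorem width_pos {n : ℕ} (hn : 1 ≤ n) {Ω : Set (E n)} (hΩ : IsBoundedLipschitzDomain Ω) :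
    0 < width Ω := by
  by_contra hcon
  push Not at hcon
  have h1 := vol_le_width hn hΩ
  have h2 := vol_pos hΩ
  have hd := diam_pos hn hΩ
  have : Real.sqrt n * width Ω * Metric.diam Ω ^ (n - 1) ≤ 0 :=
    mul_nonpos_of_nonpos_of_nonneg (mul_nonpos_of_nonneg_of_nonpos (by positivity) hcon)
      (by positivity)
  linarith

/-! ### Boundary strips of convex sets -/

theorem isBounded_of_box {n : ℕ} {T : Set (E n)} {c : Fin n → ℝ} {ℓ : ℝ}
    (hbox : ∀ x ∈ T, ∀ j, c j ≤ x j ∧ x j ≤ c j + ℓ) : Bornology.IsBounded T := by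
  refine (Metric.isBounded_iff_subset_closedBall 0).2 ⟨∑ j, (|c j| + |ℓ|), fun x hx => ?_⟩
  rw [mem_closedBall_zero_iff]
  refine (EuclideanSpace.norm_eq x).le.trans (Real.sqrt_le_iff.2 ⟨by positivity, ?_⟩)
  refine le_trans (Finset.sum_le_sum (g := fun j => (|c j| + |ℓ|) ^ 2) fun j _ => ?_)
    (Finset.sum_sq_le_sq_sum_of_nonneg fun j _ => by positivity)
  refine pow_le_pow_left₀ (norm_nonneg _) ?_ 2
  have := hbox x hx j
  rw [Real.norm_eq_abs, abs_le]
  constructor <;> linarith [neg_abs_le (c j), le_abs_self (c j), le_abs_self ℓ, abs_nonneg ℓ]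

/-- Erosion one coordinate at a time: keep the points whose two shifts by `t` along the axis stay in
the set. By convexity each removed piece is disjoint from its translates along that axis, so it has
volume at most `t * ℓ ^ (n - 1)`. -/
theorem exists_eroded {n : ℕ} {T : Set (E n)} (hTo : IsOpen T) (hTc : Convex ℝ T)
    {c : Fin n → ℝ} {ℓ t : ℝ} (hℓ : 0 ≤ ℓ) (ht : 0 ≤ t)
    (hbox : ∀ x ∈ T, ∀ j, c j ≤ x j ∧ x j ≤ c j + ℓ) (S : Finset (Fin n)) :
    ∃ T' ⊆ T, IsOpen T' ∧ Convex ℝ T' ∧ vol (T \ T') ≤ S.card * (2 * t * ℓ ^ (n - 1)) ∧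
      ∀ x ∈ T', ∀ y : E n, (∀ i ∈ S, |x i - y i| ≤ t) → (∀ i ∉ S, x i = y i) → y ∈ T := by
  classical
  induction S using Finset.induction_on with
  | empty =>
    refine ⟨T, Subset.rfl, hTo, hTc, by simp [vol], fun x hx y _ h => ?_⟩
    have : x = y := by ext i; exact h i (by simp)
    exact this ▸ hx
  | insert i S hi ih =>
    obtain ⟨T', hT'T, hT'o, hT'c, hvol, hT'⟩ := ih
    set v : E n := EuclideanSpace.single i (1 : ℝ) with hv
    set P := (fun x => x + t • v) ⁻¹' T' with hP
    set Q := (fun x => x + (-t) • v) ⁻¹' T' with hQ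
    have hPo : IsOpen P := hT'o.preimage (by fun_prop)
    have hQo : IsOpen Q := hT'o.preimage (by fun_prop)
    refine ⟨T' ∩ (P ∩ Q), inter_subset_left.trans hT'T, hT'o.inter (hPo.inter hQo),
      hT'c.inter ((hT'c.translate_preimage_left _).inter (hT'c.translate_preimage_left _)),
      ?_, ?_⟩
    · have hbox' : ∀ x ∈ T', ∀ j, c j ≤ x j ∧ x j ≤ c j + ℓ := fun x hx => hbox x (hT'T hx)
      have h1 : vol (T' \ P) ≤ t * ℓ ^ (n - 1) := by
        refine vol_le_of_disjoint_translates i (hT'o.measurableSet.diff hPo.measurableSet) hℓ ht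
          (fun x hx => hbox' x hx.1) ?_
        intro x hx k hk hx'
        -- If `x` and `x + k t v` are both in `T'`, the segment between them contains `x + t v`, so
        -- `x` was not removed.
        refine hx.2 ?_
        have hk' : (1 : ℝ) ≤ k := by exact_mod_cast hk
        have h2 := hT'c hx.1 hx'.1 (a := 1 - 1 / (k : ℝ)) (b := 1 / (k : ℝ))
          (by rw [sub_nonneg, div_le_one (by linarith)]; exact hk') (by positivity) (by ring)
        have e : (1 - 1 / (k : ℝ)) • x + (1 / (k : ℝ)) • (x + ((k : ℝ) * t) • v) = x + t • v := by
          rw [smul_add, smul_smul, ← add_assoc, ← add_smul]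
          congr 2
          · simp
          · field_simp
        change x + t • v ∈ T'
        rw [← e]; exact h2
      have h2 : vol (T' \ Q) ≤ t * ℓ ^ (n - 1) := by
        refine vol_le_of_disjoint_translates i (hT'o.measurableSet.diff hQo.measurableSet) hℓ ht
          (fun x hx => hbox' x hx.1) ?_
        intro x hx k hk hx'
        -- For the backward shift it is the far end of the segment that cannot have been removed.
        refine hx'.2 ?_
        have hk' : (1 : ℝ) ≤ k := by exact_mod_cast hk
        have h2 := hT'c hx.1 hx'.1 (a := 1 / (k : ℝ)) (b := 1 - 1 / (k : ℝ)) (by positivity)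
          (by rw [sub_nonneg, div_le_one (by linarith)]; exact hk') (by ring)
        have e : (1 / (k : ℝ)) • x + (1 - 1 / (k : ℝ)) • (x + ((k : ℝ) * t) • v) =
            x + ((k : ℝ) * t) • v + (-t) • v := by
          rw [smul_add, smul_smul, ← add_assoc, ← add_smul, add_assoc, ← add_smul]
          congr 2
          · simp
          · field_simp; ring
        change x + ((k : ℝ) * t) • v + (-t) • v ∈ T'
        rw [← e]; exact h2
      have hbT := isBounded_of_box hbox
      have hsub : T \ (T' ∩ (P ∩ Q)) ⊆ (T \ T') ∪ ((T' \ P) ∪ (T' \ Q)) := by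
        intro x hx
        by_cases h1 : x ∈ T' <;> by_cases h2 : x ∈ P <;> by_cases h3 : x ∈ Q <;>
          simp_all
      have hfin : volume ((T \ T') ∪ ((T' \ P) ∪ (T' \ Q))) ≠ ⊤ := by
        refine (hbT.subset ?_).measure_lt_top.ne
        exact union_subset sdiff_subset (union_subset (sdiff_subset.trans hT'T)
          (sdiff_subset.trans hT'T))
      have h3 : vol (T \ (T' ∩ (P ∩ Q))) ≤ vol (T \ T') + (vol (T' \ P) + vol (T' \ Q)) := by
        have g1 : vol (T \ (T' ∩ (P ∩ Q))) ≤ vol ((T \ T') ∪ ((T' \ P) ∪ (T' \ Q))) :=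
          ENNReal.toReal_mono hfin (measure_mono hsub)
        refine g1.trans ((measureReal_union_le (μ := volume) _ _).trans ?_)
        exact add_le_add le_rfl (measureReal_union_le (μ := volume) _ _)
      rw [Finset.card_insert_of_notMem hi]
      push_cast
      linarith
    · rintro x ⟨hx, hxP, hxQ⟩ y hy hy'
      -- Moving only coordinate `i` stays on the segment between the two shifts of `x`; the other
      -- coordinates are left to the induction hypothesis.
      set z : E n := x + (y i - x i) • v with hz
      have hzi : z i = y i := by simp [hz, hv]
      have hzj : ∀ j, j ≠ i → z j = x j := fun j hj => by simp [hz, hv, hj]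
      have hyi := abs_le.1 (hy i (Finset.mem_insert_self i S))
      have hzT : z ∈ T' := by
        rcases ht.eq_or_lt with h0 | h0
        · have : y i - x i = 0 := by rw [← h0] at hyi; linarith [hyi.1, hyi.2]
          rw [hz, this, zero_smul, add_zero]; exact hx
        · have h1 := hT'c hxP hxQ (a := (t + (y i - x i)) / (2 * t))
            (b := (t - (y i - x i)) / (2 * t)) (div_nonneg (by linarith) (by linarith))
            (div_nonneg (by linarith) (by linarith)) (by field_simp; ring)
          have e : ((t + (y i - x i)) / (2 * t)) • (x + t • v) +
              ((t - (y i - x i)) / (2 * t)) • (x + (-t) • v) = z := by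
            ext j
            simp only [hz, PiLp.add_apply, PiLp.smul_apply, smul_eq_mul]
            field_simp; ring
          rw [← e]; exact h1
      refine hT' z hzT y (fun j hj => ?_) fun j hj => ?_
      · have hji : j ≠ i := fun h => hi (h ▸ hj)
        rw [hzj j hji]
        exact hy j (Finset.mem_insert_of_mem hj)
      · by_cases hji : j = i
        · rw [hji, hzi]
        · rw [hzj j hji]
          exact hy' j (by simp [hji, hj])

theorem vol_convex_strip_le {n : ℕ} {T : Set (E n)} (hTo : IsOpen T) (hTc : Convex ℝ T)
    (hb : Bornology.IsBounded T)
    {c : Fin n → ℝ} {ℓ t : ℝ} (hℓ : 0 ≤ ℓ) (ht : 0 ≤ t)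
    (hbox : ∀ x ∈ T, ∀ j, c j ≤ x j ∧ x j ≤ c j + ℓ) {A : Set (E n)}
    (hA : ∀ x ∈ A, x ∈ T ∧ ∃ y, y ∉ T ∧ ∀ i, |x i - y i| ≤ t) :
    vol A ≤ n * (2 * t * ℓ ^ (n - 1)) := by
  obtain ⟨T', hT'T, -, -, hvol, hT'⟩ := exists_eroded hTo hTc hℓ ht hbox Finset.univ
  rw [Finset.card_univ, Fintype.card_fin] at hvol
  refine le_trans (ENNReal.toReal_mono (hb.subset sdiff_subset).measure_lt_top.ne
    (measure_mono fun x hx => ?_)) hvol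
  obtain ⟨hxT, y, hy, hxy⟩ := hA x hx
  exact ⟨hxT, fun hx' => hy (hT' x hx' y (fun i _ => hxy i) (by simp))⟩

theorem vol_innerStrip_convex_le {n : ℕ} {Ω : Set (E n)} (hΩ : IsBoundedLipschitzDomain Ω)
    (hc : Convex ℝ Ω) {t : ℝ} (ht : 0 ≤ t) :
    vol (innerStrip Ω t) ≤ n * (2 * t * Metric.diam Ω ^ (n - 1)) := by
  obtain ⟨c, hbox⟩ := exists_corner hΩ.nonempty hΩ.isBounded
  refine vol_convex_strip_le hΩ.isOpen hc hΩ.isBounded Metric.diam_nonneg ht hbox ?_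
  rintro x ⟨hx, y, hy, hxy⟩
  exact ⟨hx, y, hy, fun i => (hxy i).le⟩

open scoped Pointwise in
-- The shell lies in the convex set `Ω + C`, the enlargement of `Ω` by the open cube `C` of
-- half-side `s`, and within maximum-norm distance `2 * s` of its complement, so the one-sided strip
-- bound applies there.
theorem vol_boundaryShell_convex_le {n : ℕ} {Ω : Set (E n)} (hΩ : IsBoundedLipschitzDomain Ω)
    (hc : Convex ℝ Ω) {s : ℝ} (hs : 0 ≤ s) :
    vol (boundaryShell Ω s) ≤ n * (2 * (2 * s) * (Metric.diam Ω + 2 * s) ^ (n - 1)) := by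
  obtain ⟨c, hbox⟩ := exists_corner hΩ.nonempty hΩ.isBounded
  set C : Set (E n) := {u | ∀ i, |u i| < s} with hC
  have hCc : Convex ℝ C := by
    intro x hx y hy a b ha hb hab i
    have h1 := abs_lt.1 (hx i)
    have h2 := abs_lt.1 (hy i)
    simp only [PiLp.add_apply, PiLp.smul_apply, smul_eq_mul]
    have h3 : a = 1 - b := by linarith
    rcases hb.eq_or_lt with h0 | h0
    · subst h0; simp at hab; subst hab; simpa using hx i
    · rw [abs_lt]; subst h3; constructor <;> nlinarith
  have hbox' : ∀ x ∈ Ω + C, ∀ j, (fun j => c j - s) j ≤ x j ∧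
      x j ≤ (fun j => c j - s) j + (Metric.diam Ω + 2 * s) := by
    rintro _ ⟨x, hx, u, hu, rfl⟩ j
    have h1 := hbox x hx j
    have h2 := abs_lt.1 (hu j)
    simp only [PiLp.add_apply]
    constructor <;> linarith
  have hdiam : 0 ≤ Metric.diam Ω := Metric.diam_nonneg
  refine vol_convex_strip_le (hΩ.isOpen.add_right (t := C)) (hc.add hCc) (isBounded_of_box hbox')
    (by positivity) (by positivity) hbox' ?_
  rintro x ⟨⟨z, hz, hxz⟩, y, hy, hxy⟩
  refine ⟨⟨z, hz, x - z, fun i => by simpa using hxz i, by simp⟩, ?_⟩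
  obtain ⟨f, hf⟩ := geometric_hahn_banach_open_point hc hΩ.isOpen hy
  have hexp : ∀ u : E n, f u = ∑ i, u i * f (EuclideanSpace.single i 1) := by
    intro u
    conv_lhs => rw [← (EuclideanSpace.basisFun (Fin n) ℝ).sum_repr u]
    simp
  -- The vertex of the cube that maximizes the separating functional `f`; pushing `y` by `g` leaves
  -- `Ω + C`.
  set g : E n := WithLp.toLp 2 fun i => if 0 ≤ f (EuclideanSpace.single i 1) then s else -s with hg
  have hgi : ∀ i, |g i| = s := by
    intro i
    simp only [hg]
    split_ifs <;> simp [abs_of_nonneg hs]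
  refine ⟨y + g, ?_, fun i => ?_⟩
  · rintro ⟨w, hw, u, hu, hwu⟩
    have h1 : f w + f u = f y + f g := by rw [← map_add, ← map_add]; exact congrArg f hwu
    have h2 : f u ≤ f g := by
      rw [hexp u, hexp g]
      refine Finset.sum_le_sum fun i _ => ?_
      have h3 := abs_lt.1 (hu i)
      simp only [hg]
      split_ifs with h
      · exact mul_le_mul_of_nonneg_right h3.2.le h
      · exact mul_le_mul_of_nonpos_right h3.1.le (not_le.1 h).le
    linarith [hf w hw]
  · have h1 : x i - (y + g) i = (x i - y i) - g i := by simp; ring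
    rw [h1]
    refine (abs_sub _ _).trans ?_
    rw [hgi]
    linarith [hxy i]


/-! ### Volume near a Lipschitz boundary. -/

open Filter Topology in
/-- Neighbourhoods of a piece of a Lipschitz graph have volume linear in the radius. -/
theorem volume_near_graph_le {n : ℕ} {Ω : Set (E n)} (hΩ : IsBoundedLipschitzDomain Ω) (p : E n)
    (hp : p ∈ frontier Ω) : ∃ r > 0, ∃ C : NNReal, ∃ t₀ > 0, ∀ t : ℝ, 0 < t → t < t₀ →
      volume {x : E n | ∃ q ∈ frontier Ω ∩ Metric.ball p r, dist x q ≤ t} ≤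
        C * ENNReal.ofReal t := by
  obtain ⟨ν, hν, g, K, r, hg, hr, hgraph⟩ := hΩ.graph p hp
  set h : E n → ℝ := fun x => inner ℝ ν x - g (x - inner ℝ ν x • ν) with hh
  have hcont : Continuous h := by
    have := hg.continuous
    fun_prop
  have hiff : ∀ x ∈ Metric.ball p r, (x ∈ Ω ↔ h x < 0) := fun x hx => by
    rw [hgraph x hx, hh, sub_neg]
  have hfront : ∀ q ∈ frontier Ω ∩ Metric.ball p r, h q = 0 := by
    rintro q ⟨hq, hqb⟩
    rcases lt_trichotomy (h q) 0 with h0 | h0 | h0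
    · rw [frontier, hΩ.isOpen.interior_eq] at hq
      exact absurd ((hiff q hqb).2 h0) hq.2
    · exact h0
    · have hU : Metric.ball p r ∩ h ⁻¹' Ioi 0 ∈ 𝓝 q :=
        (Metric.isOpen_ball.inter (isOpen_Ioi.preimage hcont)).mem_nhds ⟨hqb, h0⟩
      obtain ⟨x, ⟨hx1, hx2⟩, hx3⟩ := mem_closure_iff_nhds.1 hq.1 _ hU
      have h1 := (hiff x hx1).1 hx3
      have h2 : 0 < h x := hx2
      linarith
  have hproj : ∀ x y : E n, ‖(x - inner ℝ ν x • ν) - (y - inner ℝ ν y • ν)‖ ≤ 2 * ‖x - y‖ := by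
    intro x y
    have e : (x - inner ℝ ν x • ν) - (y - inner ℝ ν y • ν) =
        (x - y) - inner ℝ ν (x - y) • ν := by rw [inner_sub_right, sub_smul]; abel
    rw [e]
    refine (norm_sub_le _ _).trans ?_
    rw [norm_smul, hν, mul_one]
    have := norm_inner_le_norm (𝕜 := ℝ) ν (x - y)
    rw [hν, one_mul] at this
    linarith
  have hLip : ∀ x y : E n, |h x - h y| ≤ (1 + 2 * K) * ‖x - y‖ := by
    intro x y
    have e : h x - h y = inner ℝ ν (x - y) -
        (g (x - inner ℝ ν x • ν) - g (y - inner ℝ ν y • ν)) := by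
      simp only [hh, inner_sub_right]; ring
    rw [e]
    refine (abs_sub _ _).trans ?_
    have h1 := norm_inner_le_norm (𝕜 := ℝ) ν (x - y)
    rw [hν, one_mul, Real.norm_eq_abs] at h1
    have h2 := hg.dist_le_mul (x - inner ℝ ν x • ν) (y - inner ℝ ν y • ν)
    rw [Real.dist_eq, dist_eq_norm] at h2
    have h3 : (K : ℝ) * ‖(x - inner ℝ ν x • ν) - (y - inner ℝ ν y • ν)‖ ≤ K * (2 * ‖x - y‖) := by
      gcongr; exact hproj x y
    linarith
  have hshift : ∀ (x : E n) (c : ℝ), h (x + c • ν) = h x + c := by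
    intro x c
    have h1 : inner ℝ ν (x + c • ν) = inner ℝ ν x + c := by
      rw [inner_add_right, inner_smul_right, real_inner_self_eq_norm_sq, hν]; ring
    have h2 : x + c • ν - (inner ℝ ν x + c) • ν = x - inner ℝ ν x • ν := by
      rw [add_smul]; abel
    simp only [hh, h1, h2]; ring
  set V := volume (Metric.ball p (r + 1)) with hV
  have hVfin : V ≠ ⊤ := measure_ball_lt_top.ne
  -- Since `h (x + c ν) = h x + c`, shifts of the layer `|h| ≤ τ` by multiples of `3 τ ν` are
  -- disjoint. About `1 / (3 τ)` of them fit in the ball enlarged by `1`.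
  have hG : ∀ τ : ℝ, 0 < τ → 3 * τ ≤ 1 →
      volume (Metric.ball p r ∩ {x | |h x| ≤ τ}) ≤ ENNReal.ofReal (6 * τ) * V := by
    intro τ hτ hτ1
    set G := Metric.ball p r ∩ {x | |h x| ≤ τ} with hGdef
    have hGm : MeasurableSet G :=
      measurableSet_ball.inter (measurableSet_le hcont.abs.measurable measurable_const)
    set m := ⌊1 / (3 * τ)⌋₊ with hm
    have hm1 : (m : ℝ) * (3 * τ) ≤ 1 := by
      rw [← le_div_iff₀ (by positivity)]
      exact Nat.floor_le (by positivity)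
    have hm2 : 1 ≤ 6 * τ * m := by
      have h1 := Nat.lt_floor_add_one (1 / (3 * τ))
      rw [← hm, div_lt_iff₀ (by positivity)] at h1
      have h2 : 1 ≤ m := by
        rw [hm, Nat.one_le_floor_iff, le_div_iff₀ (by positivity)]; linarith
      have h3 : (1 : ℝ) ≤ m := by exact_mod_cast h2
      nlinarith
    have hpre : ∀ k : ℕ, volume ((fun x => x + (-(k * (3 * τ))) • ν) ⁻¹' G) = volume G := fun k =>
      measure_preimage_add_right _ _ _
    have h1 : volume (⋃ k ∈ Finset.range m, (fun x => x + (-(k * (3 * τ))) • ν) ⁻¹' G) =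
        m * volume G := by
      rw [measure_biUnion_finset ?_ fun k _ => hGm.preimage (by fun_prop)]
      · rw [Finset.sum_congr rfl fun k _ => hpre k]; simp
      · intro k _ k' _ hne
        refine Set.disjoint_left.2 fun x hx hx' => hne ?_
        have h1 : |h (x + (-(k * (3 * τ))) • ν)| ≤ τ := hx.2
        have h2 : |h (x + (-(k' * (3 * τ))) • ν)| ≤ τ := hx'.2
        rw [hshift, abs_le] at h1 h2
        have h3 : (k : ℝ) < k' + 1 := by nlinarith
        have h4 : (k' : ℝ) < k + 1 := by nlinarith
        have h5 : k < k' + 1 := by exact_mod_cast h3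
        have h6 : k' < k + 1 := by exact_mod_cast h4
        omega
    have h2 : volume (⋃ k ∈ Finset.range m, (fun x => x + (-(k * (3 * τ))) • ν) ⁻¹' G) ≤ V := by
      refine measure_mono (iUnion₂_subset fun k hk x hx => ?_)
      have hx1 : dist (x + (-(k * (3 * τ))) • ν) p < r := hx.1
      have hkm : (k : ℝ) ≤ m := by exact_mod_cast (Finset.mem_range.1 hk).le
      have hx2 : dist x (x + (-(k * (3 * τ))) • ν) ≤ 1 := by
        rw [dist_eq_norm, sub_add_cancel_left, norm_neg, norm_smul, hν, mul_one, norm_neg,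
          Real.norm_eq_abs, abs_of_nonneg (by positivity)]
        refine le_trans ?_ hm1
        gcongr
      rw [Metric.mem_ball]
      linarith [dist_triangle x (x + (-(k * (3 * τ))) • ν) p]
    rw [h1] at h2
    calc volume G = 1 * volume G := (one_mul _).symm
      _ ≤ (ENNReal.ofReal (6 * τ) * m) * volume G := by
          gcongr
          rw [← ENNReal.ofReal_natCast, ← ENNReal.ofReal_mul (by positivity),
            ENNReal.one_le_ofReal]
          exact hm2
      _ = ENNReal.ofReal (6 * τ) * (m * volume G) := by ring
      _ ≤ _ := by gcongr
  have hK0 : (0 : ℝ) ≤ K := K.2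
  -- Halving the radius keeps the `t`-neighbourhood inside the ball where the graph description is
  -- valid.
  refine ⟨r / 2, by positivity, (6 * (1 + 2 * K)) * V.toNNReal,
    min (r / 2) (1 / (3 * (1 + 2 * K))), by positivity, fun t ht htlt => ?_⟩
  have ht1 := htlt.trans_le (min_le_left _ _)
  have ht2 := htlt.trans_le (min_le_right _ _)
  rw [lt_div_iff₀ (by positivity)] at ht2
  have hsub : {x : E n | ∃ q ∈ frontier Ω ∩ Metric.ball p (r / 2), dist x q ≤ t} ⊆
      Metric.ball p r ∩ {x | |h x| ≤ (1 + 2 * K) * t} := by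
    rintro x ⟨q, ⟨hq, hqb⟩, hxq⟩
    rw [Metric.mem_ball] at hqb
    refine ⟨?_, ?_⟩
    · rw [Metric.mem_ball]; linarith [dist_triangle x q p]
    · have h1 := hLip x q
      rw [hfront q ⟨hq, by rw [Metric.mem_ball]; linarith⟩, sub_zero, ← dist_eq_norm] at h1
      exact h1.trans (by gcongr)
  refine (measure_mono hsub).trans ((hG _ (by positivity) (by linarith)).trans (le_of_eq ?_))
  rw [ENNReal.coe_mul, ENNReal.coe_toNNReal hVfin, mul_right_comm, ← mul_assoc,
    ENNReal.ofReal_mul (by positivity), ENNReal.ofReal_mul (by positivity)]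
  congr 2
  rw [ENNReal.coe_mul]
  congr 1
  · simp
  · rw [ENNReal.ofReal_eq_coe_nnreal (by positivity)]
    congr 1

theorem volume_near_frontier_le {n : ℕ} {Ω : Set (E n)} (hΩ : IsBoundedLipschitzDomain Ω) :
    ∃ C : NNReal, ∃ t₀ > 0, ∀ t : ℝ, 0 < t → t < t₀ →
      volume {x : E n | ∃ q ∈ frontier Ω, dist x q ≤ t} ≤ C * ENNReal.ofReal t := by
  have hcomp : IsCompact (frontier Ω) :=
    Metric.isCompact_of_isClosed_isBounded isClosed_frontier
      (hΩ.isBounded.closure.subset frontier_subset_closure)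
  refine hcomp.induction_on (p := fun S : Set (E n) => ∃ C : NNReal, ∃ t₀ > 0, ∀ t : ℝ, 0 < t →
    t < t₀ → volume {x : E n | ∃ q ∈ S, dist x q ≤ t} ≤ C * ENNReal.ofReal t) ?_ ?_ ?_ ?_
  · exact ⟨0, 1, one_pos, by simp⟩
  · rintro S S' hSS' ⟨C, t₀, ht₀, h⟩
    refine ⟨C, t₀, ht₀, fun t ht ht' => (measure_mono ?_).trans (h t ht ht')⟩
    rintro x ⟨q, hq, hx⟩
    exact ⟨q, hSS' hq, hx⟩
  · rintro S S' ⟨C, t₀, ht₀, h⟩ ⟨C', t₀', ht₀', h'⟩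
    refine ⟨C + C', min t₀ t₀', lt_min ht₀ ht₀', fun t ht ht' => ?_⟩
    have hsub : {x : E n | ∃ q ∈ S ∪ S', dist x q ≤ t} ⊆
        {x | ∃ q ∈ S, dist x q ≤ t} ∪ {x | ∃ q ∈ S', dist x q ≤ t} := by
      rintro x ⟨q, hq | hq, hx⟩
      · exact Or.inl ⟨q, hq, hx⟩
      · exact Or.inr ⟨q, hq, hx⟩
    refine (measure_mono hsub).trans ((measure_union_le _ _).trans ?_)
    rw [ENNReal.coe_add, add_mul]
    exact add_le_add (h t ht (ht'.trans_le (min_le_left _ _)))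
      (h' t ht (ht'.trans_le (min_le_right _ _)))
  · intro p hp
    obtain ⟨r, hr, H⟩ := volume_near_graph_le hΩ p hp
    exact ⟨frontier Ω ∩ Metric.ball p r,
      inter_mem_nhdsWithin _ (Metric.ball_mem_nhds p hr), H⟩

/-! ### The surface area of a Lipschitz domain is finite and positive -/

theorem ediam_gridBox_le {n : ℕ} {s : ℝ} (hs : 0 ≤ s) (k : Fin n → ℤ) :
    Metric.ediam (gridBox s k : Set (E n)) ≤ ENNReal.ofReal (Real.sqrt n * s) := by
  refine Metric.ediam_le fun x hx y hy => ?_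
  rw [edist_dist]
  refine ENNReal.ofReal_le_ofReal ?_
  rw [EuclideanSpace.dist_eq]
  refine Real.sqrt_le_iff.2 ⟨by positivity, ?_⟩
  rw [mul_pow, Real.sq_sqrt (Nat.cast_nonneg n)]
  refine (Finset.sum_le_sum (g := fun _ => s ^ 2) fun i _ => ?_).trans (by simp)
  rw [Real.dist_eq]
  exact pow_le_pow_left₀ (abs_nonneg _) (abs_sub_lt_of_mem_box hx hy i).le 2

open Filter Topology in
-- Grid cubes of side `δ` that meet the boundary lie in its `√n δ`-neighbourhood, of volume at most
-- `C √n δ`. So there are at most `C √n δ ^ (1 - n)` of them, and they form an efficient cover.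
-- Without finiteness, `surfaceArea` would be the default value `0`.
theorem hausdorffMeasure_frontier_lt_top {n : ℕ} (hn : 1 ≤ n) {Ω : Set (E n)}
    (hΩ : IsBoundedLipschitzDomain Ω) :
    Measure.hausdorffMeasure ((n - 1 : ℕ) : ℝ) (frontier Ω) < ⊤ := by
  obtain ⟨C, t₀, ht₀, hC⟩ := volume_near_frontier_le hΩ
  have hb : Bornology.IsBounded (frontier Ω) :=
    hΩ.isBounded.closure.subset frontier_subset_closure
  have hs : 0 < Real.sqrt n := Real.sqrt_pos.2 (by exact_mod_cast hn)
  let δ : ℕ → ℝ := fun m => 1 / ((m : ℝ) + 1)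
  have hδ : ∀ m, 0 < δ m := fun m => by positivity
  have hδ0 : Tendsto δ atTop (𝓝 0) := tendsto_one_div_add_atTop_nhds_zero_nat
  have hsδ0 : Tendsto (fun m => Real.sqrt n * δ m) atTop (𝓝 0) := by
    simpa using hδ0.const_mul (Real.sqrt n)
  let I : ℕ → Finset (Fin n → ℤ) := fun m => (finite_gridBox_inter hb (hδ m)).toFinset
  have hbound := Measure.hausdorffMeasure_le_liminf_sum ((n - 1 : ℕ) : ℝ) (frontier Ω) (l := atTop)
    (fun m => ENNReal.ofReal (Real.sqrt n * δ m))
    (by simpa using ENNReal.tendsto_ofReal hsδ0)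
    (ι := fun m => I m) (fun m k => (gridBox (δ m) k.1 : Set (E n)))
    (Eventually.of_forall fun m k => ediam_gridBox_le (hδ m).le k.1)
    (Eventually.of_forall fun m x hx => by
      rw [mem_iUnion]
      exact ⟨⟨fun i => ⌊x i / δ m⌋, (Set.Finite.mem_toFinset _).2
        ⟨x, mem_gridBox_floor (hδ m) x, hx⟩⟩, mem_gridBox_floor (hδ m) x⟩)
  refine hbound.trans_lt ?_
  refine lt_of_le_of_lt (b := ENNReal.ofReal (C * Real.sqrt n * Real.sqrt n ^ (n - 1))) ?_
    ENNReal.ofReal_lt_top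
  refine liminf_le_of_frequently_le' (Eventually.frequently ?_)
  filter_upwards [hsδ0.eventually (gt_mem_nhds ht₀)] with m hm
  have hpos : 0 < Real.sqrt n * δ m := mul_pos hs (hδ m)
  have hfin : volume {x : E n | ∃ q ∈ frontier Ω, dist x q ≤ Real.sqrt n * δ m} ≠ ⊤ :=
    ((hC _ hpos hm).trans_lt (ENNReal.mul_lt_top ENNReal.coe_lt_top ENNReal.ofReal_lt_top)).ne
  have hcard := card_mul_le_vol (I m) (hδ m) id (injOn_id _) hfin (by
    intro k hk x hx
    obtain ⟨y, hy, hyf⟩ := (Set.Finite.mem_toFinset _).1 hk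
    refine ⟨y, hyf, ?_⟩
    have h1 : edist x y ≤ ENNReal.ofReal (Real.sqrt n * δ m) :=
      (Metric.edist_le_ediam_of_mem hx hy).trans (ediam_gridBox_le (hδ m).le k)
    rwa [edist_dist, ENNReal.ofReal_le_ofReal_iff hpos.le] at h1)
  have hvol : vol {x : E n | ∃ q ∈ frontier Ω, dist x q ≤ Real.sqrt n * δ m} ≤
      C * (Real.sqrt n * δ m) := by
    have h1 := ENNReal.toReal_mono
      (ENNReal.mul_lt_top ENNReal.coe_lt_top ENNReal.ofReal_lt_top).ne (hC _ hpos hm)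
    rwa [ENNReal.toReal_mul, ENNReal.toReal_ofReal hpos.le, ENNReal.coe_toReal] at h1
  have hcard2 : ((I m).card : ℝ) * δ m ^ (n - 1) ≤ C * Real.sqrt n := by
    have h1 := hcard.trans hvol
    have h2 : δ m ^ n = δ m ^ (n - 1) * δ m := by rw [← pow_succ, Nat.sub_add_cancel hn]
    rw [h2] at h1
    refine le_of_mul_le_mul_right (?_ : _ * δ m ≤ _ * δ m) (hδ m)
    linarith
  calc ∑ k : I m, Metric.ediam (gridBox (δ m) k.1 : Set (E n)) ^ ((n - 1 : ℕ) : ℝ)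
      ≤ ∑ _k : I m, ENNReal.ofReal (Real.sqrt n * δ m) ^ ((n - 1 : ℕ) : ℝ) := by
        refine Finset.sum_le_sum fun k _ => ?_
        gcongr
        exact ediam_gridBox_le (hδ m).le k.1
    _ = ENNReal.ofReal ((I m).card * (Real.sqrt n * δ m) ^ (n - 1)) := by
        rw [Finset.sum_const, Finset.card_univ, Fintype.card_coe, nsmul_eq_mul,
          ENNReal.rpow_natCast, ENNReal.ofReal_mul (Nat.cast_nonneg _), ENNReal.ofReal_natCast,
          ENNReal.ofReal_pow hpos.le]
    _ ≤ _ := by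
        refine ENNReal.ofReal_le_ofReal ?_
        rw [mul_pow]
        calc ((I m).card : ℝ) * (Real.sqrt n ^ (n - 1) * δ m ^ (n - 1))
            = ((I m).card * δ m ^ (n - 1)) * Real.sqrt n ^ (n - 1) := by ring
          _ ≤ _ := by gcongr

open Filter Topology in
-- Every line in direction `0` through the bounded set `Ω` meets the boundary, so the boundary
-- projects onto at least the shadow of `Ω`, which contains a ball. The projection is `1`-Lipschitz
-- and does not increase Hausdorff measure.
theorem hausdorffMeasure_frontier_pos {n : ℕ} {Ω : Set (E (n + 1))} (hne : Ω.Nonempty)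
    (ho : IsOpen Ω) (hb : Bornology.IsBounded Ω) :
    0 < (Measure.euclideanHausdorffMeasure n (frontier Ω) : ENNReal) := by
  let π : E (n + 1) → E n := fun x => WithLp.toLp 2 fun i => x i.succ
  have hLip : LipschitzWith 1 π := by
    refine LipschitzWith.of_dist_le_mul fun x y => ?_
    rw [NNReal.coe_one, one_mul, EuclideanSpace.dist_eq, EuclideanSpace.dist_eq]
    refine Real.sqrt_le_sqrt ?_
    rw [Fin.sum_univ_succ (fun i => dist (x i) (y i) ^ 2)]
    have := sq_nonneg (dist (x 0) (y 0))
    simp only [π]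
    linarith
  have hproj : π '' Ω ⊆ π '' frontier Ω := by
    rintro _ ⟨x, hx, rfl⟩
    set f : ℝ → E (n + 1) := fun c => x + c • EuclideanSpace.single 0 1 with hf
    have hfc : Continuous f := by fun_prop
    have hfr : (frontier (f ⁻¹' Ω)).Nonempty := by
      rw [nonempty_frontier_iff]
      refine ⟨⟨0, by simpa [hf] using hx⟩, fun h => ?_⟩
      obtain ⟨r, hr⟩ := hb.subset_closedBall x
      have h1 : (|r| + 1) ∈ f ⁻¹' Ω := by rw [h]; trivial
      have h2 := hr h1
      rw [Metric.mem_closedBall, hf, dist_eq_norm, add_sub_cancel_left, norm_smul] at h2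
      simp only [PiLp.norm_single, norm_one, mul_one, Real.norm_eq_abs] at h2
      rw [abs_of_nonneg (by positivity)] at h2
      linarith [le_abs_self r]
    obtain ⟨c, hc⟩ := hfr
    refine ⟨f c, hfc.frontier_preimage_subset Ω hc, ?_⟩
    ext i
    simp [π, hf]
  have hopen : ∃ y : E n, ∃ r > 0, Metric.ball y r ⊆ π '' Ω := by
    obtain ⟨x, hx⟩ := hne
    obtain ⟨r, hr, hball⟩ := Metric.isOpen_iff.1 ho x hx
    refine ⟨π x, r, hr, fun y hy => ?_⟩
    refine ⟨WithLp.toLp 2 (Fin.cons (x 0) y), hball ?_, ?_⟩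
    · rw [Metric.mem_ball, EuclideanSpace.dist_eq] at hy ⊢
      rw [Fin.sum_univ_succ]
      simpa [π] using hy
    · ext i; simp [π]
  obtain ⟨y, r, hr, hball⟩ := hopen
  have h1 : 0 < (Measure.euclideanHausdorffMeasure n (π '' frontier Ω) : ENNReal) := by
    rw [EuclideanSpace.euclideanHausdorffMeasure_eq_volume]
    exact (Metric.measure_ball_pos volume y hr).trans_le (measure_mono (hball.trans hproj))
  refine h1.trans_le ?_
  rw [Measure.euclideanHausdorffMeasure_def, Measure.euclideanHausdorffMeasure_def,
    Measure.smul_apply, Measure.smul_apply]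
  have h2 := hLip.hausdorffMeasure_image_le (Nat.cast_nonneg n) (frontier Ω)
  rw [ENNReal.coe_one, ENNReal.one_rpow, one_mul] at h2
  gcongr

theorem surfaceArea_pos {n : ℕ} (hn : 1 ≤ n) {Ω : Set (E n)} (hΩ : IsBoundedLipschitzDomain Ω) :
    0 < surfaceArea Ω := by
  refine ENNReal.toReal_pos ?_ ?_
  · obtain ⟨k, rfl⟩ : ∃ k, n = k + 1 := ⟨n - 1, by omega⟩
    exact (hausdorffMeasure_frontier_pos hΩ.nonempty hΩ.isOpen hΩ.isBounded).ne'
  · rw [Measure.euclideanHausdorffMeasure_def, Measure.smul_apply, ENNReal.smul_def, smul_eq_mul]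
    exact (ENNReal.mul_lt_top ENNReal.coe_lt_top (hausdorffMeasure_frontier_lt_top hn hΩ)).ne

/-! ### The constant `lipConst` -/

theorem frontier_nonempty {n : ℕ} (hn : 1 ≤ n) {Ω : Set (E n)}
    (hΩ : IsBoundedLipschitzDomain Ω) : (frontier Ω).Nonempty := by
  rw [Set.nonempty_iff_ne_empty]
  intro h
  have := surfaceArea_pos hn hΩ
  rw [surfaceArea, h] at this
  simp at this

/-- Needed because `sInf ∅ = 0`. Small `t` are covered by the linear bound near the boundary, and `t
≥ t₀` by the volume of one large ball. -/
theorem lipConst_set_nonempty {n : ℕ} (hn : 1 ≤ n) {Ω : Set (E n)}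
    (hΩ : IsBoundedLipschitzDomain Ω) : {C : ℝ | 1 ≤ C ∧ ∀ t : ℝ, 0 < t → t < width Ω →
    vol {x : E n | Metric.infDist x (frontier Ω) ≤ t} ≤ C * t * surfaceArea Ω}.Nonempty := by
  obtain ⟨C, t₀, ht₀, hC⟩ := volume_near_frontier_le hΩ
  have hS := surfaceArea_pos hn hΩ
  have hne := frontier_nonempty hn hΩ
  have hset : ∀ t : ℝ, {x : E n | Metric.infDist x (frontier Ω) ≤ t} ⊆
      {x | ∃ q ∈ frontier Ω, dist x q ≤ t} := by
    intro t x hx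
    obtain ⟨q, hq, h⟩ := isClosed_frontier.exists_infDist_eq_dist hne x
    exact ⟨q, hq, h ▸ hx⟩
  have hb : Bornology.IsBounded (frontier Ω) :=
    hΩ.isBounded.closure.subset frontier_subset_closure
  obtain ⟨r, hr⟩ := hb.subset_closedBall 0
  set V := vol (Metric.closedBall (0 : E n) (r + width Ω)) with hV
  have hV0 : 0 ≤ V := ENNReal.toReal_nonneg
  set D := (C + V / t₀) / surfaceArea Ω with hD
  have hD0 : 0 ≤ D := by positivity
  refine ⟨1 + D, by linarith, fun t ht htw => ?_⟩
  have hmain : vol {x : E n | Metric.infDist x (frontier Ω) ≤ t} ≤ (C + V / t₀) * t := by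
    rcases lt_or_ge t t₀ with h | h
    · have h1 := ENNReal.toReal_mono
        (ENNReal.mul_lt_top ENNReal.coe_lt_top ENNReal.ofReal_lt_top).ne
        ((measure_mono (hset t)).trans (hC t ht h))
      rw [ENNReal.toReal_mul, ENNReal.toReal_ofReal ht.le, ENNReal.coe_toReal] at h1
      refine h1.trans ?_
      gcongr
      have : 0 ≤ V / t₀ := by positivity
      linarith
    · have h1 : vol {x : E n | Metric.infDist x (frontier Ω) ≤ t} ≤ V := by
        refine ENNReal.toReal_mono measure_closedBall_lt_top.ne (measure_mono fun x hx => ?_)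
        obtain ⟨q, hq, hxq⟩ := hset t hx
        have h2 := hr hq
        rw [Metric.mem_closedBall] at h2 ⊢
        linarith [dist_triangle x q 0]
      calc _ ≤ V := h1
        _ = V / t₀ * t₀ := by field_simp
        _ ≤ V / t₀ * t := by gcongr
        _ ≤ (C + V / t₀) * t := by gcongr; linarith [C.2]
  calc _ ≤ (C + V / t₀) * t := hmain
    _ = D * t * surfaceArea Ω := by rw [hD]; field_simp
    _ ≤ _ := by gcongr; linarith

theorem one_le_lipConst {n : ℕ} (hn : 1 ≤ n) {Ω : Set (E n)} (hΩ : IsBoundedLipschitzDomain Ω) :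
    1 ≤ lipConst Ω := le_csInf (lipConst_set_nonempty hn hΩ) fun _ hC => hC.1

/-- The infimum defining `lipConst` is itself admissible, since for each `t` the condition on the
constant is closed. -/
theorem vol_near_frontier_le_lipConst {n : ℕ} (hn : 1 ≤ n) {Ω : Set (E n)}
    (hΩ : IsBoundedLipschitzDomain Ω) {t : ℝ} (ht : 0 < t) (htw : t < width Ω) :
    vol {x : E n | Metric.infDist x (frontier Ω) ≤ t} ≤ lipConst Ω * t * surfaceArea Ω := by
  have hS := surfaceArea_pos hn hΩ
  have : vol {x : E n | Metric.infDist x (frontier Ω) ≤ t} / (t * surfaceArea Ω) ≤ lipConst Ω := by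
    refine le_csInf (lipConst_set_nonempty hn hΩ) fun C hC => ?_
    rw [div_le_iff₀ (by positivity), ← mul_assoc]
    exact hC.2 t ht htw
  rwa [div_le_iff₀ (by positivity), ← mul_assoc] at this


/-! ### Boundary strips of Lipschitz domains -/

theorem infDist_frontier_le {n : ℕ} {A : Set (E n)} {x y : E n} (hx : x ∈ A) (hy : y ∉ A) :
    Metric.infDist x (frontier A) ≤ dist x y := by
  obtain ⟨q, hq, h⟩ := exists_mem_frontier_infDist_compl_eq_dist hx
    (fun h => hy (h ▸ Set.mem_univ y))
  calc Metric.infDist x (frontier A) ≤ dist x q := Metric.infDist_le_dist_of_mem hq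
    _ = Metric.infDist x Aᶜ := h.symm
    _ ≤ dist x y := Metric.infDist_le_dist_of_mem hy

theorem dist_le_sqrt_mul {n : ℕ} {x y : E n} {t : ℝ} (ht : 0 ≤ t) (h : ∀ i, |x i - y i| < t) :
    dist x y ≤ Real.sqrt n * t := by
  rw [EuclideanSpace.dist_eq]
  refine Real.sqrt_le_iff.2 ⟨by positivity, ?_⟩
  rw [mul_pow, Real.sq_sqrt (Nat.cast_nonneg n)]
  refine (Finset.sum_le_sum (g := fun _ => t ^ 2) fun i _ => ?_).trans (by simp)
  rw [Real.dist_eq]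
  exact pow_le_pow_left₀ (abs_nonneg _) (h i).le 2

theorem innerStrip_subset {n : ℕ} {Ω : Set (E n)} {t : ℝ} (ht : 0 ≤ t) :
    innerStrip Ω t ⊆ {x | Metric.infDist x (frontier Ω) ≤ Real.sqrt n * t} := by
  rintro x ⟨hx, y, hy, hxy⟩
  exact (infDist_frontier_le hx hy).trans (dist_le_sqrt_mul ht hxy)

theorem boundaryShell_subset {n : ℕ} {Ω : Set (E n)} {t : ℝ} (ht : 0 ≤ t) :
    boundaryShell Ω t ⊆ {x | Metric.infDist x (frontier Ω) ≤ Real.sqrt n * t} := by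
  rintro x ⟨⟨z, hz, hxz⟩, y, hy, hxy⟩
  by_cases hx : x ∈ Ω
  · exact (infDist_frontier_le hx hy).trans (dist_le_sqrt_mul ht hxy)
  · have h1 := infDist_frontier_le (A := Ωᶜ) (x := x) (y := z) hx (fun h => h hz)
    rw [frontier_compl] at h1
    exact h1.trans (dist_le_sqrt_mul ht hxz)

theorem volume_near_frontier_ne_top {n : ℕ} (hn : 1 ≤ n) {Ω : Set (E n)}
    (hΩ : IsBoundedLipschitzDomain Ω) (t : ℝ) :
    volume {x : E n | Metric.infDist x (frontier Ω) ≤ t} ≠ ⊤ := by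
  have hb : Bornology.IsBounded (frontier Ω) :=
    hΩ.isBounded.closure.subset frontier_subset_closure
  obtain ⟨r, hr⟩ := hb.subset_closedBall 0
  refine (lt_of_le_of_lt (measure_mono (t := Metric.closedBall (0 : E n) (r + t)) fun x hx => ?_)
    measure_closedBall_lt_top).ne
  obtain ⟨q, hq, hxq⟩ := isClosed_frontier.exists_infDist_eq_dist (frontier_nonempty hn hΩ) x
  have h1 : Metric.infDist x (frontier Ω) ≤ t := hx
  have h2 := hr hq
  rw [Metric.mem_closedBall] at h2 ⊢
  linarith [dist_triangle x q 0]

theorem vol_le_of_subset_near_frontier {n : ℕ} (hn : 1 ≤ n) {Ω : Set (E n)}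
    (hΩ : IsBoundedLipschitzDomain Ω) {t : ℝ} (ht : 0 < t) (htw : t < width Ω) {A : Set (E n)}
    (hA : A ⊆ {x | Metric.infDist x (frontier Ω) ≤ t}) :
    vol A ≤ lipConst Ω * t * surfaceArea Ω :=
  (ENNReal.toReal_mono (volume_near_frontier_ne_top hn hΩ t) (measure_mono hA)).trans
    (vol_near_frontier_le_lipConst hn hΩ ht htw)

/-! ### The choice of the dyadic scales -/

/-- The top side `w / (2 √n)` keeps every strip within Euclidean distance `w / 2`, inside the range
of `lipConst`. The integer `J` brings the frequency radius of the smallest cubes into `[2 n √n, 4 n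
√n]`. -/
theorem exists_dyadic_scale {n : ℕ} (hn : 2 ≤ n) {w R : ℝ} (hw : 0 < w) (hR : 0 < R)
    (hwR : 4 * Real.pi * n ^ 2 ≤ w * R) : ∃ (J : ℕ) (s : ℝ), 0 < s ∧
      2 ^ J * s = w / (2 * Real.sqrt n) ∧ 2 * (n * Real.sqrt n) ≤ s * R / Real.pi ∧
      s * R / Real.pi ≤ 4 * (n * Real.sqrt n) ∧ J + 7 ≤ Real.logb 2 (10 * w * R / Real.pi) := by
  have hπ := Real.pi_pos
  have hn' : (2 : ℝ) ≤ n := by exact_mod_cast hn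
  have hs : 0 < Real.sqrt n := Real.sqrt_pos.2 (by linarith)
  set x := w * R / (4 * Real.pi * n ^ 2) with hx
  have hx1 : 1 ≤ x := by rw [hx, le_div_iff₀ (by positivity)]; linarith
  obtain ⟨J, hJ1, hJ2⟩ := exists_nat_pow_near hx1 (by norm_num : (1 : ℝ) < 2)
  have hJ0 : (0 : ℝ) < 2 ^ J := by positivity
  have hρ : w / (2 * Real.sqrt n) / 2 ^ J * R / Real.pi = 2 * (n * Real.sqrt n) * (x / 2 ^ J) := by
    rw [hx]
    field_simp
    have : Real.sqrt n ^ 2 = n := Real.sq_sqrt (by linarith)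
    rw [this]; ring
  refine ⟨J, w / (2 * Real.sqrt n) / 2 ^ J, by positivity, by field_simp, ?_, ?_, ?_⟩
  · rw [hρ]
    refine le_mul_of_one_le_right (by positivity) ?_
    rwa [one_le_div hJ0]
  · rw [hρ]
    have : x / 2 ^ J ≤ 2 := by rw [div_le_iff₀ hJ0]; rw [pow_succ] at hJ2; linarith
    calc 2 * (n * Real.sqrt n) * (x / 2 ^ J) ≤ 2 * (n * Real.sqrt n) * 2 := by gcongr
      _ = _ := by ring
  · rw [Real.le_logb_iff_rpow_le (by norm_num) (by positivity)]
    have e : ((2 : ℝ) ^ ((J : ℝ) + 7)) = 2 ^ J * 128 := by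
      rw [Real.rpow_add (by norm_num), Real.rpow_natCast]
      norm_num
    have e2 : 10 * w * R / Real.pi = x * (40 * n ^ 2) := by
      rw [hx]; field_simp; ring
    rw [e, e2]
    gcongr
    nlinarith

theorem logb_ten_div_pi : (1.6 : ℝ) ≤ Real.logb 2 (10 / Real.pi) := by
  have hπ := Real.pi_pos
  rw [Real.le_logb_iff_rpow_le (by norm_num) (by positivity)]
  have h1 : (3.17 : ℝ) ≤ 10 / Real.pi := by
    rw [le_div_iff₀ hπ]; nlinarith [Real.pi_lt_d2]
  refine le_trans ?_ h1
  refine (pow_le_pow_iff_left₀ (by positivity) (by norm_num) (by norm_num : (5 : ℕ) ≠ 0)).1 ?_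
  rw [← Real.rpow_natCast, ← Real.rpow_mul (by norm_num)]
  norm_num

/-- The left-hand side of the equations for the thresholds. -/
def thresholdFun {n : ℕ} (Ω : Set (E n)) (P Λ : ℝ) : ℝ :=
  P / (vol Ω * Real.sqrt Λ) * logFactor Ω Λ

theorem logb_scaled_ge {w R : ℝ} (h : 1 ≤ w * R) :
    (1.6 : ℝ) ≤ Real.logb 2 (10 * w * R / Real.pi) := by
  have hπ := Real.pi_pos
  refine logb_ten_div_pi.trans ?_
  refine Real.logb_le_logb_of_le (by norm_num) (by positivity) ?_
  gcongr
  linarith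

/-- Consequences of the threshold inequality at frequency `R`. -/
theorem thresholdFun_le_imp {n : ℕ} (hn : 2 ≤ n) {Ω : Set (E n)} (hΩ : IsBoundedLipschitzDomain Ω)
    {P ε R : ℝ} (hR : 0 < R) (hwR : 1 ≤ width Ω * R) (hε1 : ε < 1)
    (hP : 2 * (n : ℝ) * Metric.diam Ω ^ (n - 1) ≤ P) (h : thresholdFun Ω P (R ^ 2) ≤ ε) :
    16 * Real.pi * n ^ 2 * Real.sqrt n ≤ width Ω * R ∧
      P * (5 * n ^ 2 * Real.logb 2 (10 * width Ω * R / Real.pi)) ≤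
        ε * (vol Ω * (R / Real.pi)) := by
  have hπ := Real.pi_pos
  have hn' : (2 : ℝ) ≤ n := by exact_mod_cast hn
  have hs : 0 < Real.sqrt n := Real.sqrt_pos.2 (by linarith)
  have hV := vol_pos hΩ
  have hd := diam_pos (by omega) hΩ
  have hP0 : 0 < P := lt_of_lt_of_le (by positivity) hP
  have hL := logb_scaled_ge hwR
  rw [thresholdFun, logFactor, Real.sqrt_sq hR.le, div_mul_eq_mul_div,
    div_le_iff₀ (by positivity)] at h
  set ℓ := Real.logb 2 (10 * width Ω * R / Real.pi) with hℓ
  have h2 : P * (5 * n ^ 2 * ℓ) * Real.pi ≤ ε * (vol Ω * R) := by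
    have : P * (Real.pi / 2 + 5 * n ^ 2 * Real.pi * ℓ) =
      P * (5 * n ^ 2 * ℓ) * Real.pi + P * (Real.pi / 2) := by ring
    rw [this] at h
    have : 0 ≤ P * (Real.pi / 2) := by positivity
    linarith
  constructor
  · have h3 : P * (5 * n ^ 2 * ℓ) * Real.pi ≤ vol Ω * R := h2.trans
      (mul_le_of_le_one_left (by positivity) hε1.le)
    have h4 := vol_le_width (by omega) hΩ
    have hD : 0 < Metric.diam Ω ^ (n - 1) := by positivity
    -- As `ε < 1` and the logarithm is at least `1.6`, the threshold inequality forces a high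
    -- frequency; `2 * 5 * 1.6 = 16` is the constant obtained.
    have h5 : (2 * n * Metric.diam Ω ^ (n - 1)) * (5 * n ^ 2 * 1.6) * Real.pi ≤
        (Real.sqrt n * width Ω * Metric.diam Ω ^ (n - 1)) * R := by
      calc (2 * n * Metric.diam Ω ^ (n - 1)) * (5 * n ^ 2 * 1.6) * Real.pi
          ≤ P * (5 * n ^ 2 * ℓ) * Real.pi := by gcongr
        _ ≤ vol Ω * R := h3
        _ ≤ _ := by gcongr
    have hss : Real.sqrt n * Real.sqrt n = n := Real.mul_self_sqrt (by linarith)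
    have h6 : (16 * Real.pi * n ^ 2 * Real.sqrt n) * (Real.sqrt n * Metric.diam Ω ^ (n - 1)) ≤
        (width Ω * R) * (Real.sqrt n * Metric.diam Ω ^ (n - 1)) := by
      calc (16 * Real.pi * n ^ 2 * Real.sqrt n) * (Real.sqrt n * Metric.diam Ω ^ (n - 1))
          = 16 * Real.pi * n ^ 2 * Metric.diam Ω ^ (n - 1) * (Real.sqrt n * Real.sqrt n) := by ring
        _ = (2 * n * Metric.diam Ω ^ (n - 1)) * (5 * n ^ 2 * 1.6) * Real.pi := by
            rw [hss]; ring
        _ ≤ _ := h5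
        _ = _ := by ring
    exact le_of_mul_le_mul_right h6 (by positivity)
  · rw [mul_div_assoc', mul_div_assoc', le_div_iff₀ hπ]
    exact h2

/-! ### Absorbing the boundary terms into the `ε`-loss. -/

theorem weyl_term_eq {n : ℕ} (hn : 1 ≤ n) {Ω : Set (E n)} {R : ℝ} :
    unitBallVol n / 2 ^ n * (R / Real.pi) ^ (n - 1) * (vol Ω * (R / Real.pi)) =
      vol Ω * unitBallVol n / (2 * Real.pi) ^ n * R ^ n := by
  have hπ := Real.pi_pos
  have : (R / Real.pi) ^ n = (R / Real.pi) ^ (n - 1) * (R / Real.pi) := by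
    rw [← pow_succ, Nat.sub_add_cancel hn]
  have h2 : unitBallVol n / 2 ^ n * (R / Real.pi) ^ (n - 1) * (vol Ω * (R / Real.pi)) =
      unitBallVol n / 2 ^ n * vol Ω * (R / Real.pi) ^ n := by rw [this]; ring
  rw [h2, div_pow, mul_pow]
  field_simp

/-- The counting bound once the boundary terms are absorbed by the `ε`-loss. -/
theorem eigenvalueCount_le_of_absorbed {n : ℕ} (hn : 1 ≤ n) {Ω : Set (E n)}
    (hΩ : IsBoundedLipschitzDomain Ω) {s : ℝ} (hs : 0 < s) (J : ℕ) {t R X Y ε : ℝ} (hR : 0 < R)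
    (htR : t < R ^ 2) (hρ1 : 2 * (n * Real.sqrt n) ≤ s * R / Real.pi)
    (hρ2 : s * R / Real.pi ≤ 4 * (n * Real.sqrt n))
    (hX : ∀ j < J, vol (innerStrip Ω (2 * (2 ^ j * s))) ≤ X * (2 ^ j * s))
    (hY : vol (boundaryShell Ω s) ≤ Y * s)
    (habs : 2 * (n * Real.sqrt n) * (J * X + vol Ω / (2 ^ J * s)) + 8 * (n * Real.sqrt n) * Y ≤
      ε * (vol Ω * (R / Real.pi))) :
    ∃ N : ℕ, eigenvalueCount Ω t ≤ (N : Cardinal) ∧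
      (N : ℝ) ≤ (1 + ε) * (vol Ω * unitBallVol n / (2 * Real.pi) ^ n) * R ^ n := by
  have hfin : volume (boundaryShell Ω s) ≠ ⊤ :=
    ((measure_mono (boundaryShell_subset hs.le)).trans_lt
      (volume_near_frontier_ne_top hn hΩ _).lt_top).ne
  obtain ⟨N, hN, hle⟩ := eigenvalueCount_le_of_strips hn hΩ.isBounded hs J hR htR hρ1 hρ2 hX hfin hY
  refine ⟨N, hN, hle.trans ?_⟩
  rw [mul_assoc (1 + ε), ← weyl_term_eq hn]
  have hκ : 0 ≤ unitBallVol n / 2 ^ n * (R / Real.pi) ^ (n - 1) := by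
    have := unitBallVol_nonneg n
    have := Real.pi_pos
    positivity
  calc _ ≤ unitBallVol n / 2 ^ n * (R / Real.pi) ^ (n - 1) *
        (vol Ω * (R / Real.pi) + ε * (vol Ω * (R / Real.pi))) := by
        refine mul_le_mul_of_nonneg_left ?_ hκ
        linarith
    _ = _ := by ring

theorem vol_div_le {n : ℕ} (hn : 1 ≤ n) {Ω : Set (E n)} (hΩ : IsBoundedLipschitzDomain Ω) :
    vol Ω / (width Ω / (2 * Real.sqrt n)) ≤ 2 * n * Metric.diam Ω ^ (n - 1) := by
  have hw := width_pos hn hΩ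
  have hs : 0 < Real.sqrt n := Real.sqrt_pos.2 (by exact_mod_cast hn)
  have hss : Real.sqrt n * Real.sqrt n = n := Real.mul_self_sqrt (Nat.cast_nonneg n)
  rw [div_le_iff₀ (by positivity)]
  calc vol Ω ≤ Real.sqrt n * width Ω * Metric.diam Ω ^ (n - 1) := vol_le_width hn hΩ
    _ = 2 * (Real.sqrt n * Real.sqrt n) * Metric.diam Ω ^ (n - 1) *
        (width Ω / (2 * Real.sqrt n)) := by field_simp
    _ = _ := by rw [hss]

theorem eigenvalueCount_le_lipschitz {n : ℕ} (hn : 2 ≤ n) {Ω : Set (E n)}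
    (hΩ : IsBoundedLipschitzDomain Ω) {t R ε : ℝ} (hR : 0 < R) (hwR : 1 ≤ width Ω * R)
    (htR : t < R ^ 2) (hε1 : ε < 1)
    (h : thresholdFun Ω ((2 * (n : ℝ) * Metric.diam Ω ^ (n - 1) + surfaceArea Ω) * lipConst Ω)
      (R ^ 2) ≤ ε) :
    ∃ N : ℕ, eigenvalueCount Ω t ≤ (N : Cardinal) ∧
      (N : ℝ) ≤ (1 + ε) * (vol Ω * unitBallVol n / (2 * Real.pi) ^ n) * R ^ n := by
  have hπ := Real.pi_pos
  have hn' : (2 : ℝ) ≤ n := by exact_mod_cast hn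
  have hn1 : 1 ≤ n := by omega
  have hsq : 0 < Real.sqrt n := Real.sqrt_pos.2 (by linarith)
  have hss : Real.sqrt n * Real.sqrt n = n := Real.mul_self_sqrt (Nat.cast_nonneg n)
  have hsq1 : 1 ≤ Real.sqrt n := Real.one_le_sqrt.2 (by linarith)
  have hw := width_pos hn1 hΩ
  have hD : 0 < Metric.diam Ω ^ (n - 1) := pow_pos (diam_pos hn1 hΩ) _
  have hS := surfaceArea_pos hn1 hΩ
  have hC := one_le_lipConst hn1 hΩ
  set D := Metric.diam Ω ^ (n - 1) with hDdef
  set S := surfaceArea Ω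
  set C := lipConst Ω
  obtain ⟨h1, h2⟩ := thresholdFun_le_imp hn hΩ hR hwR hε1 (by
    calc 2 * (n : ℝ) * D = (2 * (n : ℝ) * D + 0) * 1 := by ring
      _ ≤ (2 * (n : ℝ) * D + S) * C := by gcongr) h
  obtain ⟨J, s, hs, hJs, hρ1, hρ2, hL⟩ := exists_dyadic_scale hn hw hR (by
    refine le_trans ?_ h1
    have : 4 * Real.pi * n ^ 2 * 1 ≤ 4 * Real.pi * n ^ 2 * (4 * Real.sqrt n) := by
      gcongr; linarith
    linarith)
  set ℓ := Real.logb 2 (10 * width Ω * R / Real.pi)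
  have hwhalf : Real.sqrt n * (2 ^ J * s) < width Ω := by
    rw [hJs]
    have : Real.sqrt n * (width Ω / (2 * Real.sqrt n)) = width Ω / 2 := by field_simp
    linarith
  -- Maximum-norm distance `t` is Euclidean distance at most `√n t`; the inner strips have `t = 2 *
  -- (2 ^ j * s)`, the shell has `t = s`.
  refine eigenvalueCount_le_of_absorbed hn1 hΩ hs J (X := 2 * Real.sqrt n * C * S)
    (Y := Real.sqrt n * C * S) hR htR hρ1 hρ2 ?_ ?_ ?_
  · intro j hj
    have hle : 2 * (2 ^ j * s) ≤ 2 ^ J * s := by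
      have : (2 : ℝ) ^ (j + 1) ≤ 2 ^ J := pow_le_pow_right₀ (by norm_num) hj
      calc 2 * (2 ^ j * s) = 2 ^ (j + 1) * s := by ring
        _ ≤ _ := by gcongr
    refine (vol_le_of_subset_near_frontier hn1 hΩ (t := Real.sqrt n * (2 * (2 ^ j * s)))
      (by positivity) (lt_of_le_of_lt (by gcongr) hwhalf)
      (innerStrip_subset (by positivity))).trans (le_of_eq (by ring))
  · have hle : s ≤ 2 ^ J * s := le_mul_of_one_le_left hs.le (one_le_pow₀ (by norm_num))
    exact (vol_le_of_subset_near_frontier hn1 hΩ (t := Real.sqrt n * s) (by positivity)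
      (lt_of_le_of_lt (by gcongr) hwhalf) (boundaryShell_subset hs.le)).trans
      (le_of_eq (by ring))
  · refine le_trans ?_ h2
    rw [hJs]
    have hvd := vol_div_le hn1 hΩ
    have hJ0 : (0 : ℝ) ≤ J := Nat.cast_nonneg J
    have hsn : Real.sqrt n ≤ n := by
      calc Real.sqrt n = Real.sqrt n * 1 := by ring
        _ ≤ Real.sqrt n * Real.sqrt n := by gcongr
        _ = n := hss
    calc 2 * (n * Real.sqrt n) * (J * (2 * Real.sqrt n * C * S) +
          vol Ω / (width Ω / (2 * Real.sqrt n))) + 8 * (n * Real.sqrt n) * (Real.sqrt n * C * S)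
        ≤ 2 * (n * Real.sqrt n) * (J * (2 * Real.sqrt n * C * S) + 2 * n * D) +
          8 * (n * Real.sqrt n) * (Real.sqrt n * C * S) := by gcongr
      _ = (n * (Real.sqrt n * Real.sqrt n)) * (C * S) * (4 * J + 8) +
          4 * n ^ 2 * Real.sqrt n * D * 1 := by ring
      _ ≤ (n * (Real.sqrt n * Real.sqrt n)) * (C * S) * (5 * ℓ) +
          10 * n ^ 2 * n * D * (C * ℓ) := by
          gcongr
          · linarith
          · norm_num
          · nlinarith
      _ = _ := by rw [hss]; ring

theorem eigenvalueCount_le_convex {n : ℕ} (hn : 2 ≤ n) {Ω : Set (E n)}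
    (hΩ : IsBoundedLipschitzDomain Ω) (hc : Convex ℝ Ω) {t R ε : ℝ} (hR : 0 < R)
    (hwR : 1 ≤ width Ω * R) (htR : t < R ^ 2) (hε1 : ε < 1)
    (h : thresholdFun Ω (2 * (n : ℝ) * Metric.diam Ω ^ (n - 1)) (R ^ 2) ≤ ε) :
    ∃ N : ℕ, eigenvalueCount Ω t ≤ (N : Cardinal) ∧
      (N : ℝ) ≤ (1 + ε) * (vol Ω * unitBallVol n / (2 * Real.pi) ^ n) * R ^ n := by
  have hπ := Real.pi_pos
  have hn' : (2 : ℝ) ≤ n := by exact_mod_cast hn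
  have hn1 : 1 ≤ n := by omega
  have hsq : 0 < Real.sqrt n := Real.sqrt_pos.2 (by linarith)
  have hss : Real.sqrt n * Real.sqrt n = n := Real.mul_self_sqrt (Nat.cast_nonneg n)
  have hsq1 : 1.4 ≤ Real.sqrt n := Real.le_sqrt_of_sq_le (by norm_num; linarith)
  have hw := width_pos hn1 hΩ
  have hd := diam_pos hn1 hΩ
  have hwd := width_le_diam hn1 hΩ
  obtain ⟨h1, h2⟩ := thresholdFun_le_imp hn hΩ hR hwR hε1 le_rfl h
  obtain ⟨J, s, hs, hJs, hρ1, hρ2, hL⟩ := exists_dyadic_scale hn hw hR (by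
    refine le_trans ?_ h1
    have : 4 * Real.pi * n ^ 2 * 1 ≤ 4 * Real.pi * n ^ 2 * (4 * Real.sqrt n) := by
      gcongr; linarith
    linarith)
  set ℓ := Real.logb 2 (10 * width Ω * R / Real.pi)
  set D := Metric.diam Ω ^ (n - 1) with hDdef
  have hD : 0 < D := by positivity
  -- The smallest cubes are tiny compared with `Ω`, so enlarging the diameter by `2 * s` costs at
  -- most a factor `2` in its `(n - 1)`-st power.
  have hsd : 2 * s / Metric.diam Ω ≤ 1 / (2 * n) := by
    rw [div_le_div_iff₀ hd (by positivity)]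
    rw [div_le_iff₀ hπ] at hρ2
    have h3 : (2 * s * (2 * n)) * R ≤ 1 * Metric.diam Ω * R := by
      calc (2 * s * (2 * n)) * R = 4 * n * (s * R) := by ring
        _ ≤ 4 * n * (4 * (n * Real.sqrt n) * Real.pi) := by gcongr
        _ = 16 * Real.pi * n ^ 2 * Real.sqrt n := by ring
        _ ≤ width Ω * R := h1
        _ ≤ 1 * Metric.diam Ω * R := by rw [one_mul]; gcongr
    exact le_of_mul_le_mul_right h3 hR
  have hD2 : (Metric.diam Ω + 2 * s) ^ (n - 1) ≤ 2 * D := by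
    have e : Metric.diam Ω + 2 * s = (1 + 2 * s / Metric.diam Ω) * Metric.diam Ω := by
      field_simp
    rw [e, mul_pow]
    refine mul_le_mul_of_nonneg_right ?_ hD.le
    refine (pow_le_pow_right₀ ?_ (Nat.sub_le n 1)).trans
      (one_add_div_pow_le_two hn1 (by positivity) hsd)
    have : 0 ≤ 2 * s / Metric.diam Ω := by positivity
    linarith
  refine eigenvalueCount_le_of_absorbed hn1 hΩ hs J (X := 4 * n * D)
    (Y := 8 * n * D) hR htR hρ1 hρ2 ?_ ?_ ?_
  · intro j _
    exact (vol_innerStrip_convex_le hΩ hc (t := 2 * (2 ^ j * s)) (by positivity)).trans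
      (le_of_eq (by ring))
  · refine (vol_boundaryShell_convex_le hΩ hc hs.le).trans ?_
    calc n * (2 * (2 * s) * (Metric.diam Ω + 2 * s) ^ (n - 1)) ≤ n * (2 * (2 * s) * (2 * D)) := by
          gcongr
      _ = _ := by ring
  · refine le_trans ?_ h2
    rw [hJs]
    have hvd := vol_div_le hn1 hΩ
    have hJ0 : (0 : ℝ) ≤ J := Nat.cast_nonneg J
    calc 2 * (n * Real.sqrt n) * (J * (4 * n * D) +
          vol Ω / (width Ω / (2 * Real.sqrt n))) + 8 * (n * Real.sqrt n) * (8 * n * D)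
        ≤ 2 * (n * Real.sqrt n) * (J * (4 * n * D) + 2 * n * D) +
          8 * (n * Real.sqrt n) * (8 * n * D) := by gcongr
      _ = (n ^ 2 * Real.sqrt n * D) * (8 * J + 68) := by ring
      _ ≤ (n ^ 2 * Real.sqrt n * D) * (10 * (Real.sqrt n * ℓ)) := by
          gcongr
          have : 1.4 * (J + 7) ≤ Real.sqrt n * ℓ := by gcongr
          linarith
      _ = 10 * n ^ 2 * (Real.sqrt n * Real.sqrt n) * D * ℓ := by ring
      _ = _ := by rw [hss]; ring


/-! ### The thresholds -/

theorem logFactor_eq {n : ℕ} (Ω : Set (E n)) {Λ : ℝ} :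
    logFactor Ω Λ = Real.pi / 2 + 5 * (n : ℝ) ^ 2 * Real.pi *
      Real.logb 2 (10 * width Ω * Real.sqrt Λ / Real.pi) := rfl

theorem one_le_width_mul_sqrt {n : ℕ} {Ω : Set (E n)} (hw : 0 < width Ω) {Λ : ℝ}
    (h : 1 / width Ω ^ 2 ≤ Λ) : 1 ≤ width Ω * Real.sqrt Λ := by
  have h1 : 1 / width Ω ≤ Real.sqrt Λ := by
    refine Real.le_sqrt_of_sq_le ?_
    rwa [div_pow, one_pow]
  rw [div_le_iff₀ hw] at h1
  linarith

/-- With `x = √Λ` the function is a positive multiple of `(a + b ℓ(x)) / x`, where `ℓ` is the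
logarithm. From `x` to `y` the logarithm grows by at most `1.5 (y - x) / x`, because `1 / log 2 <
1.5`, while `ℓ ≥ 1.6` on this range; so division by `x` wins. -/
theorem thresholdFun_strictAnti {n : ℕ} (hn : 1 ≤ n) {Ω : Set (E n)}
    (hΩ : IsBoundedLipschitzDomain Ω) {P : ℝ} (hP : 0 < P) :
    StrictAntiOn (thresholdFun Ω P) (Ici (1 / width Ω ^ 2)) := by
  have hπ := Real.pi_pos
  have hw := width_pos hn hΩ
  have hV := vol_pos hΩ
  have hn' : (1 : ℝ) ≤ n := by exact_mod_cast hn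
  intro Λ₁ h₁ Λ₂ h₂ hlt
  have h₁' := one_le_width_mul_sqrt hw h₁
  have hΛ₁ : 0 ≤ Λ₁ := le_trans (by positivity) (mem_Ici.1 h₁)
  have hsqrt := Real.sqrt_lt_sqrt hΛ₁ hlt
  set x := Real.sqrt Λ₁ with hx
  set y := Real.sqrt Λ₂ with hy
  have hx0 : 0 < x := pos_of_mul_pos_right (lt_of_lt_of_le one_pos h₁') hw.le
  have hy0 : 0 < y := hx0.trans hsqrt
  have hℓ := logb_scaled_ge h₁'
  have hlog : Real.logb 2 (10 * width Ω * y / Real.pi) =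
      Real.logb 2 (10 * width Ω * x / Real.pi) + Real.logb 2 (y / x) := by
    rw [← Real.logb_mul (by positivity) (by positivity)]
    congr 1
    field_simp
  have hlt2 : x * Real.logb 2 (y / x) ≤ (y - x) * 1.5 := by
    have h1 : Real.log (y / x) ≤ y / x - 1 := Real.log_le_sub_one_of_pos (by positivity)
    have h2 : x * Real.log (y / x) ≤ y - x := by
      calc x * Real.log (y / x) ≤ x * (y / x - 1) := by gcongr
        _ = y - x := by field_simp
    have h3 := Real.log_two_gt_d9
    rw [Real.logb, mul_div_assoc', div_le_iff₀ (by linarith)]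
    nlinarith
  rw [thresholdFun, thresholdFun, logFactor_eq, logFactor_eq, hlog, ← hx, ← hy]
  set ℓ := Real.logb 2 (10 * width Ω * x / Real.pi)
  set δ := Real.logb 2 (y / x)
  rw [div_mul_eq_mul_div, div_mul_eq_mul_div, div_lt_div_iff₀ (by positivity) (by positivity)]
  have hmain : (Real.pi / 2 + 5 * n ^ 2 * Real.pi * (ℓ + δ)) * x <
      (Real.pi / 2 + 5 * n ^ 2 * Real.pi * ℓ) * y := by
    have hβ : 0 < 5 * (n : ℝ) ^ 2 * Real.pi := by positivity
    have h1 : x * δ < (y - x) * ℓ := by nlinarith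
    have h2 := mul_lt_mul_of_pos_left h1 hβ
    nlinarith
  calc P * (Real.pi / 2 + 5 * n ^ 2 * Real.pi * (ℓ + δ)) * (vol Ω * x)
      = (P * vol Ω) * ((Real.pi / 2 + 5 * n ^ 2 * Real.pi * (ℓ + δ)) * x) := by ring
    _ < (P * vol Ω) * ((Real.pi / 2 + 5 * n ^ 2 * Real.pi * ℓ) * y) := by gcongr
    _ = _ := by ring

theorem continuousOn_thresholdFun {n : ℕ} (hn : 1 ≤ n) {Ω : Set (E n)}
    (hΩ : IsBoundedLipschitzDomain Ω) (P : ℝ) :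
    ContinuousOn (thresholdFun Ω P) (Ici (1 / width Ω ^ 2)) := by
  have hπ := Real.pi_pos
  have hw := width_pos hn hΩ
  have hV := vol_pos hΩ
  have hpos : ∀ Λ ∈ Ici (1 / width Ω ^ 2), 0 < Real.sqrt Λ := fun Λ hΛ =>
    Real.sqrt_pos.2 (lt_of_lt_of_le (by positivity) (mem_Ici.1 hΛ))
  have h1 : ContinuousOn (fun Λ : ℝ => Real.sqrt Λ) (Ici (1 / width Ω ^ 2)) :=
    Real.continuous_sqrt.continuousOn
  have h2 : ContinuousOn (fun Λ : ℝ => Real.log (10 * width Ω * Real.sqrt Λ / Real.pi))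
      (Ici (1 / width Ω ^ 2)) :=
    ContinuousOn.log (by fun_prop) fun Λ hΛ => by have := hpos Λ hΛ; positivity
  have h3 : ContinuousOn (fun Λ : ℝ => P / (vol Ω * Real.sqrt Λ)) (Ici (1 / width Ω ^ 2)) :=
    continuousOn_const.div (by fun_prop) fun Λ hΛ => by have := hpos Λ hΛ; positivity
  have h4 : ContinuousOn (fun Λ : ℝ => logFactor Ω Λ) (Ici (1 / width Ω ^ 2)) := by
    simp_rw [logFactor_eq, Real.logb]
    fun_prop
  exact h3.mul h4

open Filter Topology in
theorem tendsto_thresholdFun {n : ℕ} (hn : 1 ≤ n) {Ω : Set (E n)}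
    (hΩ : IsBoundedLipschitzDomain Ω) (P : ℝ) :
    Tendsto (fun x : ℝ => thresholdFun Ω P (x ^ 2)) atTop (𝓝 0) := by
  have hπ := Real.pi_pos
  have hw := width_pos hn hΩ
  have hV := vol_pos hΩ
  set γ := 10 * width Ω / Real.pi with hγ
  have hγ0 : 0 < γ := by positivity
  have h1 : Tendsto (fun x : ℝ => Real.log x / x) atTop (𝓝 0) :=
    Real.isLittleO_log_id_atTop.tendsto_div_nhds_zero
  have h2 : Tendsto (fun x : ℝ => x⁻¹) atTop (𝓝 0) := tendsto_inv_atTop_zero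
  have h3 : Tendsto (fun x : ℝ => P / vol Ω * ((Real.pi / 2 + 5 * (n : ℝ) ^ 2 * Real.pi *
      (Real.log γ / Real.log 2)) * x⁻¹ + 5 * (n : ℝ) ^ 2 * Real.pi / Real.log 2 *
      (Real.log x / x))) atTop (𝓝 0) := by
    simpa using ((h2.const_mul (Real.pi / 2 + 5 * (n : ℝ) ^ 2 * Real.pi *
      (Real.log γ / Real.log 2))).add
      (h1.const_mul (5 * (n : ℝ) ^ 2 * Real.pi / Real.log 2))).const_mul (P / vol Ω)
  refine h3.congr' ?_
  filter_upwards [eventually_gt_atTop 0] with x hx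
  have e : Real.log (10 * width Ω * x / Real.pi) = Real.log γ + Real.log x := by
    rw [← Real.log_mul hγ0.ne' hx.ne', hγ]
    congr 1; ring
  have hl2 : Real.log 2 ≠ 0 := (Real.log_pos (by norm_num)).ne'
  rw [thresholdFun, logFactor_eq, Real.sqrt_sq hx.le, Real.logb, e]
  field_simp
  ring

/-- At the left endpoint both factors are at least `1`: the first by the bound of the volume by
width and diameter, the second because `π / 2 > 1`. -/
theorem one_le_thresholdFun {n : ℕ} (hn : 1 ≤ n) {Ω : Set (E n)}
    (hΩ : IsBoundedLipschitzDomain Ω) {P : ℝ}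
    (hP : 2 * (n : ℝ) * Metric.diam Ω ^ (n - 1) ≤ P) :
    1 ≤ thresholdFun Ω P (1 / width Ω ^ 2) := by
  have hπ := Real.pi_pos
  have hπ3 := Real.pi_gt_three
  have hw := width_pos hn hΩ
  have hV := vol_pos hΩ
  have hn' : (1 : ℝ) ≤ n := by exact_mod_cast hn
  have hsq : Real.sqrt n ≤ n := Real.sqrt_le_iff.2 ⟨by linarith, by nlinarith⟩
  have hD : 0 < Metric.diam Ω ^ (n - 1) := pow_pos (diam_pos hn hΩ) _
  have e : Real.sqrt (1 / width Ω ^ 2) = 1 / width Ω := by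
    rw [show 1 / width Ω ^ 2 = (1 / width Ω) ^ 2 by rw [div_pow, one_pow],
      Real.sqrt_sq (by positivity)]
  have hℓ := logb_scaled_ge (w := width Ω) (R := 1 / width Ω) (by field_simp; exact le_rfl)
  rw [thresholdFun, logFactor_eq, e]
  set ℓ := Real.logb 2 (10 * width Ω * (1 / width Ω) / Real.pi)
  have h1 : 1 ≤ Real.pi / 2 + 5 * n ^ 2 * Real.pi * ℓ := by
    have : 0 ≤ 5 * (n : ℝ) ^ 2 * Real.pi * ℓ := by positivity
    linarith
  have h2 : 1 ≤ P / (vol Ω * (1 / width Ω)) := by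
    rw [one_le_div (by positivity), mul_one_div, div_le_iff₀ hw]
    calc vol Ω ≤ Real.sqrt n * width Ω * Metric.diam Ω ^ (n - 1) := vol_le_width hn hΩ
      _ ≤ (2 * n) * width Ω * Metric.diam Ω ^ (n - 1) := by gcongr; linarith
      _ = (2 * n * Metric.diam Ω ^ (n - 1)) * width Ω := by ring
      _ ≤ _ := by gcongr
  exact one_le_mul_of_one_le_of_one_le h2 h1

theorem existsUnique_threshold {n : ℕ} (hn : 1 ≤ n) {Ω : Set (E n)}
    (hΩ : IsBoundedLipschitzDomain Ω) {P : ℝ}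
    (hP : 2 * (n : ℝ) * Metric.diam Ω ^ (n - 1) ≤ P) {ε : ℝ} (hε0 : 0 < ε) (hε1 : ε < 1) :
    ∃! Λ : ℝ, 1 / width Ω ^ 2 ≤ Λ ∧ thresholdFun Ω P Λ = ε := by
  have hw := width_pos hn hΩ
  have hP0 : 0 < P := by
    have hD : 0 < Metric.diam Ω ^ (n - 1) := pow_pos (diam_pos hn hΩ) _
    have hn' : (0 : ℝ) < n := by exact_mod_cast hn
    exact lt_of_lt_of_le (by positivity) hP
  have hanti := thresholdFun_strictAnti hn hΩ hP0
  obtain ⟨x, hx1, hx2⟩ := (((tendsto_thresholdFun hn hΩ P).eventually (gt_mem_nhds hε0)).and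
    (Filter.eventually_ge_atTop (1 / width Ω))).exists
  have hle : 1 / width Ω ^ 2 ≤ x ^ 2 := by
    have : (1 / width Ω) ^ 2 ≤ x ^ 2 := pow_le_pow_left₀ (by positivity) hx2 2
    rwa [div_pow, one_pow] at this
  obtain ⟨Λ, hΛ, hΛε⟩ := intermediate_value_Icc' hle
    ((continuousOn_thresholdFun hn hΩ P).mono Icc_subset_Ici_self)
    (show ε ∈ Icc _ _ from ⟨hx1.le, hε1.le.trans (one_le_thresholdFun hn hΩ hP)⟩)
  exact ⟨Λ, ⟨hΛ.1, hΛε⟩, fun Λ' h => hanti.injOn h.1 hΛ.1 (h.2.trans hΛε.symm)⟩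

theorem isThreshold_iff {n : ℕ} {Ω : Set (E n)} {ε Λ : ℝ} :
    IsThreshold Ω ε Λ ↔ 1 / width Ω ^ 2 ≤ Λ ∧ thresholdFun Ω
      ((2 * (n : ℝ) * Metric.diam Ω ^ (n - 1) + surfaceArea Ω) * lipConst Ω) Λ = ε := by
  rw [IsThreshold, thresholdFun, div_mul_eq_mul_div]

theorem isConvexThreshold_iff {n : ℕ} {Ω : Set (E n)} {ε Λ : ℝ} :
    IsConvexThreshold Ω ε Λ ↔ 1 / width Ω ^ 2 ≤ Λ ∧ thresholdFun Ω
      (2 * (n : ℝ) * Metric.diam Ω ^ (n - 1)) Λ = ε := Iff.rfl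

theorem lt_lipschitz_factor {n : ℕ} (hn : 1 ≤ n) {Ω : Set (E n)}
    (hΩ : IsBoundedLipschitzDomain Ω) : 2 * (n : ℝ) * Metric.diam Ω ^ (n - 1) <
      (2 * (n : ℝ) * Metric.diam Ω ^ (n - 1) + surfaceArea Ω) * lipConst Ω := by
  have hS := surfaceArea_pos hn hΩ
  have hC := one_le_lipConst hn hΩ
  have hD : 0 < Metric.diam Ω ^ (n - 1) := pow_pos (diam_pos hn hΩ) _
  calc 2 * (n : ℝ) * Metric.diam Ω ^ (n - 1)
      < (2 * (n : ℝ) * Metric.diam Ω ^ (n - 1) + surfaceArea Ω) * 1 := by linarith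
    _ ≤ _ := by gcongr

/-! ### From the counting function to individual eigenvalues. -/

theorem eigenvalueCount_mono {n : ℕ} (Ω : Set (E n)) {t t' : ℝ} (h : t ≤ t') :
    eigenvalueCount Ω t ≤ eigenvalueCount Ω t' :=
  Submodule.rank_mono (iSup₂_le fun μ hμ => le_iSup₂_of_le μ (hμ.trans h) le_rfl)

theorem le_eigenvalueCount {n : ℕ} {Ω : Set (E n)} {k : ℕ} {t : ℝ}
    (hpos : 0 < dirichletEigenvalue Ω k) (ht : dirichletEigenvalue Ω k < t) :
    (k : Cardinal) ≤ eigenvalueCount Ω t := by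
  -- An empty set would give the default infimum `0`, against positivity; so the existence of a
  -- `k`-th eigenvalue need not be proved.
  have hne : {t : ℝ | (k : Cardinal) ≤ eigenvalueCount Ω t}.Nonempty := by
    rw [Set.nonempty_iff_ne_empty]
    intro h
    rw [dirichletEigenvalue, h, Real.sInf_empty] at hpos
    exact lt_irrefl _ hpos
  obtain ⟨t', ht', hlt⟩ := exists_lt_of_csInf_lt hne ht
  exact le_trans ht' (eigenvalueCount_mono Ω hlt.le)

open Filter Topology in
/-- If the counting bound holds at all frequencies above `√Λ` then so does the bound on `k`. -/
theorem polyaUpToLoss_of_count {n : ℕ} {Ω : Set (E n)} {ε Λ : ℝ} (hΛ : 0 < Λ)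
    (h : ∀ R t : ℝ, 0 < R → Λ ≤ R ^ 2 → t < R ^ 2 →
      ∃ N : ℕ, eigenvalueCount Ω t ≤ (N : Cardinal) ∧
      (N : ℝ) ≤ (1 + ε) * (vol Ω * unitBallVol n / (2 * Real.pi) ^ n) * R ^ n) :
    PolyaUpToLoss Ω ε Λ := by
  intro k _ hk
  set μ := dirichletEigenvalue Ω k with hμ
  have hμ0 : 0 < μ := hΛ.trans_le hk
  have hs0 : 0 < Real.sqrt μ := Real.sqrt_pos.2 hμ0
  have hpow : μ ^ ((n : ℝ) / 2) = Real.sqrt μ ^ n := by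
    rw [Real.sqrt_eq_rpow, ← Real.rpow_natCast, ← Real.rpow_mul hμ0.le]
    congr 1; ring
  rw [hpow]
  -- The count is known only for `t < R²`. Any `R > √μ` leaves room for `t` with `μ < t < R²`, and
  -- the bound survives the limit `R → √μ`.
  have hlim : Tendsto (fun R : ℝ => (1 + ε) * (vol Ω * unitBallVol n / (2 * Real.pi) ^ n) * R ^ n)
      (𝓝[>] (Real.sqrt μ)) (𝓝 ((1 + ε) * (vol Ω * unitBallVol n / (2 * Real.pi) ^ n) *
        Real.sqrt μ ^ n)) := by
    refine Tendsto.mono_left ?_ nhdsWithin_le_nhds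
    exact Continuous.tendsto (by fun_prop) _
  refine ge_of_tendsto hlim ?_
  filter_upwards [self_mem_nhdsWithin] with R hR
  have hR' : Real.sqrt μ < R := hR
  have hμR : μ < R ^ 2 := (Real.sqrt_lt' (hs0.trans hR')).1 hR'
  obtain ⟨t, ht1, ht2⟩ := exists_between hμR
  obtain ⟨N, hN, hNle⟩ := h R t (hs0.trans hR') (hk.trans hμR.le) ht2
  have hkN : (k : Cardinal) ≤ (N : Cardinal) := (le_eigenvalueCount hμ0 ht1).trans hN
  have : k ≤ N := by exact_mod_cast hkN
  exact le_trans (by exact_mod_cast this) hNle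

end DirichletPolya

end


theorem mainTheorem1 (n : ℕ) (hn : 2 ≤ n) (Ω : Set (DirichletPolya.E n))
    (hΩ : DirichletPolya.IsBoundedLipschitzDomain Ω) (ε : ℝ) (hε0 : 0 < ε) (hε1 : ε < 1) :
    ((∃! Λ : ℝ, DirichletPolya.IsThreshold Ω ε Λ) ∧
      ∀ Λ : ℝ, DirichletPolya.IsThreshold Ω ε Λ → DirichletPolya.PolyaUpToLoss Ω ε Λ) ∧
    (Convex ℝ Ω →
      (∃! Λ : ℝ, DirichletPolya.IsConvexThreshold Ω ε Λ) ∧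
      ∀ Λ : ℝ, DirichletPolya.IsConvexThreshold Ω ε Λ →
        (∀ Λ' : ℝ, DirichletPolya.IsThreshold Ω ε Λ' → Λ < Λ') ∧
          DirichletPolya.PolyaUpToLoss Ω ε Λ) := by
  open DirichletPolya in
  have hn1 : 1 ≤ n := by omega
  have hw := width_pos hn1 hΩ
  have hP := lt_lipschitz_factor hn1 hΩ
  have hD : 0 < 2 * (n : ℝ) * Metric.diam Ω ^ (n - 1) := by
    have := diam_pos hn1 hΩ
    have : (0 : ℝ) < n := by exact_mod_cast hn1
    positivity
  simp only [isThreshold_iff, isConvexThreshold_iff]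
  have hpos : ∀ {Λ : ℝ}, 1 / width Ω ^ 2 ≤ Λ → 0 < Λ := fun h =>
    lt_of_lt_of_le (by positivity) h
  have hwR : ∀ {Λ R : ℝ}, 1 / width Ω ^ 2 ≤ Λ → 0 < R → Λ ≤ R ^ 2 → 1 ≤ width Ω * R := by
    intro Λ R h1 hR h2
    have := one_le_width_mul_sqrt hw (h1.trans h2)
    rwa [Real.sqrt_sq hR.le] at this
  have hdec : ∀ {P Λ R : ℝ}, 0 < P → 1 / width Ω ^ 2 ≤ Λ ∧ thresholdFun Ω P Λ = ε → Λ ≤ R ^ 2 →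
      thresholdFun Ω P (R ^ 2) ≤ ε := fun hP0 h hΛR =>
    ((thresholdFun_strictAnti hn1 hΩ hP0).antitoneOn h.1 (h.1.trans hΛR) hΛR).trans h.2.le
  refine ⟨⟨existsUnique_threshold hn1 hΩ hP.le hε0 hε1, fun Λ hΛ => ?_⟩, fun hc =>
    ⟨existsUnique_threshold hn1 hΩ le_rfl hε0 hε1, fun Λ hΛ => ⟨fun Λ' hΛ' => ?_, ?_⟩⟩⟩
  · refine polyaUpToLoss_of_count (hpos hΛ.1) fun R t hR hΛR htR => ?_
    exact eigenvalueCount_le_lipschitz hn hΩ hR (hwR hΛ.1 hR hΛR) htR hε1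
      (hdec (hD.trans hP) hΛ hΛR)
  -- If `Λ' ≤ Λ`, monotonicity makes the convex expression at `Λ'` at least `ε`. The Lipschitz
  -- expression equals `ε` there although its prefactor is strictly larger, which is impossible
  -- since `logFactor` is positive.
  · by_contra hcon
    push Not at hcon
    have h1 := (thresholdFun_strictAnti hn1 hΩ hD).antitoneOn hΛ'.1 hΛ.1 hcon
    rw [hΛ.2, ← hΛ'.2] at h1
    have hs := one_le_width_mul_sqrt hw hΛ'.1
    have hsq : 0 < Real.sqrt Λ' := Real.sqrt_pos.2 (hpos hΛ'.1)
    have hV := vol_pos hΩ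
    have hlf : 0 < logFactor Ω Λ' := by
      have h2 := logb_scaled_ge hs
      have := Real.pi_pos
      rw [logFactor_eq]
      have : 0 ≤ Real.logb 2 (10 * width Ω * Real.sqrt Λ' / Real.pi) := by linarith
      positivity
    refine absurd h1 (not_le.2 ?_)
    rw [thresholdFun, thresholdFun]
    gcongr
  · refine polyaUpToLoss_of_count (hpos hΛ.1) fun R t hR hΛR htR => ?_
    exact eigenvalueCount_le_convex hn hΩ hc hR (hwR hΛ.1 hR hΛR) htR hε1 (hdec hD hΛ hΛR)
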